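/- **The algorithm EDS-G.** Let $G=(V,E)$ be a finite simple graph, $V=\{1,\dots,n\}$, $m=|E|$. Write $N_G(u)$ for the set of neighbours of $u$, $N_G[u]=N_G(u)\cup\{u\}$ and $N_G[U]=\bigcup_{u\in U}N_G[u]$. A set $D\subseteq V$ is a dominating set if every vertex is in $D$ or has a neighbour in $D$. The algorithm EDS-G sets $f_u\leftarrow\mathrm{False}$ for all $u\in V$, lets $C$ be the set of non-isolated vertices, removes the isolated vertices from $G$, and calls $\mathrm{AllChildren}(X=V,C,f,G)$: * $\mathrm{AllChildren}(X,C,f,G)$: output $X$. While $C\ne\emptyset$: let $v$ be the largest vertex of $C$; compute $(C',f',G')=\mathrm{CandG}(v,C,f,G)$; call $\mathrm{AllChildren}(X\setminus\{v\},C',f',G')$; then, for each $u\in N_G(v)$, set $f_u\leftarrow\mathrm{True}$ if $u\in C$ and remove $u$ from $G$ if $u\notin C$; finally remove $v$ from $G$ and from $C$. * $\mathrm{CandG}(v,C,f,G)$: let $\mathrm{Del}$ be the set of all $w\neq v$ such that some $u\in N_G[v]$ has $f_u=\mathrm{False}$ and $N_G[u]\cap X=\{w,v\}$ (the vertices of the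 current graph $G$ that lie in $X$ are exactly those in $C$). Put $C'=C\setminus(\mathrm{Del}\cup\{v\})$. For each $u\in N_G[\mathrm{Del}]$, set $f_u\leftarrow\mathrm{True}$, and remove $u$ from $G$ if $u\notin C'$. If $f_v=\mathrm{True}$, remove $v$ from $G$. Return $C'$ and the new $f$ and $G$. Recursive calls and $\mathrm{CandG}$ do not change the caller's data. EDS-G is implemented on a unit-cost word RAM with recursive procedures, with $C$ and the adjacency lists of the current $G$ stored as doubly linked lists, and with changes undone from a log after each recursive call. The input is an arbitrary list of the edges. Each solution is output as its symmetric difference to the previously output one (to $\emptyset$ for the first), followed by an end mark. **Theorem.** There is an absolute constant $c$ such that for every graph $G$ on $\{1,\dots,n\}$ with $m$ edges and girth at least nine (acyclic graphs have girth $\infty$) and every list of its edges, the following holds. Let $N$ be the number of dominating sets of $G$. 1. EDS-G halts and outputs every dominating set of $G$ exactly once, and nothing else. 2. It runs in $O(n+m)$ space: it needs at most $c(n+m+1)$ memory cells, at most $c(n+m+1)$ nested procedure calls (each activation record consisting of a constant number of words), and all words it handles are natural numbers at most $c(n+m+1)$. 3. It runs in $O(1)$ amortized time per solution: its total number of steps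 is at most $c\,(N+n+m)$, and at most $c\,N$ if $G$ has no isolated vertex. -/

import Mathlib

/-! ## Dominating sets and edge lists -/

/-- `D` is a dominating set of `G`: every vertex is in `D` or has a neighbour in `D`. -/
def SimpleGraph.IsDominatingSet {V : Type*} (G : SimpleGraph V) (D : Finset V) : Prop :=
  ∀ v, v ∈ D ∨ ∃ u ∈ D, G.Adj u v

/-- `es` lists every edge of `G` exactly once (in any order, each edge in any direction). -/
def SimpleGraph.IsEdgeList {V : Type*} (G : SimpleGraph V) (es : List (V × V)) : Prop :=
  (es.map fun e => s(e.1, e.2)).Nodup ∧ ∀ e : Sym2 V, e ∈ es.map (fun e => s(e.1, e.2)) ↔ e ∈ G.edgeSet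

/-! ## A word RAM with recursive procedures

A machine of size `S` has a read-only input tape, a write-only output tape, `S` memory cells
(addresses `0, …, S - 1`, initially `0`), words in `0, …, S`, and a call stack of at most `S`
activation records.  Registers are local to an activation (one fixed finite set of registers per
program), the memory is global.  So a machine of size `S` occupies `O(S)` words of `O(log S)` bits. -/

namespace RAM

/-- The binary operations of the machine; `sub` is truncated, and `eq`, `ne` return `1` or `0`. -/
inductive Op
  | add | sub | mul | eq | ne

def Op.eval : Op → ℕ → ℕ → ℕ
  | .add, x, y => x + y
  | .sub, x, y => x - y
  | .mul, x, y => x * y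
  | .eq, x, y => if x = y then 1 else 0
  | .ne, x, y => if x = y then 0 else 1

/-- Expressions over the registers `R`: constants, registers, the input cell or the memory cell
at a computed address, and binary operations. -/
inductive Expr (R : Type)
  | num (k : ℕ)
  | reg (r : R)
  | inp (e : Expr R)
  | mem (e : Expr R)
  | bin (o : Op) (e₁ e₂ : Expr R)

namespace Expr

variable {R : Type}

instance (k : ℕ) : OfNat (Expr R) k := ⟨.num k⟩
instance : Coe R (Expr R) := ⟨.reg⟩
instance : Add (Expr R) := ⟨.bin .add⟩
instance : Sub (Expr R) := ⟨.bin .sub⟩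
instance : Mul (Expr R) := ⟨.bin .mul⟩

def eval (input : List ℕ) (ρ : R → ℕ) (μ : ℕ → ℕ) : Expr R → ℕ
  | num k => k
  | reg r => ρ r
  | inp e => input.getD (e.eval input ρ μ) 0
  | mem e => μ (e.eval input ρ μ)
  | bin o e₁ e₂ => o.eval (e₁.eval input ρ μ) (e₂.eval input ρ μ)

/-- The evaluation of the expression on a machine of size `S` is legal: every intermediate
value is at most `S`, and only existing memory cells are read. -/
def Fits (S : ℕ) (input : List ℕ) (ρ : R → ℕ) (μ : ℕ → ℕ) : Expr R → Prop
  | num k => k ≤ S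
  | reg r => ρ r ≤ S
  | inp e => e.Fits S input ρ μ ∧ input.getD (e.eval input ρ μ) 0 ≤ S
  | mem e => e.Fits S input ρ μ ∧ e.eval input ρ μ < S ∧ μ (e.eval input ρ μ) ≤ S
  | bin o e₁ e₂ => e₁.Fits S input ρ μ ∧ e₂.Fits S input ρ μ ∧
      o.eval (e₁.eval input ρ μ) (e₂.eval input ρ μ) ≤ S

/-- The number of elementary operations in an evaluation of the expression. -/
def cost : Expr R → ℕ
  | num _ => 1
  | reg _ => 1
  | inp e => e.cost + 1
  | mem e => e.cost + 1
  | bin _ e₁ e₂ => e₁.cost + e₂.cost + 1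

end Expr

/-- Statements over the registers `R` and the procedure names `P`.  In conditions, `0` means
false and every other word means true. -/
inductive Stmt (R P : Type)
  | skip
  | set (r : R) (e : Expr R)
  | store (addr e : Expr R)
  | emit (e : Expr R)
  | seq (s₁ s₂ : Stmt R P)
  | ite (e : Expr R) (s₁ s₂ : Stmt R P)
  | while (e : Expr R) (s : Stmt R P)
  | call (p : P) (e : Expr R)

/-- Sequential composition of a list of statements. -/
def block {R P : Type} : List (Stmt R P) → Stmt R P
  | [] => .skip
  | s :: l => .seq s (block l)

/-- A program: its registers, its procedures with their bodies, the register that receives the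
argument of a call, and the main statement. -/
structure Program (R P : Type) where
  body : P → Stmt R P
  param : R
  main : Stmt R P

/-- `Exec prog S input d s ρ μ t out ρ' μ'`: on a machine of size `S` with `d` unused activation
records, the statement `s`, started with registers `ρ` and memory `μ`, terminates after `t` steps,
has then written `out` on the output tape, and leaves registers `ρ'` and memory `μ'`.
There is exactly one rule for each kind of statement and each truth value of its condition. -/
inductive Exec {R P : Type} [DecidableEq R] (prog : Program R P) (S : ℕ) (input : List ℕ) :
    ℕ → Stmt R P → (R → ℕ) → (ℕ → ℕ) → ℕ → List ℕ → (R → ℕ) → (ℕ → ℕ) → Prop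
  | skip {d ρ μ} : Exec prog S input d .skip ρ μ 1 [] ρ μ
  | set {d r e ρ μ} (h : e.Fits S input ρ μ) :
      Exec prog S input d (.set r e) ρ μ (e.cost + 1) []
        (Function.update ρ r (e.eval input ρ μ)) μ
  | store {d a e ρ μ} (ha : a.Fits S input ρ μ) (haS : a.eval input ρ μ < S)
      (he : e.Fits S input ρ μ) :
      Exec prog S input d (.store a e) ρ μ (a.cost + e.cost + 1) []
        ρ (Function.update μ (a.eval input ρ μ) (e.eval input ρ μ))
  | emit {d e ρ μ} (h : e.Fits S input ρ μ) :
      Exec prog S input d (.emit e) ρ μ (e.cost + 1) [e.eval input ρ μ] ρ μ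
  | seq {d s₁ s₂ ρ μ t₁ o₁ ρ₁ μ₁ t₂ o₂ ρ₂ μ₂}
      (h₁ : Exec prog S input d s₁ ρ μ t₁ o₁ ρ₁ μ₁)
      (h₂ : Exec prog S input d s₂ ρ₁ μ₁ t₂ o₂ ρ₂ μ₂) :
      Exec prog S input d (.seq s₁ s₂) ρ μ (t₁ + t₂) (o₁ ++ o₂) ρ₂ μ₂
  | iteTrue {d e s₁ s₂ ρ μ t o ρ' μ'} (h : e.Fits S input ρ μ) (he : e.eval input ρ μ ≠ 0)
      (hs : Exec prog S input d s₁ ρ μ t o ρ' μ') :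
      Exec prog S input d (.ite e s₁ s₂) ρ μ (e.cost + 1 + t) o ρ' μ'
  | iteFalse {d e s₁ s₂ ρ μ t o ρ' μ'} (h : e.Fits S input ρ μ) (he : e.eval input ρ μ = 0)
      (hs : Exec prog S input d s₂ ρ μ t o ρ' μ') :
      Exec prog S input d (.ite e s₁ s₂) ρ μ (e.cost + 1 + t) o ρ' μ'
  | whileTrue {d e s ρ μ t₁ o₁ ρ₁ μ₁ t₂ o₂ ρ₂ μ₂} (h : e.Fits S input ρ μ)
      (he : e.eval input ρ μ ≠ 0)
      (h₁ : Exec prog S input d s ρ μ t₁ o₁ ρ₁ μ₁)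
      (h₂ : Exec prog S input d (.while e s) ρ₁ μ₁ t₂ o₂ ρ₂ μ₂) :
      Exec prog S input d (.while e s) ρ μ (e.cost + 1 + t₁ + t₂) (o₁ ++ o₂) ρ₂ μ₂
  | whileFalse {d e s ρ μ} (h : e.Fits S input ρ μ) (he : e.eval input ρ μ = 0) :
      Exec prog S input d (.while e s) ρ μ (e.cost + 1) [] ρ μ
  | call {d p e ρ μ t o ρ' μ'} (h : e.Fits S input ρ μ)
      (hs : Exec prog S input d (prog.body p)
        (Function.update (fun _ => 0) prog.param (e.eval input ρ μ)) μ t o ρ' μ') :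
      Exec prog S input (d + 1) (.call p e) ρ μ (e.cost + 1 + t) o ρ μ'

/-- On a machine of size `S`, the program halts on `input` after `t` steps with output `out`. -/
def Program.Runs {R P : Type} [DecidableEq R] (prog : Program R P) (S : ℕ) (input : List ℕ)
    (t : ℕ) (out : List ℕ) : Prop :=
  ∃ ρ' μ', Exec prog S input S prog.main (fun _ => 0) (fun _ => 0) t out ρ' μ'

end RAM

/-! ## The algorithm EDS-G

The vertex `i : Fin n` is the word `i + 1`.  The input tape holds `n`, `m` and the ends of the
`m` edges. -/

namespace EDSG

open RAM

def encode (n : ℕ) (es : List (Fin n × Fin n)) : List ℕ :=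
  n :: es.length :: es.flatMap fun e => [(e.1 : ℕ) + 1, (e.2 : ℕ) + 1]

/-- How the output tape is read.  Each solution is written as its difference to the previous one
(to `∅` at the start): the word `i + 1` inserts the vertex `i` into the current set or removes it
from there, and the word `0` declares the current set a solution. -/
def decode {n : ℕ} (D : Finset (Fin n)) : List ℕ → List (Finset (Fin n))
  | [] => []
  | 0 :: l => D :: decode D l
  | (k + 1) :: l => decode (symmDiff D (Finset.univ.filter fun i : Fin n => (i : ℕ) = k)) l

/-- The registers. -/
inductive Reg
  | p | n | m | i | v | mark | go | a | b | u | w | x | del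
  deriving DecidableEq

/-- The procedures. -/
inductive Proc
  | undo | delete | drop | candG | allChildren

open Reg

abbrev E := Expr Reg
abbrev C := Stmt Reg Proc

def eq (e₁ e₂ : E) : E := .bin .eq e₁ e₂
def ne (e₁ e₂ : E) : E := .bin .ne e₁ e₂

/-- One-armed conditional. -/
def ifThen (e : E) (s : List C) : C := .ite e (block s) .skip

def whileDo (e : E) (s : List C) : C := .while e (block s)

/-! The memory is cut into records of ten cells.  Record `0` holds the top of the log (cell `0`)
and is the sentinel of the candidate list.  The records `1, …, n` are the vertices, the records
`n + 1, …, n + 2 m` the arcs (each edge gives two arcs), and the log starts after them.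

The current graph `G` is stored in circular doubly linked adjacency lists: the record of a vertex
`u` is the sentinel of a list of arcs `a`, and `head a` is the neighbour of `u` to which `a` leads;
`twin a` is the opposite arc.  The current candidate set `C` is stored in a circular doubly linked
list, sorted by index. -/

/-- The address of the cell number `f` in the record `e`. -/
def addr (f : ℕ) (e : E) : E := .num 10 * e + .num f

def fld (f : ℕ) (e : E) : E := .mem (addr f e)

/-- Next and previous arc in an adjacency list. -/
abbrev nxt := 0
abbrev prv := 1
/-- (vertices, sentinel) Next (larger) and previous (smaller) candidate. -/
abbrev cnext := 2
abbrev cprev := 3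
/-- (vertices) `u ∈ C`. -/
abbrev inC := 4
/-- (vertices) The flag `f_u`. -/
abbrev flag := 5
/-- (vertices) The number `|N_G[u] ∩ X|`; a vertex of `G` belongs to `X` iff it belongs to `C`. -/
abbrev cnt := 6
/-- (vertices) `u` has not been removed from `G`. -/
abbrev inG := 7
/-- (vertices) Membership in `Del₁ ∪ Del₂`, and the link to the next vertex of this set. -/
abbrev marked := 8
abbrev link := 9
/-- (arcs) The end of the arc, and the opposite arc. -/
abbrev head := 2
abbrev twin := 3

/-- The top of the log. -/
def top : E := .mem 0

/-- Record the old content of the cell `f` of record `e` in the log, then overwrite it with `e'`. -/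
def upd (f : ℕ) (e e' : E) : C := block
  [ .store top (addr f e),
    .store (top + 1) (fld f e),
    .store 0 (top + 2),
    .store (addr f e) e' ]

/-- `undo(p)`: restore the memory as it was when the top of the log was `p`. -/
def undoBody : C :=
  whileDo (ne top p)
    [ .store 0 (top - 2),
      .store (.mem top) (.mem (top + 1)) ]

/-- `delete(p)`: `G ← G \ {p}`. -/
def deleteBody : C :=
  ifThen (fld inG p)
    [ upd inG p 0,
      .set a (fld nxt p),
      whileDo (ne a p)
        [ .set b (fld twin a),
          upd nxt (fld prv b) (fld nxt b),
          upd prv (fld nxt b) (fld prv b),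
          .set a (fld nxt a) ] ]

/-- `drop(p)`: `C ← C \ {p}`, and `p` no longer counts in `|N_G[u] ∩ X|`. -/
def dropBody : C := block
  [ upd cnext (fld cprev p) (fld cnext p),
    upd cprev (fld cnext p) (fld cprev p),
    upd inC p 0,
    upd cnt p (fld cnt p - 1),
    .set a (fld nxt p),
    whileDo (ne a p)
      [ upd cnt (fld head a) (fld cnt (fld head a) - 1),
        .set a (fld nxt a) ] ]

/-- `candG(v)` with `v` in the register `p`: from `C`, the flags and `G` for `(X, v)`, compute
`C`, the flags and `G` for `Y = X \ {v}`. -/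
def candGBody : C := block
  [ -- collect `Del₁ ∪ Del₂` in a linked list that starts at `del`
    .set del 0,
    .set u p,
    .set a p,
    .set go 1,
    whileDo go
      [ -- `u` runs through `N_G[v]`
        ifThen (eq (fld flag u) 0)
          [ ifThen (eq (fld cnt u) 2)
              [ -- now `N_G[u] ∩ X = {w, v}` for some `w ≠ v`; find `w`
                .set w u,
                ifThen (eq ((fld inC u) * (ne u p)) 0)
                  [ .set b (fld nxt u),
                    whileDo (eq ((fld inC (fld head b)) * (ne (fld head b) p)) 0)
                      [ .set b (fld nxt b) ],
                    .set w (fld head b) ],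
                ifThen (eq (fld marked w) 0)
                  [ upd marked w 1,
                    upd link w del,
                    .set del w ] ] ],
        .set a (fld nxt a),
        .set u (fld head a),
        .set go (ne a p) ],
    -- `C ← C \ (Del₁ ∪ Del₂ ∪ {v})`
    .call .drop p,
    .set x del,
    whileDo x
      [ .call .drop x,
        .set x (fld link x) ],
    -- `f_u ← True` for the neighbours `u` of `Del₁ ∪ Del₂`, and remove from `G` the vertices
    -- outside `C` in the closed neighbourhood of this set
    whileDo del
      [ upd marked del 0,
        .set a (fld nxt del),
        whileDo (ne a del)
          [ .set u (fld head a),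
            upd flag u 1,
            ifThen (eq (fld inC u) 0) [ .call .delete u ],
            .set a (fld nxt a) ],
        .call .delete del,
        .set del (fld link del) ],
    ifThen (fld flag p) [ .call .delete p ] ]

/-- `allChildren`, for the current solution `X`, candidate set `C`, flags and graph `G`. -/
def allChildrenBody : C := block
  [ .emit 0,
    .set v (fld cprev 0),
    whileDo v
      [ -- `v` is the largest vertex of `C`
        .set mark top,
        .call .candG v,
        .emit v,
        .call .allChildren 0,
        .call .undo mark,
        .emit v,
        .set a (fld nxt v),
        whileDo (ne a v)
          [ .set u (fld head a),
            .ite (fld inC u) (upd flag u 1) (.call .delete u),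
            .set a (fld nxt a) ],
        .call .drop v,
        .call .delete v,
        .set v (fld cprev 0) ] ]

/-- Put the arc in register `a`, which leads to `w`, into the adjacency list of `u`. -/
def insertArc (a u w : E) : List C :=
  [ .store (addr head a) w,
    .store (addr nxt a) (fld nxt u),
    .store (addr prv a) u,
    .store (addr prv (fld nxt u)) a,
    .store (addr nxt u) a,
    .store (addr cnt u) (fld cnt u + 1) ]

/-- Build the data structures for `X = V`, and write `V` on the output tape, then start the
recursion.  The candidates for `V` are the vertices that are not isolated. -/
def mainStmt : C := block
  [ .set n (.inp 0),
    .set m (.inp 1),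
    .store 0 (10 * (n + 2 * m + 1)),
    .set i 0,
    whileDo (ne i n)
      [ .set i (i + 1),
        .emit i,
        .store (addr nxt i) i,
        .store (addr prv i) i ],
    .set i 0,
    whileDo (ne i m)
      [ .set u (.inp (2 * i + 2)),
        .set w (.inp (2 * i + 3)),
        .set a (n + 2 * i + 1),
        .set b (n + 2 * i + 2),
        .store (addr twin a) b,
        .store (addr twin b) a,
        block (insertArc a u w),
        block (insertArc b w u),
        .set i (i + 1) ],
    .set i 0,
    whileDo (ne i n)
      [ .set i (i + 1),
        ifThen (ne (fld nxt i) i)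
          [ .store (addr inG i) 1,
            .store (addr inC i) 1,
            .store (addr cnt i) (fld cnt i + 1),
            .store (addr cprev i) (fld cprev 0),
            .store (addr cnext (fld cprev 0)) i,
            .store (addr cprev 0) i ] ],
    .call .allChildren 0 ]

/-- The algorithm EDS-G. -/
def edsG : Program Reg Proc where
  body
    | .undo => undoBody
    | .delete => deleteBody
    | .drop => dropBody
    | .candG => candGBody
    | .allChildren => allChildrenBody
  param := p
  main := mainStmt

end EDSG

/-! A state of the algorithm is a solution `X` with a set `C ⊆ X` of candidates. It stands for the
dominating sets `D` with `X \ C ⊆ D ⊆ X` (`SG.sols`). The invariant `SG.Inv` says that every vertex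
with no closed neighbour in `X \ C` has at least two closed neighbours in `X`; in particular `X`
dominates. Let `v` be a candidate. A solution that avoids `v` must contain every `w` for which some
closed neighbourhood meets `X` exactly in `{v, w}`. Fixing these `w` gives the child `X \ {v}`;
fixing `v` instead gives the state `(X, C \ {v})`. Both keep the invariant (`SG.Inv.child`,
`SG.Inv.fix`), and together they split the solutions other than `X` (`SG.sols_split`), so each
solution is output exactly once. At the start `X = V`, and `C` consists of the vertices that are not
isolated; isolated vertices lie in every dominating set anyway (`mem_sols_core`).

The current graph consists of `C` and of the vertices outside `X` that `X \ C` does not dominate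
(`SG.verts`). It is enough to compute the child (`SG.dels_eq`). A round of the loop takes time
proportional to `1 + |C|` plus the number of arcs of this graph. A vertex of the graph outside `C`
has two neighbours in `C`, so without short cycles the arcs can be injected into four copies of `C ×
C` (`SG.Inv.arcs_le`), and a round costs `O(1 + |C|²)`.

For the amortisation, call `v` and `w` linked if a closed neighbourhood meets `X` in `{v, w}`; they
are then joined by a path of length at most two. Two vertices `v ≠ v'` cannot both be linked to `w`
and to `w' ≠ w`, because this would give a cycle of length at most eight (`SG.link_unique`). Girth
nine is needed in full here. So the pairs inside the sets `Del` of different `v` are different, the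
sets are small in total (`SG.sum_card_Del_le`), and the children of a state with many candidates
together keep at least `|C|² / 8` of them. By Cauchy–Schwarz the squares of their candidate numbers
add up to at least `|C|³ / 64` (`SG.cube_le_sum_sq`). The loop itself costs `O(|C|³)` plus the cost
of the children, so a potential proportional to `|C|²` closes the induction: cost plus potential is
at most a constant times the number of solutions (`SG.loopCost_le`). Without isolated vertices the
potential of the root also pays for reading the input.

For the space, all changes after the set-up are logged. The log of one branch of the recursion is
bounded by the decreasing quantity `SG.room`, which is linear in `n + m` at the root. The time to
undo a change is charged to the change itself.

The machine is handled by weakest preconditions `hwp` that count time, output and log entries; `Rep`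
ties memory cells to the abstract state. `candG_spec` and `allChildren_loop` join the two levels. -/

/-! ## A program logic for the RAM -/

namespace EDSG

open RAM

/-- The size of the machine, its input, and the number of data records after record `0`. -/
structure Mach where
  S : ℕ
  inp : List ℕ
  R : ℕ
  hS : 10 * (R + 1) ≤ S

/-- The memory `μ` has the data cells `D` (`D f r` is cell `f` of record `r`) and log top `T`. -/
def Holds (M : Mach) (D : ℕ → ℕ → ℕ) (T : ℕ) (μ : ℕ → ℕ) : Prop :=
  μ 0 = T ∧ 10 * (M.R + 1) ≤ T ∧ T ≤ M.S ∧
    ∀ f < 10, ∀ r ≤ M.R, 0 < 10 * r + f → μ (10 * r + f) = D f r ∧ D f r ≤ M.S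

/-- `μ` arises from `μ₀` by `k` logged changes. -/
def Logged (M : Mach) (μ₀ : ℕ → ℕ) : ℕ → (ℕ → ℕ) → Prop
  | 0, μ => ∀ x < μ₀ 0, μ x = μ₀ x
  | k + 1, μ => ∃ μ₁ a, Logged M μ₀ k μ₁ ∧ a ≠ 0 ∧ a < 10 * (M.R + 1) ∧ μ₁ a ≤ M.S ∧
      μ 0 = μ₁ 0 + 2 ∧ μ (μ₁ 0) = a ∧ μ (μ₁ 0 + 1) = μ₁ a ∧
      ∀ x < μ₁ 0, x ≠ 0 → x ≠ a → μ x = μ₁ x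

/-- Data and log both lie below the log top, so the cells above it may hold anything. -/
theorem Logged.congr {M : Mach} {μ₀ : ℕ → ℕ} (h0 : 0 < μ₀ 0) :
    ∀ {k : ℕ} {μ μ' : ℕ → ℕ}, Logged M μ₀ k μ → (∀ x < μ 0, μ' x = μ x) → 0 < μ 0 →
      Logged M μ₀ k μ'
  | 0, μ, μ', h, h', _ => fun x hx => by
      have := h 0 h0
      rw [h' x (by omega), h x hx]
  | k + 1, μ, μ', ⟨μ₁, a, h, ha, haR, hS, h1, h2, h3, h4⟩, h', _ =>
      ⟨μ₁, a, h, ha, haR, hS, by rw [h' 0 (by omega), h1], by rw [h' _ (by omega), h2],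
        by rw [h' _ (by omega), h3], fun x hx hx0 hxa => by rw [h' x (by omega), h4 x hx hx0 hxa]⟩

theorem Logged.top {M : Mach} {μ₀ : ℕ → ℕ} (h0 : 0 < μ₀ 0) :
    ∀ {k : ℕ} {μ : ℕ → ℕ}, Logged M μ₀ k μ → μ 0 = μ₀ 0 + 2 * k
  | 0, _, h => by simpa using h 0 h0
  | k + 1, μ, ⟨μ₁, a, h, _, _, _, h1, _⟩ => by rw [h1, h.top h0]; ring

theorem Logged.trans {M : Mach} {μ₀ μ₁ : ℕ → ℕ} (h0 : 0 < μ₀ 0) {k : ℕ} (h : Logged M μ₀ k μ₁) :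
    ∀ {j : ℕ} {μ : ℕ → ℕ}, Logged M μ₁ j μ → Logged M μ₀ (k + j) μ
  | 0, _, h' => h.congr h0 h' (by rw [h.top h0]; omega)
  | _ + 1, _, ⟨μ₂, a, h', hr⟩ => ⟨μ₂, a, h.trans h0 h', hr⟩

/-- The value of an expression in terms of the data cells. -/
def deval (M : Mach) (ρ : Reg → ℕ) (D : ℕ → ℕ → ℕ) : E → ℕ
  | .num k => k
  | .reg r => ρ r
  | .inp e => M.inp.getD (deval M ρ D e) 0
  | .mem e => D (deval M ρ D e % 10) (deval M ρ D e / 10)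
  | .bin o e₁ e₂ => o.eval (deval M ρ D e₁) (deval M ρ D e₂)

/-- The evaluation is legal and reads data cells only. -/
def DFits (M : Mach) (ρ : Reg → ℕ) (D : ℕ → ℕ → ℕ) : E → Prop
  | .num k => k ≤ M.S
  | .reg r => ρ r ≤ M.S
  | .inp e => DFits M ρ D e ∧ M.inp.getD (deval M ρ D e) 0 ≤ M.S
  | .mem e => DFits M ρ D e ∧ 0 < deval M ρ D e ∧ deval M ρ D e < 10 * (M.R + 1)
  | .bin o e₁ e₂ => DFits M ρ D e₁ ∧ DFits M ρ D e₂ ∧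
      (o ≠ .sub → o.eval (deval M ρ D e₁) (deval M ρ D e₂) ≤ M.S)

/-- This moves the evaluation of expressions from the memory to the data cells. Truncated
subtraction never exceeds its first operand, which is why `DFits` asks for no bound in that case. -/
theorem Holds.eval {M : Mach} {D : ℕ → ℕ → ℕ} {T : ℕ} {μ : ℕ → ℕ} (h : Holds M D T μ)
    {ρ : Reg → ℕ} : ∀ {e : E}, DFits M ρ D e →
      e.Fits M.S M.inp ρ μ ∧ e.eval M.inp ρ μ = deval M ρ D e ∧ deval M ρ D e ≤ M.S
  | .num k, he => ⟨he, rfl, he⟩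
  | .reg r, he => ⟨he, rfl, he⟩
  | .inp e, he => by
      obtain ⟨h1, h2, h3⟩ := h.eval he.1
      refine ⟨⟨h1, ?_⟩, ?_, he.2⟩
      · rw [h2]; exact he.2
      · simp only [Expr.eval, deval, h2]
  | .mem e, he => by
      obtain ⟨h1, h2, h3⟩ := h.eval he.1
      have hS := M.hS
      have key := h.2.2.2 (deval M ρ D e % 10) (Nat.mod_lt _ (by norm_num)) (deval M ρ D e / 10)
        (by have := he.2.2; omega) (by rw [Nat.div_add_mod]; exact he.2.1)
      rw [Nat.div_add_mod] at key
      refine ⟨⟨h1, ?_, ?_⟩, ?_, key.2⟩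
      · rw [h2]; have := he.2.2; omega
      · rw [h2, key.1]; exact key.2
      · simp only [Expr.eval, deval, h2, key.1]
  | .bin o e₁ e₂, he => by
      obtain ⟨h1, h2, h3⟩ := h.eval he.1
      obtain ⟨h4, h5, h6⟩ := h.eval he.2.1
      have hle : o.eval (deval M ρ D e₁) (deval M ρ D e₂) ≤ M.S := by
        by_cases ho : o = .sub
        · subst ho; exact (Nat.sub_le _ _).trans h3
        · exact he.2.2 ho
      refine ⟨⟨h1, h4, ?_⟩, ?_, hle⟩
      · rw [h2, h5]; exact hle
      · simp only [Expr.eval, deval, h2, h5]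

section simplemmas
variable (M : Mach) (ρ : Reg → ℕ) (D : ℕ → ℕ → ℕ)

@[simp] theorem deval_num (k : ℕ) : deval M ρ D (.num k) = k := rfl
@[simp] theorem deval_ofNat (k : ℕ) : deval M ρ D (no_index (@OfNat.ofNat E k _)) = k := rfl
@[simp] theorem deval_reg (r : Reg) : deval M ρ D (.reg r) = ρ r := rfl
@[simp] theorem deval_add (a b : E) : deval M ρ D (a + b) = deval M ρ D a + deval M ρ D b := rfl
@[simp] theorem deval_sub (a b : E) : deval M ρ D (a - b) = deval M ρ D a - deval M ρ D b := rfl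
@[simp] theorem deval_mul (a b : E) : deval M ρ D (a * b) = deval M ρ D a * deval M ρ D b := rfl
@[simp] theorem deval_eq (a b : E) :
    deval M ρ D (eq a b) = if deval M ρ D a = deval M ρ D b then 1 else 0 := rfl
@[simp] theorem deval_ne (a b : E) :
    deval M ρ D (ne a b) = if deval M ρ D a = deval M ρ D b then 0 else 1 := rfl
@[simp] theorem deval_inp (a : E) :
    deval M ρ D (.inp a) = M.inp.getD (deval M ρ D a) 0 := rfl
@[simp] theorem deval_addr (f : ℕ) (a : E) :
    deval M ρ D (addr f a) = 10 * deval M ρ D a + f := rfl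

theorem deval_fld {f : ℕ} (hf : f < 10) (a : E) :
    deval M ρ D (fld f a) = D f (deval M ρ D a) := by
  have h1 : (10 * deval M ρ D a + f) % 10 = f := by omega
  have h2 : (10 * deval M ρ D a + f) / 10 = deval M ρ D a := by omega
  change D ((10 * deval M ρ D a + f) % 10) ((10 * deval M ρ D a + f) / 10) = _
  rw [h1, h2]

@[simp] theorem dfits_num (k : ℕ) : DFits M ρ D (.num k) ↔ k ≤ M.S := Iff.rfl
@[simp] theorem dfits_ofNat (k : ℕ) : DFits M ρ D (no_index (@OfNat.ofNat E k _)) ↔ k ≤ M.S := Iff.rfl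
@[simp] theorem dfits_reg (r : Reg) : DFits M ρ D (.reg r) ↔ ρ r ≤ M.S := Iff.rfl
@[simp] theorem dfits_inp (a : E) : DFits M ρ D (.inp a) ↔
    DFits M ρ D a ∧ M.inp.getD (deval M ρ D a) 0 ≤ M.S := Iff.rfl
@[simp] theorem dfits_add (a b : E) : DFits M ρ D (a + b) ↔
    DFits M ρ D a ∧ DFits M ρ D b ∧ deval M ρ D a + deval M ρ D b ≤ M.S :=
  ⟨fun h => ⟨h.1, h.2.1, h.2.2 (by simp)⟩, fun h => ⟨h.1, h.2.1, fun _ => h.2.2⟩⟩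
@[simp] theorem dfits_mul (a b : E) : DFits M ρ D (a * b) ↔
    DFits M ρ D a ∧ DFits M ρ D b ∧ deval M ρ D a * deval M ρ D b ≤ M.S :=
  ⟨fun h => ⟨h.1, h.2.1, h.2.2 (by simp)⟩, fun h => ⟨h.1, h.2.1, fun _ => h.2.2⟩⟩

@[simp] theorem dfits_eq (a b : E) : DFits M ρ D (eq a b) ↔ DFits M ρ D a ∧ DFits M ρ D b := by
  refine ⟨fun h => ⟨h.1, h.2.1⟩, fun h => ⟨h.1, h.2, fun _ => ?_⟩⟩
  have := M.hS
  change (if _ then 1 else 0) ≤ M.S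
  split <;> omega

@[simp] theorem dfits_ne (a b : E) : DFits M ρ D (ne a b) ↔ DFits M ρ D a ∧ DFits M ρ D b := by
  refine ⟨fun h => ⟨h.1, h.2.1⟩, fun h => ⟨h.1, h.2, fun _ => ?_⟩⟩
  have := M.hS
  change (if _ then 0 else 1) ≤ M.S
  split <;> omega

@[simp] theorem dfits_sub (a b : E) : DFits M ρ D (a - b) ↔
    DFits M ρ D a ∧ DFits M ρ D b :=
  ⟨fun h => ⟨h.1, h.2.1⟩, fun h => ⟨h.1, h.2, fun h => absurd rfl h⟩⟩

theorem dfits_addr {f : ℕ} (hf : f < 10) {a : E} (ha : DFits M ρ D a)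
    (hR : deval M ρ D a ≤ M.R) : DFits M ρ D (addr f a) := by
  have := M.hS
  simp only [addr, dfits_add, dfits_mul, dfits_num, deval_num, deval_mul]
  exact ⟨⟨by omega, ha, by omega⟩, by omega, by omega⟩

theorem dfits_fld {f : ℕ} (hf : f < 10) (a : E) : DFits M ρ D (fld f a) ↔
    DFits M ρ D a ∧ deval M ρ D a ≤ M.R ∧ (0 < f ∨ 0 < deval M ρ D a) := by
  constructor
  · rintro ⟨⟨⟨-, h, -⟩, -, -⟩, h2, h3⟩
    change 10 * deval M ρ D a + f < _ at h3
    change 0 < 10 * deval M ρ D a + f at h2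
    exact ⟨h, by omega, by omega⟩
  · rintro ⟨h1, h2, h3⟩
    refine ⟨dfits_addr M ρ D hf h1 h2, ?_, ?_⟩
    · change 0 < 10 * deval M ρ D a + f
      omega
    · change 10 * deval M ρ D a + f < _
      omega

@[simp] theorem cost_ofNat (k : ℕ) : (no_index (@OfNat.ofNat E k _)).cost = 1 := rfl
@[simp] theorem cost_reg (r : Reg) : (Expr.reg r : E).cost = 1 := rfl
@[simp] theorem cost_inp (a : E) : (Expr.inp a : E).cost = a.cost + 1 := rfl
@[simp] theorem cost_add (a b : E) : (a + b).cost = a.cost + b.cost + 1 := rfl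
@[simp] theorem cost_sub (a b : E) : (a - b).cost = a.cost + b.cost + 1 := rfl
@[simp] theorem cost_mul (a b : E) : (a * b).cost = a.cost + b.cost + 1 := rfl
@[simp] theorem cost_eq (a b : E) : (eq a b).cost = a.cost + b.cost + 1 := rfl
@[simp] theorem cost_ne (a b : E) : (ne a b).cost = a.cost + b.cost + 1 := rfl
@[simp] theorem cost_addr (f : ℕ) (a : E) : (addr f a).cost = a.cost + 4 := by
  change 1 + a.cost + 1 + 1 + 1 = _; ring
@[simp] theorem cost_fld (f : ℕ) (a : E) : (fld f a).cost = a.cost + 5 := by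
  change (addr f a).cost + 1 = _; simp

end simplemmas

/-- Change one data cell. -/
def setF (D : ℕ → ℕ → ℕ) (f r x : ℕ) : ℕ → ℕ → ℕ :=
  Function.update D f (Function.update (D f) r x)

theorem setF_apply (D : ℕ → ℕ → ℕ) (f r x f' r' : ℕ) :
    setF D f r x f' r' = if f' = f ∧ r' = r then x else D f' r' := by
  unfold setF
  by_cases h : f' = f
  · subst h; simp [Function.update_apply]
  · simp [h]

@[simp] theorem setF_same (D : ℕ → ℕ → ℕ) (f r x : ℕ) :
    setF D f r x f = Function.update (D f) r x := by simp [setF]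

theorem setF_other (D : ℕ → ℕ → ℕ) {f f' : ℕ} (r x : ℕ) (h : f' ≠ f) :
    setF D f r x f' = D f' := by simp [setF, h]

/-- Weakest preconditions: from every memory with data cells `D` and log top `T`, the statement
terminates, and `Q t o ρ' D' k` holds for its time, its output, the final registers and data
cells and the number of new log entries.  If `lg` is set, all changes have been logged. -/
def hwp (M : Mach) (lg : Bool) (d : ℕ) (s : C) (ρ : Reg → ℕ) (D : ℕ → ℕ → ℕ) (T : ℕ)
    (Q : ℕ → List ℕ → (Reg → ℕ) → (ℕ → ℕ → ℕ) → ℕ → Prop) : Prop :=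
  ∀ μ, Holds M D T μ → ∃ t o ρ' μ' D' k, Exec edsG M.S M.inp d s ρ μ t o ρ' μ' ∧
    Holds M D' (T + 2 * k) μ' ∧ (lg = true → Logged M μ k μ') ∧ k ≤ t ∧ Q t o ρ' D' k

section rules
variable {M : Mach} {lg : Bool} {d : ℕ} {ρ : Reg → ℕ} {D : ℕ → ℕ → ℕ} {T : ℕ}
  {Q : ℕ → List ℕ → (Reg → ℕ) → (ℕ → ℕ → ℕ) → ℕ → Prop}

theorem hwp_mono {s : C} {Q' : ℕ → List ℕ → (Reg → ℕ) → (ℕ → ℕ → ℕ) → ℕ → Prop}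
    (h : hwp M lg d s ρ D T Q') (hQ : ∀ t o ρ' D' k, Q' t o ρ' D' k → Q t o ρ' D' k) :
    hwp M lg d s ρ D T Q := fun μ hμ => by
  obtain ⟨t, o, ρ', μ', D', k, h1, h2, h3, h4, h5⟩ := h μ hμ
  exact ⟨t, o, ρ', μ', D', k, h1, h2, h3, h4, hQ _ _ _ _ _ h5⟩

theorem hwp_nil (h : Q 1 [] ρ D 0) : hwp M lg d (block []) ρ D T Q := fun μ hμ =>
  ⟨1, [], ρ, μ, D, 0, .skip, hμ, fun _ _ _ => rfl, by simp, h⟩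

theorem hwp_skip (h : Q 1 [] ρ D 0) : hwp M lg d .skip ρ D T Q := hwp_nil h

theorem hwp_set {r : Reg} {e : E} (he : DFits M ρ D e)
    (h : Q (e.cost + 1) [] (Function.update ρ r (deval M ρ D e)) D 0) :
    hwp M lg d (.set r e) ρ D T Q := fun μ hμ => by
  obtain ⟨h1, h2, -⟩ := hμ.eval he
  have := Exec.set (prog := edsG) (d := d) (r := r) h1
  rw [h2] at this
  exact ⟨_, _, _, _, D, 0, this, hμ, fun _ _ _ => rfl, by simp, h⟩

theorem hwp_emit {e : E} (he : DFits M ρ D e) (h : Q (e.cost + 1) [deval M ρ D e] ρ D 0) :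
    hwp M lg d (.emit e) ρ D T Q := fun μ hμ => by
  obtain ⟨h1, h2, -⟩ := hμ.eval he
  have := Exec.emit (prog := edsG) (d := d) h1
  rw [h2] at this
  exact ⟨_, _, _, _, D, 0, this, hμ, fun _ _ _ => rfl, by simp, h⟩

theorem Holds.pos {μ : ℕ → ℕ} (h : Holds M D T μ) : 0 < μ 0 := by
  have := h.1; have := h.2.1; omega

/-- The second statement may use that the log still fits, since `Holds` guarantees it after the
first one. This is the premise that the later proofs introduce after every step. -/
theorem hwp_seq {s₁ s₂ : C} (h : hwp M lg d s₁ ρ D T fun t o ρ' D' k => T + 2 * k ≤ M.S →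
      hwp M lg d s₂ ρ' D' (T + 2 * k) fun t' o' ρ'' D'' k' => Q (t + t') (o ++ o') ρ'' D'' (k + k')) :
    hwp M lg d (.seq s₁ s₂) ρ D T Q := fun μ hμ => by
  obtain ⟨t, o, ρ', μ', D', k, h1, h2, h3, h4, h5⟩ := h μ hμ
  obtain ⟨t', o', ρ'', μ'', D'', k', i1, i2, i3, i4, i5⟩ := h5 h2.2.2.1 μ' h2
  refine ⟨t + t', o ++ o', ρ'', μ'', D'', k + k', .seq h1 i1, ?_, ?_, by omega, i5⟩
  · rwa [Nat.mul_add, ← Nat.add_assoc]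
  · exact fun hl => (h3 hl).trans hμ.pos (i3 hl)

theorem hwp_cons {s : C} {l : List C} (h : hwp M lg d s ρ D T fun t o ρ' D' k => T + 2 * k ≤ M.S →
      hwp M lg d (block l) ρ' D' (T + 2 * k)
        fun t' o' ρ'' D'' k' => Q (t + t') (o ++ o') ρ'' D'' (k + k')) :
    hwp M lg d (block (s :: l)) ρ D T Q := hwp_seq h

theorem hwp_ite {e : E} {s₁ s₂ : C} (he : DFits M ρ D e)
    (h1 : deval M ρ D e ≠ 0 →
      hwp M lg d s₁ ρ D T fun t o ρ' D' k => Q (e.cost + 1 + t) o ρ' D' k)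
    (h2 : deval M ρ D e = 0 →
      hwp M lg d s₂ ρ D T fun t o ρ' D' k => Q (e.cost + 1 + t) o ρ' D' k) :
    hwp M lg d (.ite e s₁ s₂) ρ D T Q := fun μ hμ => by
  obtain ⟨i1, i2, -⟩ := hμ.eval he
  by_cases h : deval M ρ D e = 0
  · obtain ⟨t, o, ρ', μ', D', k, j1, j2, j3, j4, j5⟩ := h2 h μ hμ
    exact ⟨_, o, ρ', μ', D', k, .iteFalse i1 (i2.trans h) j1, j2, j3, by omega, j5⟩
  · obtain ⟨t, o, ρ', μ', D', k, j1, j2, j3, j4, j5⟩ := h1 h μ hμ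
    exact ⟨_, o, ρ', μ', D', k, .iteTrue i1 (by rwa [i2]) j1, j2, j3, by omega, j5⟩

theorem hwp_ifThen {e : E} {s : List C} (he : DFits M ρ D e)
    (h1 : deval M ρ D e ≠ 0 →
      hwp M lg d (block s) ρ D T fun t o ρ' D' k => Q (e.cost + 1 + t) o ρ' D' k)
    (h2 : deval M ρ D e = 0 → Q (e.cost + 2) [] ρ D 0) :
    hwp M lg d (ifThen e s) ρ D T Q :=
  hwp_ite he h1 fun h => hwp_skip (h2 h)

theorem hwp_while {e : E} {s : List C} (he : DFits M ρ D e)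
    (h1 : deval M ρ D e ≠ 0 → hwp M lg d (block s) ρ D T fun t o ρ' D' k => T + 2 * k ≤ M.S →
      hwp M lg d (whileDo e s) ρ' D' (T + 2 * k)
        fun t' o' ρ'' D'' k' => Q (e.cost + 1 + t + t') (o ++ o') ρ'' D'' (k + k'))
    (h2 : deval M ρ D e = 0 → Q (e.cost + 1) [] ρ D 0) :
    hwp M lg d (whileDo e s) ρ D T Q := fun μ hμ => by
  obtain ⟨i1, i2, -⟩ := hμ.eval he
  by_cases h : deval M ρ D e = 0
  · exact ⟨_, _, _, _, D, 0, .whileFalse i1 (i2.trans h), hμ, fun _ _ _ => rfl, by simp, h2 h⟩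
  · obtain ⟨t, o, ρ', μ', D', k, j1, j2, j3, j4, j5⟩ := h1 h μ hμ
    obtain ⟨t', o', ρ'', μ'', D'', k', l1, l2, l3, l4, l5⟩ := j5 j2.2.2.1 μ' j2
    refine ⟨_, _, _, _, D'', k + k', .whileTrue i1 (by rwa [i2]) j1 l1, ?_, ?_, by omega, l5⟩
    · rwa [Nat.mul_add, ← Nat.add_assoc]
    · exact fun hl => (j3 hl).trans hμ.pos (l3 hl)

theorem hwp_call {q : Proc} {e : E} (he : DFits M ρ D e)
    (h : hwp M lg d (edsG.body q) (Function.update (fun _ => 0) .p (deval M ρ D e)) D T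
      fun t o _ D' k => Q (e.cost + 1 + t) o ρ D' k) :
    hwp M lg (d + 1) (.call q e) ρ D T Q := fun μ hμ => by
  obtain ⟨i1, i2, -⟩ := hμ.eval he
  obtain ⟨t, o, ρ', μ', D', k, j1, j2, j3, j4, j5⟩ := h μ hμ
  rw [← i2] at j1
  exact ⟨_, o, ρ, μ', D', k, .call i1 j1, j2, j3, by omega, j5⟩

theorem Holds.congr {μ μ' : ℕ → ℕ} {T' : ℕ} (h : Holds M D T μ) (hT : T ≤ T') (hS : T' ≤ M.S)
    (h0 : μ' 0 = T') (h' : ∀ x < 10 * (M.R + 1), x ≠ 0 → μ' x = μ x) : Holds M D T' μ' := by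
  refine ⟨h0, h.2.1.trans hT, hS, fun f hf r hr hfr => ?_⟩
  rw [h' _ (by omega) (by omega)]
  exact h.2.2.2 f hf r hr hfr

theorem Holds.setF {μ μ' : ℕ → ℕ} (h : Holds M D T μ) {f r x : ℕ} (hf : f < 10)
    (hfr : 0 < 10 * r + f) (hx : x ≤ M.S) (h' : μ' = Function.update μ (10 * r + f) x) :
    Holds M (setF D f r x) T μ' := by
  subst h'
  refine ⟨?_, h.2.1, h.2.2.1, fun f' hf' r' hr' hfr' => ?_⟩
  · rw [Function.update_of_ne (by omega)]; exact h.1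
  · obtain ⟨h1, h2⟩ := h.2.2.2 f' hf' r' hr' hfr'
    rw [setF_apply, Function.update_apply]
    by_cases hc : f' = f ∧ r' = r
    · rw [if_pos hc, if_pos (by omega)]; exact ⟨rfl, hx⟩
    · rw [if_neg hc, if_neg (by omega)]; exact ⟨h1, h2⟩

/-- A plain write leaves no log entry, hence `lg = false`. Only the construction of the data
structures writes in this way. -/
theorem hwp_store {f : ℕ} {e e' : E} (hf : f < 10) (he : DFits M ρ D e)
    (hR : deval M ρ D e ≤ M.R) (hfr : 0 < f ∨ 0 < deval M ρ D e) (he' : DFits M ρ D e')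
    (h : Q ((addr f e).cost + e'.cost + 1) [] ρ (setF D f (deval M ρ D e) (deval M ρ D e')) 0) :
    hwp M false d (.store (addr f e) e') ρ D T Q := fun μ hμ => by
  obtain ⟨i1, i2, -⟩ := hμ.eval (dfits_addr M ρ D hf he hR)
  obtain ⟨j1, j2, j3⟩ := hμ.eval he'
  have hS := M.hS
  rw [deval_addr] at i2
  have := Exec.store (prog := edsG) (d := d) i1 (by rw [i2]; omega) j1
  rw [i2, j2] at this
  exact ⟨_, _, _, _, _, 0, this, hμ.setF hf (by omega) j3 rfl, by simp, by simp, h⟩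

theorem hwp_upd {f : ℕ} {e e' : E} (hf : f < 10) (he : DFits M ρ D e)
    (hR : deval M ρ D e ≤ M.R) (hfr : 0 < f ∨ 0 < deval M ρ D e) (he' : DFits M ρ D e')
    (hT : T + 2 ≤ M.S)
    (h : Q (3 * e.cost + e'.cost + 29) [] ρ (setF D f (deval M ρ D e) (deval M ρ D e')) 1) :
    hwp M lg d (upd f e e') ρ D T Q := fun μ hμ => by
  have hS := M.hS
  have hB := hμ.2.1
  have h0 := hμ.1
  set a := 10 * deval M ρ D e + f with ha
  have haB : a < 10 * (M.R + 1) := by omega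
  have hfa := dfits_addr M ρ D hf he hR
  have hfl := (dfits_fld M ρ D hf e).2 ⟨he, hR, hfr⟩
  have eaddr : deval M ρ D (addr f e) = a := rfl
  -- first store
  obtain ⟨i1, i2, i3⟩ := hμ.eval hfa
  have s1 := Exec.store (prog := edsG) (d := d) (ρ := ρ) (μ := μ) (a := top) (S := M.S)
    (input := M.inp) (e := addr f e)
    (show Expr.Fits _ _ _ _ (.mem (.num 0)) from ⟨Nat.zero_le _, by simp [Expr.eval]; omega,
      by simp [Expr.eval]; omega⟩)
    (by simp [top, Expr.eval]; omega) i1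
  have et : Expr.eval M.inp ρ μ top = T := by simpa [top, Expr.eval] using h0
  rw [et, i2, eaddr] at s1
  -- second store
  set μ1 := Function.update μ T a with hμ1
  -- The log starts at `10 * (M.R + 1)` or later, so a write at its top spares the data cells.
  have hH1 : Holds M D T μ1 := hμ.congr le_rfl (by omega)
    (by rw [hμ1, Function.update_of_ne (by omega)]; exact h0)
    (fun x hx hx0 => by rw [hμ1, Function.update_of_ne (by omega)])
  obtain ⟨j1, j2, j3⟩ := hH1.eval hfl
  have s2 := Exec.store (prog := edsG) (d := d) (ρ := ρ) (μ := μ1) (a := top + 1) (S := M.S)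
    (input := M.inp) (e := fld f e)
    (show Expr.Fits _ _ _ _ (.bin .add (.mem (.num 0)) (.num 1)) from
      ⟨⟨Nat.zero_le _, by simp [Expr.eval]; omega, by simp [Expr.eval, hH1.1]; omega⟩,
        show 1 ≤ M.S by omega, by simp [Expr.eval, hH1.1, Op.eval]; omega⟩)
    (by change μ1 0 + 1 < M.S; rw [hH1.1]; omega) j1
  have et2 : Expr.eval M.inp ρ μ1 (top + 1) = T + 1 := by
    change μ1 0 + 1 = _; rw [hH1.1]
  rw [et2, j2] at s2
  set μ2 := Function.update μ1 (T + 1) (deval M ρ D (fld f e)) with hμ2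
  have hH2 : Holds M D T μ2 := hH1.congr le_rfl (by omega)
    (by rw [hμ2, Function.update_of_ne (by omega)]; exact hH1.1)
    (fun x hx hx0 => by rw [hμ2, Function.update_of_ne (by omega)])
  -- third store
  have s3 := Exec.store (prog := edsG) (d := d) (ρ := ρ) (μ := μ2) (a := 0) (S := M.S)
    (input := M.inp) (e := top + 2)
    (Nat.zero_le _) (by change 0 < M.S; omega)
    (show Expr.Fits _ _ _ _ (.bin .add (.mem (.num 0)) (.num 2)) from
      ⟨⟨Nat.zero_le _, by simp [Expr.eval]; omega, by simp [Expr.eval, hH2.1]; omega⟩,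
        show 2 ≤ M.S by omega, by simp [Expr.eval, hH2.1, Op.eval]; omega⟩)
  have et3 : Expr.eval M.inp ρ μ2 (top + 2) = T + 2 := by
    change μ2 0 + 2 = _; rw [hH2.1]
  have et0 : Expr.eval M.inp ρ μ2 (0 : E) = 0 := rfl
  rw [et3, et0] at s3
  set μ3 := Function.update μ2 0 (T + 2) with hμ3
  have hH3 : Holds M D (T + 2) μ3 := hH2.congr (by omega) hT
    (by rw [hμ3, Function.update_self])
    (fun x hx hx0 => by rw [hμ3, Function.update_of_ne hx0])
  -- fourth store
  obtain ⟨k1, k2, k3⟩ := hH3.eval hfa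
  obtain ⟨l1, l2, l3⟩ := hH3.eval he'
  rw [eaddr] at k2
  have s4 := Exec.store (prog := edsG) (d := d) k1 (by rw [k2]; omega) l1
  rw [k2, l2] at s4
  have hH4 := hH3.setF (μ' := Function.update μ3 a (deval M ρ D e')) hf (by omega) l3 rfl
  have hold : deval M ρ D (fld f e) = μ a := by
    rw [deval_fld _ _ _ hf]; exact (hμ.2.2.2 f hf _ hR (by omega)).1.symm
  have hex := Exec.seq s1 (Exec.seq s2 (Exec.seq s3 (Exec.seq s4 Exec.skip)))
  refine ⟨_, _, _, _, _, 1, hex, hH4, fun _ => ⟨μ, a, fun _ _ => rfl, by omega, haB, ?_, ?_, ?_, ?_,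
    ?_⟩, ?_, ?_⟩
  · rw [← hold]; exact j3
  · rw [Function.update_of_ne (by omega), hμ3, Function.update_self]; omega
  · rw [h0, Function.update_of_ne (by omega), hμ3, Function.update_of_ne (by omega), hμ2,
      Function.update_of_ne (by omega), hμ1, Function.update_self]
  · rw [h0, Function.update_of_ne (by omega), hμ3, Function.update_of_ne (by omega), hμ2,
      Function.update_self, hold]
  · intro x hx hx0 hxa
    rw [Function.update_of_ne hxa, hμ3, Function.update_of_ne hx0, hμ2,
      Function.update_of_ne (by omega), hμ1, Function.update_of_ne (by omega)]
  · have : 0 < (top : E).cost := by decide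
    omega
  · convert h using 1
    swap; · rfl
    have c3 : (top : E).cost = 2 := rfl
    have c4 : (top + 1 : E).cost = 4 := rfl
    have c5 : (top + 2 : E).cost = 4 := rfl
    have c6 : (0 : E).cost = 1 := rfl
    rw [cost_addr, cost_fld, c3, c4, c5, c6]; ring

end rules

/-- The time that `undo` needs for `k` log entries. -/
theorem exec_undo {M : Mach} {μ₀ : ℕ → ℕ} {d : ℕ} {ρ : Reg → ℕ} (hp : ρ .p = μ₀ 0)
    (hB : 10 * (M.R + 1) ≤ μ₀ 0) : ∀ {k : ℕ} {μ : ℕ → ℕ}, Logged M μ₀ k μ → μ 0 ≤ M.S →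
      ∃ μ', Exec edsG M.S M.inp d undoBody ρ μ (21 * k + 5) [] ρ μ' ∧ ∀ x < μ₀ 0, μ' x = μ₀ x
  | 0, μ, h, hS => by
      have h0 := h 0 (by omega)
      refine ⟨μ, ?_, h⟩
      have := M.hS
      exact Exec.whileFalse (e := ne top (.reg .p))
        ⟨⟨Nat.zero_le _, by change 0 < M.S; omega, hS⟩, by change ρ .p ≤ M.S; omega,
          by change (if _ then 0 else 1) ≤ M.S; split <;> omega⟩
        (by change (if μ 0 = ρ .p then 0 else 1) = 0; rw [if_pos (by omega)])
  | k + 1, μ, ⟨μ₁, a, h, ha, haR, haS, h1, h2, h3, h4⟩, hS => by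
      have hMS := M.hS
      have htop := h.top (by omega)
      set μ2 := Function.update μ 0 (μ₁ 0) with hμ2
      set μ3 := Function.update μ2 a (μ₁ a) with hμ3
      -- One round restores `μ₁` only below its log top; the two popped cells keep their contents,
      -- which `Logged.congr` tolerates.
      have hlow : ∀ x < μ₁ 0, μ3 x = μ₁ x := by
        intro x hx
        by_cases hxa : x = a
        · subst hxa; rw [hμ3, Function.update_self]
        · rw [hμ3, Function.update_of_ne hxa]
          by_cases hx0 : x = 0
          · subst hx0; rw [hμ2, Function.update_self]
          · rw [hμ2, Function.update_of_ne hx0]; exact h4 x hx hx0 hxa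
      have h30 : μ3 0 = μ₁ 0 := hlow 0 (by omega)
      obtain ⟨μ', hex, hμ'⟩ := exec_undo (d := d) (ρ := ρ) hp hB
        (h.congr (by omega) hlow (by omega)) (by omega)
      refine ⟨μ', ?_, hμ'⟩
      have s1 := Exec.store (prog := edsG) (d := d) (ρ := ρ) (μ := μ) (a := 0) (S := M.S)
        (input := M.inp) (e := top - 2) (Nat.zero_le _) (by change 0 < M.S; omega)
        (show Expr.Fits _ _ _ _ (.bin .sub (.mem (.num 0)) (.num 2)) from
          ⟨⟨Nat.zero_le _, by simp [Expr.eval]; omega, by simp [Expr.eval]; omega⟩,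
            show 2 ≤ M.S by omega, by simp [Expr.eval, Op.eval]; omega⟩)
      have e1 : Expr.eval M.inp ρ μ (top - 2) = μ₁ 0 := by
        change μ 0 - 2 = _; omega
      have e0 : Expr.eval M.inp ρ μ (0 : E) = 0 := rfl
      rw [e1, e0] at s1
      have h20 : μ2 0 = μ₁ 0 := by rw [hμ2, Function.update_self]
      have h2a : μ2 (μ₁ 0) = a := by rw [hμ2, Function.update_of_ne (by omega), h2]
      have h2b : μ2 (μ₁ 0 + 1) = μ₁ a := by rw [hμ2, Function.update_of_ne (by omega), h3]
      have s2 := Exec.store (prog := edsG) (d := d) (ρ := ρ) (μ := μ2) (a := .mem top) (S := M.S)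
        (input := M.inp) (e := .mem (top + 1))
        (show Expr.Fits _ _ _ _ (.mem (.mem (.num 0))) from
          ⟨⟨Nat.zero_le _, by change 0 < M.S; omega, by change μ2 0 ≤ M.S; omega⟩,
            by change μ2 0 < M.S; omega, by change μ2 (μ2 0) ≤ M.S; rw [h20, h2a]; omega⟩)
        (by change μ2 (μ2 0) < M.S; rw [h20, h2a]; omega)
        (show Expr.Fits _ _ _ _ (.mem (.bin .add (.mem (.num 0)) (.num 1))) from
          ⟨⟨⟨Nat.zero_le _, by change 0 < M.S; omega, by change μ2 0 ≤ M.S; omega⟩,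
            by change 1 ≤ M.S; omega, by change μ2 0 + 1 ≤ M.S; omega⟩,
            by change μ2 0 + 1 < M.S; omega, by
              change μ2 (μ2 0 + 1) ≤ M.S; rw [h20, h2b]; exact haS⟩)
      have e2 : Expr.eval M.inp ρ μ2 (.mem top) = a := by
        change μ2 (μ2 0) = a; rw [h20, h2a]
      have e3 : Expr.eval M.inp ρ μ2 (.mem (top + 1)) = μ₁ a := by
        change μ2 (μ2 0 + 1) = _; rw [h20, h2b]
      rw [e2, e3] at s2
      have hw := Exec.whileTrue (prog := edsG) (S := M.S) (input := M.inp) (d := d) (ρ := ρ) (μ := μ)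
        (e := ne top (.reg .p))
        ⟨⟨Nat.zero_le _, by change 0 < M.S; omega, hS⟩, by change ρ .p ≤ M.S; omega,
          by change (if _ then 0 else 1) ≤ M.S; split <;> omega⟩
        (by change (if μ 0 = ρ .p then 0 else 1) ≠ 0; rw [if_neg (by omega)]; omega)
        (Exec.seq s1 (Exec.seq s2 Exec.skip)) hex
      refine (congrArg (fun t => Exec edsG M.S M.inp d undoBody ρ μ t [] ρ μ') ?_).mp hw
      have c1 : (ne top (.reg .p) : E).cost = 4 := rfl
      have c2 : (top - 2 : E).cost = 4 := rfl
      have c3 : (Expr.mem top : E).cost = 3 := rfl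
      have c4 : (Expr.mem (top + 1) : E).cost = 5 := rfl
      have c5 : (0 : E).cost = 1 := rfl
      rw [c1, c2, c3, c4, c5]; ring

end EDSG

namespace EDSG

open RAM

/-! ## Circular doubly linked lists -/

/-- `l` is the doubly linked list with sentinel `u`. -/
def DLL (nx pv : ℕ → ℕ) (u : ℕ) (l : List ℕ) : Prop :=
  List.IsChain (fun x y => nx x = y ∧ pv y = x) (u :: (l ++ [u]))

theorem isChain_iff_nx_pv {nx pv : ℕ → ℕ} {l : List ℕ} :
    List.IsChain (fun x y => nx x = y ∧ pv y = x) l ↔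
      ∀ p x y q, l = p ++ x :: y :: q → nx x = y ∧ pv y = x := by
  constructor
  · rintro h p x y q rfl
    exact (List.isChain_cons_cons.1 (List.isChain_append.1 h).2.1).1
  · induction l with
    | nil => intro _; exact .nil
    | cons x l ih =>
      intro h
      cases l with
      | nil => exact .singleton _
      | cons y q =>
        exact .cons_cons (h [] x y q rfl) (ih fun p x' y' q' hq => h (x :: p) x' y' q' (by rw [hq]; rfl))

theorem DLL.nx_mid {nx pv : ℕ → ℕ} {u : ℕ} {l₁ l₂ : List ℕ} {a : ℕ}
    (h : DLL nx pv u (l₁ ++ a :: l₂)) : nx a = l₂.headD u := by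
  cases l₂ with
  | nil => exact (isChain_iff_nx_pv.1 h (u :: l₁) a u [] (by simp)).1
  | cons b l => exact (isChain_iff_nx_pv.1 h (u :: l₁) a b (l ++ [u]) (by simp)).1

theorem DLL.nx_root {nx pv : ℕ → ℕ} {u : ℕ} {l : List ℕ} (h : DLL nx pv u l) :
    nx u = l.headD u := by
  cases l with
  | nil => exact (isChain_iff_nx_pv.1 h [] u u [] (by simp)).1
  | cons b l => exact (isChain_iff_nx_pv.1 h [] u b (l ++ [u]) (by simp)).1

theorem DLL.pv_mid {nx pv : ℕ → ℕ} {u : ℕ} {l₁ l₂ : List ℕ} {a : ℕ}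
    (h : DLL nx pv u (l₁ ++ a :: l₂)) : pv a = l₁.getLastD u := by
  rcases List.eq_nil_or_concat l₁ with rfl | ⟨l, b, rfl⟩
  · exact (isChain_iff_nx_pv.1 h [] u a (l₂ ++ [u]) (by simp)).2
  · simpa using (isChain_iff_nx_pv.1 h (u :: l) b a (l₂ ++ [u]) (by simp)).2

theorem DLL.pv_root {nx pv : ℕ → ℕ} {u : ℕ} {l : List ℕ} (h : DLL nx pv u l) :
    pv u = l.getLastD u := by
  rcases List.eq_nil_or_concat l with rfl | ⟨l, b, rfl⟩
  · exact (isChain_iff_nx_pv.1 h [] u u [] (by simp)).2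
  · simpa using (isChain_iff_nx_pv.1 h (u :: l) b u [] (by simp)).2

theorem headD_mem (l : List ℕ) (u : ℕ) : l.headD u = u ∨ l.headD u ∈ l := by
  cases l <;> simp

theorem getLastD_mem (l : List ℕ) (u : ℕ) : l.getLastD u = u ∨ l.getLastD u ∈ l := by
  rcases List.eq_nil_or_concat l with rfl | ⟨l, b, rfl⟩ <;> simp

theorem DLL.congr {nx pv nx' pv' : ℕ → ℕ} {u : ℕ} {l : List ℕ} (h : DLL nx pv u l)
    (h' : ∀ x, x = u ∨ x ∈ l → nx' x = nx x ∧ pv' x = pv x) : DLL nx' pv' u l := by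
  refine isChain_iff_nx_pv.2 fun p x y q hq => ?_
  have hm : ∀ z ∈ u :: (l ++ [u]), z = u ∨ z ∈ l := by simp; tauto
  rw [(h' x (hm x (by rw [hq]; simp))).1, (h' y (hm y (by rw [hq]; simp))).2]
  exact isChain_iff_nx_pv.1 h p x y q hq

theorem DLL.nil {nx pv : ℕ → ℕ} {u : ℕ} (h1 : nx u = u) (h2 : pv u = u) : DLL nx pv u [] := by
  simp [DLL, h1, h2]

theorem getLast?_root (u : ℕ) (l : List ℕ) : (u :: l).getLast? = some (l.getLastD u) := by
  rcases List.eq_nil_or_concat l with rfl | ⟨l, b, rfl⟩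
  · rfl
  · rw [List.concat_eq_append, ← List.cons_append, List.getLast?_concat]; simp

theorem head?_root (u : ℕ) (l : List ℕ) : (l ++ [u]).head? = some (l.headD u) := by
  cases l <;> simp

theorem ne_last_of_split {p q : List ℕ} {x y z : ℕ} (h : (p ++ x :: y :: q).Nodup)
    (hz : (p ++ x :: y :: q).getLast? = some z) : x ≠ z := by
  rintro rfl
  rw [show p ++ x :: y :: q = (p ++ [x]) ++ (y :: q) by simp, List.getLast?_append] at hz
  rcases hh : (y :: q).getLast? with _ | w
  · simp at hh
  · rw [hh] at hz
    simp at hz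
    subst hz
    exact (List.nodup_cons.1 (List.nodup_append.1 h).2.1).1 (List.mem_of_getLast? hh)

theorem ne_head_of_split {p q : List ℕ} {x y z : ℕ} (h : (p ++ x :: y :: q).Nodup)
    (hz : (p ++ x :: y :: q).head? = some z) : y ≠ z := by
  rintro rfl
  rw [show p ++ x :: y :: q = (p ++ [x]) ++ (y :: q) by simp] at h hz
  have h2 : (p ++ [x]).head? = some y := by
    rw [← hz]; cases p <;> simp
  exact (List.nodup_append.1 h).2.2 _ (List.mem_of_head? h2) _ (by simp) rfl

theorem mem_tail_of_split {p q l : List ℕ} {x y u : ℕ} (h : u :: l = p ++ x :: y :: q) : y ∈ l := by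
  cases p with
  | nil => simp only [List.nil_append, List.cons.injEq] at h; rw [h.2]; simp
  | cons p0 p => simp only [List.cons_append, List.cons.injEq] at h; rw [h.2]; simp

theorem mem_init_of_split {p q l : List ℕ} {x y u : ℕ} (h : l ++ [u] = p ++ x :: y :: q) :
    x ∈ l := by
  have h' := congrArg List.dropLast h
  rw [List.dropLast_concat] at h'
  rw [h']
  rcases List.eq_nil_or_concat q with rfl | ⟨q', z, rfl⟩
  · rw [show p ++ [x, y] = (p ++ [x]) ++ [y] by simp, List.dropLast_concat]; simp
  · rw [show p ++ x :: y :: q'.concat z = (p ++ x :: y :: q') ++ [z] by simp,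
      List.dropLast_concat]
    simp

theorem nodup_root_comm {u : ℕ} {l : List ℕ} (h : (u :: l).Nodup) : (l ++ [u]).Nodup :=
  (List.perm_append_singleton u l).nodup_iff.2 h

/-- Sentinel and elements are distinct, so the next cell of the predecessor of `b` and the previous
cell of its successor are used by no consecutive pair of the shortened list except the new junction.
-/
theorem DLL.remove {nx pv : ℕ → ℕ} {u : ℕ} {l : List ℕ} {b : ℕ} (h : DLL nx pv u l)
    (hl : (u :: l).Nodup) (hb : b ∈ l) :
    DLL (Function.update nx (pv b) (nx b)) (Function.update pv (nx b) (pv b)) u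
      (l.filter (· ≠ b)) := by
  obtain ⟨l₁, l₂, rfl⟩ := List.append_of_mem hb
  have hf : (l₁ ++ b :: l₂).filter (· ≠ b) = l₁ ++ l₂ := by
    simp only [List.nodup_cons, List.nodup_append, List.mem_cons] at hl
    rw [List.filter_append, List.filter_cons_of_neg (by simp), List.filter_eq_self.2,
      List.filter_eq_self.2]
    · intro x hx; simp; rintro rfl; exact hl.2.2.1.1 hx
    · intro x hx; simp; rintro rfl; exact hl.2.2.2 x hx x (Or.inl rfl) rfl
  rw [hf, h.pv_mid, h.nx_mid]
  have h1 : List.IsChain (fun x y => nx x = y ∧ pv y = x) ((u :: l₁) ++ (b :: (l₂ ++ [u]))) := by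
    simpa [DLL] using h
  obtain ⟨c1, c2, -⟩ := List.isChain_append.1 h1
  have c3 := c2.tail
  simp only [List.tail_cons] at c3
  have nd1 : (u :: l₁).Nodup := hl.sublist (by simp)
  have nd2 : (u :: l₂).Nodup := hl.sublist (by simp)
  have nd : (u :: (l₁ ++ l₂)).Nodup := hl.sublist (by simp)
  have ndd := (List.nodup_append.1 (List.nodup_cons.1 nd).2).2.2
  unfold DLL
  rw [show u :: (l₁ ++ l₂ ++ [u]) = (u :: l₁) ++ (l₂ ++ [u]) by simp, List.isChain_append]
  refine ⟨isChain_iff_nx_pv.2 fun p x y q hq => ?_, isChain_iff_nx_pv.2 fun p x y q hq => ?_, ?_⟩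
  · have hx : x ≠ l₁.getLastD u :=
      ne_last_of_split (hq ▸ nd1) (hq ▸ getLast?_root u l₁)
    have hyl := mem_tail_of_split hq
    have hy : y ≠ l₂.headD u := by
      rintro rfl
      rcases headD_mem l₂ u with h0 | h0
      · rw [h0] at hyl; exact (List.nodup_cons.1 nd1).1 hyl
      · exact ndd _ hyl _ h0 rfl
    rw [Function.update_of_ne hx, Function.update_of_ne hy]
    exact isChain_iff_nx_pv.1 c1 p x y q hq
  · have hy : y ≠ l₂.headD u :=
      ne_head_of_split (hq ▸ nodup_root_comm nd2) (hq ▸ head?_root u l₂)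
    have hxl := mem_init_of_split hq
    have hx : x ≠ l₁.getLastD u := by
      rintro rfl
      rcases getLastD_mem l₁ u with h0 | h0
      · rw [h0] at hxl; exact (List.nodup_cons.1 nd2).1 hxl
      · exact ndd _ h0 _ hxl rfl
    rw [Function.update_of_ne hx, Function.update_of_ne hy]
    exact isChain_iff_nx_pv.1 c3 p x y q hq
  · rw [getLast?_root, head?_root]
    rintro x hx y hy
    simp only [Option.mem_def, Option.some.injEq] at hx hy
    rw [← hx, ← hy, Function.update_self, Function.update_self]
    exact ⟨rfl, rfl⟩

theorem DLL.insert_head {nx pv : ℕ → ℕ} {u a : ℕ} {l : List ℕ} (h : DLL nx pv u l)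
    (hl : (u :: l).Nodup) (ha : a ≠ u) (hal : a ∉ l) :
    DLL (Function.update (Function.update nx a (nx u)) u a)
      (Function.update (Function.update pv a u) (nx u) a) u (a :: l) := by
  have hh := h.nx_root
  unfold DLL
  rw [List.cons_append, List.isChain_cons_cons]
  have h1 : l.headD u ≠ a := by
    rcases headD_mem l u with h0 | h0
    · rw [h0]; exact ha.symm
    · exact fun e => hal (e ▸ h0)
  refine ⟨⟨by simp, by rw [hh, Function.update_of_ne h1.symm, Function.update_self]⟩, ?_⟩
  refine isChain_iff_nx_pv.2 fun p x y q hq => ?_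
  cases p with
  | nil =>
    simp only [List.nil_append, List.cons.injEq] at hq
    obtain ⟨rfl, hq⟩ := hq
    have : y = l.headD u := by cases l <;> simp_all
    rw [this, Function.update_of_ne ha, Function.update_self, hh, Function.update_self]
    exact ⟨rfl, rfl⟩
  | cons p0 p =>
    simp only [List.cons_append, List.cons.injEq] at hq
    obtain ⟨rfl, hq⟩ := hq
    have hal' : ∀ z ∈ l ++ [u], z ≠ a := by
      rintro z hz rfl; simp at hz; tauto
    have hy : y ≠ l.headD u := ne_head_of_split (hq ▸ nodup_root_comm hl) (hq ▸ head?_root u l)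
    have hx : x ≠ u := fun e => (List.nodup_cons.1 hl).1 (e ▸ mem_init_of_split hq)
    have hxa : x ≠ a := hal' x (by rw [hq]; simp)
    have hya : y ≠ a := hal' y (by rw [hq]; simp)
    rw [Function.update_of_ne hx, Function.update_of_ne hxa, hh, Function.update_of_ne hy,
      Function.update_of_ne hya]
    exact isChain_iff_nx_pv.1 h (u :: p) x y q (by rw [hq]; rfl)

/-- The program does not write the next cell of the new last element. It relies on the value `0` of
fresh memory, which is the sentinel of the candidate list; `hna` expresses this. -/
theorem DLL.insert_last {nx pv : ℕ → ℕ} {u a : ℕ} {l : List ℕ} (h : DLL nx pv u l)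
    (hl : (u :: l).Nodup) (ha : a ≠ u) (hal : a ∉ l) (hna : nx a = u) :
    DLL (Function.update nx (pv u) a)
      (Function.update (Function.update pv a (pv u)) u a) u (l ++ [a]) := by
  have hh := h.pv_root
  have h1 : l.getLastD u ≠ a := by
    rcases getLastD_mem l u with h0 | h0
    · rw [h0]; exact ha.symm
    · exact fun e => hal (e ▸ h0)
  have h2 : List.IsChain (fun x y => nx x = y ∧ pv y = x) (u :: l) := by
    have : List.IsChain (fun x y => nx x = y ∧ pv y = x) ((u :: l) ++ [u]) := h
    exact (List.isChain_append.1 this).1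
  unfold DLL
  rw [show u :: (l ++ [a] ++ [u]) = (u :: l) ++ [a, u] by simp, List.isChain_append, hh]
  refine ⟨isChain_iff_nx_pv.2 fun p x y q hq => ?_, ?_, ?_⟩
  · have hx : x ≠ l.getLastD u := ne_last_of_split (hq ▸ hl) (hq ▸ getLast?_root u l)
    have hyl := mem_tail_of_split hq
    have hy : y ≠ u := fun e => (List.nodup_cons.1 hl).1 (e ▸ hyl)
    have hya : y ≠ a := fun e => hal (e ▸ hyl)
    rw [Function.update_of_ne hx, Function.update_of_ne hy, Function.update_of_ne hya]
    exact isChain_iff_nx_pv.1 h2 p x y q hq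
  · rw [List.isChain_cons_cons, Function.update_of_ne h1.symm, hna, Function.update_self]
    exact ⟨⟨rfl, rfl⟩, .singleton _⟩
  · rw [getLast?_root]
    rintro x hx y hy
    simp only [Option.mem_def, Option.some.injEq, List.head?_cons] at hx hy
    rw [← hx, ← hy, Function.update_self, Function.update_of_ne ha, Function.update_self]
    exact ⟨rfl, rfl⟩

/-! ## Graphs on natural numbers, and their adjacency lists -/

/-- A finite graph of girth at least nine. -/
structure SG where
  V : Finset ℕ
  nb : ℕ → Finset ℕ
  symm : ∀ {u w}, w ∈ nb u → u ∈ nb w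
  irrefl : ∀ u, u ∉ nb u
  sub : ∀ {u w}, w ∈ nb u → w ∈ V
  -- The closed list has between three and eight vertices.
  noCycle : ∀ (x : ℕ) (l : List ℕ), (x :: l).Nodup → 2 ≤ l.length → l.length ≤ 7 →
    List.IsChain (fun a b => b ∈ nb a) (x :: (l ++ [x])) → False

/-- The closed neighbourhood. -/
def SG.cl (G : SG) (u : ℕ) : Finset ℕ := insert u (G.nb u)

theorem SG.mem_cl (G : SG) {u w : ℕ} : w ∈ G.cl u ↔ w = u ∨ w ∈ G.nb u := Finset.mem_insert

theorem SG.mem_cl_self (G : SG) (u : ℕ) : u ∈ G.cl u := Finset.mem_insert_self _ _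

/-- The number of arcs inside `W`. -/
def SG.arcs (G : SG) (W : Finset ℕ) : ℕ := ∑ u ∈ W, (G.nb u ∩ W).card

/-- A graph with vertices `1, …, n` and its arcs `n + 1, …, n + 2m`. -/
structure Net extends SG where
  n : ℕ
  m : ℕ
  mem_V : ∀ {u}, u ∈ V ↔ 1 ≤ u ∧ u ≤ n
  out : ℕ → List ℕ
  hd : ℕ → ℕ
  tw : ℕ → ℕ
  arc_gt : ∀ {u a}, a ∈ out u → n < a
  arc_le : ∀ {u a}, a ∈ out u → a ≤ n + 2 * m
  tail_unique : ∀ {u v a}, a ∈ out u → a ∈ out v → u = v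
  out_nodup : ∀ u, (out u).Nodup
  tw_mem : ∀ {u a}, a ∈ out u → tw a ∈ out (hd a)
  hd_tw : ∀ {u a}, a ∈ out u → hd (tw a) = u
  tw_tw : ∀ {u a}, a ∈ out u → tw (tw a) = a
  hd_inj : ∀ {u a b}, a ∈ out u → b ∈ out u → hd a = hd b → a = b
  mem_nb : ∀ {u w}, w ∈ nb u ↔ ∃ a ∈ out u, hd a = w

namespace Net
variable (N : Net)

/-- The adjacency list of `u` in the graph induced by `W`. -/
def live (W : Finset ℕ) (u : ℕ) : List ℕ := (N.out u).filter (N.hd · ∈ W)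

theorem mem_live {W : Finset ℕ} {u a : ℕ} : a ∈ N.live W u ↔ a ∈ N.out u ∧ N.hd a ∈ W := by
  simp [live]

theorem hd_mem {u a : ℕ} (h : a ∈ N.out u) : N.hd a ∈ N.V := N.sub (N.mem_nb.2 ⟨a, h, rfl⟩)

theorem tail_mem {u a : ℕ} (h : a ∈ N.out u) : u ∈ N.V :=
  N.sub (N.symm (N.mem_nb.2 ⟨a, h, rfl⟩))

theorem hd_ne {u a : ℕ} (h : a ∈ N.out u) : N.hd a ≠ u := fun e =>
  N.irrefl u (N.mem_nb.2 ⟨a, h, e⟩)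

theorem live_nodup (W : Finset ℕ) (u : ℕ) : (N.live W u).Nodup := (N.out_nodup u).filter _

theorem live_hd_nodup (W : Finset ℕ) (u : ℕ) : ((N.live W u).map N.hd).Nodup :=
  (List.nodup_map_iff_inj_on (N.live_nodup W u)).2 fun _ hx _ hy h =>
    N.hd_inj (N.mem_live.1 hx).1 (N.mem_live.1 hy).1 h

theorem mem_live_hd {W : Finset ℕ} {u w : ℕ} :
    w ∈ (N.live W u).map N.hd ↔ w ∈ N.nb u ∩ W := by
  simp only [List.mem_map, N.mem_live, Finset.mem_inter, N.mem_nb]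
  constructor
  · rintro ⟨a, ⟨h1, h2⟩, rfl⟩; exact ⟨⟨a, h1, rfl⟩, h2⟩
  · rintro ⟨⟨a, h1, rfl⟩, h2⟩; exact ⟨a, ⟨h1, h2⟩, rfl⟩

theorem live_length (W : Finset ℕ) (u : ℕ) : (N.live W u).length = (N.nb u ∩ W).card := by
  rw [← List.length_map (f := N.hd), ← List.toFinset_card_of_nodup (N.live_hd_nodup W u)]
  congr 1
  ext w
  rw [List.mem_toFinset, N.mem_live_hd]

end Net

/-- The data cells `D` represent the graph induced by `W`, the candidate set `C` and the set `F`
of flagged vertices; `mk` and `lk` are the contents of the fields `marked` and `link`. -/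
structure Rep (N : Net) (D : ℕ → ℕ → ℕ) (W C F : Finset ℕ) (mk lk : ℕ → ℕ) : Prop where
  subV : W ⊆ N.V
  subC : C ⊆ W
  -- Cells 2 and 3 are head and twin in arc records but candidate pointers in the records up to
  -- `N.n`; arcs have larger numbers, so the two uses never meet.
  arc : ∀ {u a}, a ∈ N.out u → D 2 a = N.hd a ∧ D 3 a = N.tw a
  -- Adjacency lists and counters are kept up to date only for vertices of the current graph.
  adj : ∀ u ∈ W, DLL (D 0) (D 1) u (N.live W u)
  cand : ∃ l : List ℕ, l.Pairwise (· < ·) ∧ (∀ x, x ∈ l ↔ x ∈ C) ∧ DLL (D 2) (D 3) 0 l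
  inC : ∀ u ∈ N.V, D 4 u = if u ∈ C then 1 else 0
  flag : ∀ u ∈ N.V, D 5 u = if u ∈ F then 1 else 0
  cnt : ∀ u ∈ W, D 6 u = (N.cl u ∩ C).card
  inG : ∀ u ∈ N.V, D 7 u = if u ∈ W then 1 else 0
  marked : ∀ u ∈ N.V, D 8 u = mk u
  link : ∀ u ∈ N.V, D 9 u = lk u

end EDSG

/-! ### Removing a vertex from the candidates -/

namespace EDSG

open RAM Reg

/-- `rest` is linked by `nx` and ends at `u`. -/
def Linked (nx : ℕ → ℕ) (u : ℕ) (rest : List ℕ) : Prop :=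
  ∀ pre a post, rest = pre ++ a :: post → nx a = post.headD u

theorem Linked.tail {nx : ℕ → ℕ} {u b : ℕ} {l : List ℕ} (h : Linked nx u (b :: l)) :
    Linked nx u l := fun pre a post e => h (b :: pre) a post (by rw [e]; rfl)

theorem Linked.head {nx : ℕ → ℕ} {u b : ℕ} {l : List ℕ} (h : Linked nx u (b :: l)) :
    nx b = l.headD u := h [] b l rfl

theorem DLL.linked {nx pv : ℕ → ℕ} {u : ℕ} {l₁ l₂ : List ℕ} (h : DLL nx pv u (l₁ ++ l₂)) :
    Linked nx u l₂ := fun pre a post e => by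
  subst e
  exact DLL.nx_mid (l₁ := l₁ ++ pre) (by simpa using h)

/-- The heads along the list are distinct, so no counter is decremented twice and the final cells
have a closed form. -/
theorem drop_loop {M : Mach} {lg : Bool} {d : ℕ} {q : ℕ} (hq : q ≤ M.R) :
    ∀ (rest : List ℕ) (ρ : Reg → ℕ) (D : ℕ → ℕ → ℕ) (T : ℕ), ρ .p = q → ρ .a = rest.headD q →
      (∀ x ∈ rest, 0 < x ∧ x ≤ M.R ∧ x ≠ q ∧ D 2 x ≤ M.R) → Linked (D 0) q rest →
      (rest.map (D 2)).Nodup → T + 2 * rest.length ≤ M.S →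
      hwp M lg d (whileDo (ne a p)
        [ upd cnt (fld head a) (fld cnt (fld head a) - 1),
          .set a (fld nxt a) ]) ρ D T fun t o _ D' k =>
        o = [] ∧ t ≤ 80 * rest.length + 4 ∧ k ≤ rest.length ∧
          D' = fun f x => if f = 6 ∧ x ∈ rest.map (D 2) then D f x - 1 else D f x := by
  intro rest
  induction rest with
  | nil =>
    intro ρ D T hp ha _ _ _ _
    have := M.hS
    simp only [List.headD_nil] at ha
    refine hwp_while (by simp [hp, ha]; omega) (fun h => ?_) fun _ => ?_
    · simp [hp, ha] at h
    · simp
  | cons b rest ih =>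
    intro ρ D T hp ha hr hl hnd hT
    have hMS := M.hS
    simp only [List.headD_cons] at ha
    simp only [List.length_cons] at hT
    obtain ⟨hb0, hbR, hbq, hhb⟩ := hr b (by simp)
    refine hwp_while (by simp [hp, ha]; omega) (fun _ => ?_) fun h => ?_
    swap
    · simp [hp, ha, hbq] at h
    have hfa : DFits M ρ D (fld head a) := by
      rw [dfits_fld _ _ _ (by norm_num)]; simp [ha]; omega
    have hva : deval M ρ D (fld head a) = D 2 b := by
      rw [deval_fld _ _ _ (by norm_num)]; simp [ha]
    have hfc : DFits M ρ D (fld cnt (fld head a)) := by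
      rw [dfits_fld _ _ _ (by norm_num), hva]; exact ⟨hfa, hhb, by simp⟩
    have hvc : deval M ρ D (fld cnt (fld head a)) = D 6 (D 2 b) := by
      rw [deval_fld _ _ _ (by norm_num), hva]
    refine hwp_cons (hwp_upd (by norm_num) hfa (by rw [hva]; exact hhb) (by simp) ?_ (by omega) ?_)
    · rw [dfits_sub]
      simp only [dfits_ofNat]
      exact ⟨hfc, by omega⟩
    intro hT1
    rw [hva, deval_sub, hvc]
    simp only [deval_ofNat]
    set D1 := setF D cnt (D 2 b) (D 6 (D 2 b) - 1) with hD1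
    have hD1' : ∀ f ≠ 6, D1 f = D f := fun f hf => setF_other _ _ _ hf
    refine hwp_cons (hwp_set ?_ ?_)
    · rw [dfits_fld _ _ _ (by norm_num)]; simp [ha]; omega
    intro hT2
    rw [deval_fld _ _ _ (by norm_num)]
    refine hwp_nil ?_
    intro hT3
    simp only [deval_reg, ha, hD1' 0 (by norm_num), hl.head]
    refine hwp_mono (ih _ D1 _ (by simpa using hp) (by simp) ?_ ?_ ?_ ?_) ?_
    · intro x hx
      rw [hD1' 2 (by norm_num)]
      exact hr x (by simp [hx])
    · rw [hD1' 0 (by norm_num)]; exact hl.tail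
    · rw [hD1' 2 (by norm_num)]; simp at hnd; simpa using hnd.2
    · omega
    · rintro t o ρ' D' k ⟨rfl, ht, hk, rfl⟩
      refine ⟨rfl, ?_, ?_, ?_⟩
      · simp; omega
      · simp; omega
      · funext f x
        rw [hD1' 2 (by norm_num), hD1, setF_apply]
        simp only [List.map_cons, List.nodup_cons] at hnd
        by_cases hf : f = 6
        · subst hf
          by_cases hx : x = D 2 b
          · subst hx
            simp [hnd.1]
          · simp [hx]
        · simp [hf]

theorem Rep.pos {N : Net} {D : ℕ → ℕ → ℕ} {W C F : Finset ℕ} {mk lk : ℕ → ℕ}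
    (h : Rep N D W C F mk lk) {u : ℕ} (hu : u ∈ W) : 1 ≤ u ∧ u ≤ N.n := N.mem_V.1 (h.subV hu)

theorem dfits_fld_reg {M : Mach} {ρ : Reg → ℕ} {D : ℕ → ℕ → ℕ} {f x : ℕ} {r : Reg} (hf : f < 10)
    (h : ρ r = x) (hx : x ≤ M.R) (h0 : 0 < f ∨ 0 < x) : DFits M ρ D (fld f (.reg r)) := by
  have := M.hS
  rw [dfits_fld _ _ _ hf]
  simp only [dfits_reg, deval_reg, h]
  omega

theorem deval_fld_reg {M : Mach} {ρ : Reg → ℕ} {D : ℕ → ℕ → ℕ} {f x : ℕ} {r : Reg} (hf : f < 10)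
    (h : ρ r = x) : deval M ρ D (fld f (.reg r)) = D f x := by
  rw [deval_fld _ _ _ hf, deval_reg, h]

theorem dfits_fld_fld {M : Mach} {ρ : Reg → ℕ} {D : ℕ → ℕ → ℕ} {f g x y : ℕ} {r : Reg}
    (hf : f < 10) (hg : g < 10) (h : ρ r = x) (hx : x ≤ M.R) (h0 : 0 < g ∨ 0 < x)
    (hy : D g x = y) (hyR : y ≤ M.R) (h1 : 0 < f ∨ 0 < y) :
    DFits M ρ D (fld f (fld g (.reg r))) := by
  rw [dfits_fld _ _ _ hf, deval_fld_reg hg h, hy]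
  exact ⟨dfits_fld_reg hg h hx h0, hyR, h1⟩

theorem deval_fld_fld {M : Mach} {ρ : Reg → ℕ} {D : ℕ → ℕ → ℕ} {f g x : ℕ} {r : Reg}
    (hf : f < 10) (hg : g < 10) (h : ρ r = x) :
    deval M ρ D (fld f (fld g (.reg r))) = D f (D g x) := by
  rw [deval_fld _ _ _ hf, deval_fld_reg hg h]

theorem Rep.mem_W_live {N : Net} {D : ℕ → ℕ → ℕ} {W C F : Finset ℕ} {mk lk : ℕ → ℕ}
    (h : Rep N D W C F mk lk) {u b : ℕ} (hb : b ∈ N.live W u) :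
    N.n < b ∧ b ≤ N.n + 2 * N.m ∧ N.hd b ∈ W ∧ 1 ≤ N.hd b ∧ N.hd b ≤ N.n ∧ 1 ≤ u ∧ u ≤ N.n := by
  obtain ⟨h1, h2⟩ := N.mem_live.1 hb
  have := h.pos h2
  have := N.mem_V.1 (N.tail_mem h1)
  exact ⟨N.arc_gt h1, N.arc_le h1, h2, by omega, by omega, by omega, by omega⟩

/-- In the current graph `q` is counted exactly at `q` and at its live neighbours. The four further
log entries are two list pointers, the membership bit and the counter of `q`. -/
theorem drop_spec {N : Net} {M : Mach} (hR : M.R = N.n + 2 * N.m) {lg : Bool} {d : ℕ}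
    {D : ℕ → ℕ → ℕ} {T : ℕ} {W C F : Finset ℕ} {mk lk : ℕ → ℕ} (h : Rep N D W C F mk lk) {q : ℕ}
    (hq : q ∈ C) {ρ : Reg → ℕ} (hρ : ρ .p = q) (hT : T + 2 * (4 + (N.nb q ∩ W).card) ≤ M.S) :
    hwp M lg d (edsG.body .drop) ρ D T fun t o _ D' k =>
      o = [] ∧ t ≤ 300 + 80 * (N.nb q ∩ W).card ∧ k ≤ 4 + (N.nb q ∩ W).card ∧
        Rep N D' W (C.erase q) F mk lk := by
  have hMS := M.hS
  have hqW := h.subC hq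
  have hq1 := h.pos hqW
  obtain ⟨l, hsort, hmem, hdll⟩ := h.cand
  have hCn : ∀ x ∈ l, 1 ≤ x ∧ x ≤ N.n := fun x hx => h.pos (h.subC ((hmem x).1 hx))
  have hnd : (0 :: l).Nodup := List.nodup_cons.2 ⟨fun h0 => by have := hCn 0 h0; omega,
    hsort.imp fun h => Nat.ne_of_lt h⟩
  have hql := (hmem q).2 hq
  have hrem := hdll.remove hnd hql
  obtain ⟨l₁, l₂, rfl⟩ := List.append_of_mem hql
  have hn := hdll.nx_mid
  have hp := hdll.pv_mid
  have hnle : D 2 q ≤ N.n := by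
    rw [hn]; rcases headD_mem l₂ 0 with h0 | h0
    · omega
    · exact (hCn _ (List.mem_append_right _ (List.mem_cons_of_mem _ h0))).2
  have hple : D 3 q ≤ N.n := by
    rw [hp]; rcases getLastD_mem l₁ 0 with h0 | h0
    · omega
    · exact (hCn _ (List.mem_append_left _ h0)).2
  -- The first pointer update therefore spares the next cell of `q`, which the second update reads.
  have hpq : q ≠ D 3 q := by
    rw [hp]; rcases getLastD_mem l₁ 0 with h0 | h0
    · omega
    · intro e
      exact (List.nodup_append.1 (List.nodup_cons.1 hnd).2).2.2 _ h0 q (by simp) e.symm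
  change hwp M lg d dropBody ρ D T _
  simp only [dropBody, nxt, cnext, cprev, inC, cnt, head]
  refine hwp_cons (hwp_upd (by norm_num) (dfits_fld_reg (by norm_num) hρ (by omega) (by simp))
    (by rw [deval_fld_reg (by norm_num) hρ]; omega) (by simp)
    (dfits_fld_reg (by norm_num) hρ (by omega) (by simp)) (by omega) ?_)
  rw [deval_fld_reg (by norm_num) hρ, deval_fld_reg (by norm_num) hρ]
  intro _
  set D1 := setF D 2 (D 3 q) (D 2 q) with hD1
  have e1 : D1 2 q = D 2 q := by rw [hD1, setF_same, Function.update_of_ne hpq]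
  have e2 : D1 3 q = D 3 q := by rw [hD1, setF_other _ _ _ (by norm_num)]
  refine hwp_cons (hwp_upd (by norm_num) (dfits_fld_reg (by norm_num) hρ (by omega) (by simp))
    (by rw [deval_fld_reg (by norm_num) hρ, e1]; omega) (by simp)
    (dfits_fld_reg (by norm_num) hρ (by omega) (by simp)) (by omega) ?_)
  rw [deval_fld_reg (by norm_num) hρ, deval_fld_reg (by norm_num) hρ, e1, e2]
  intro _
  refine hwp_cons (hwp_upd (by norm_num) (by simp [hρ]; omega) (by simp [hρ]; omega) (by simp)
    (by simp) (by omega) ?_)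
  intro _
  simp only [deval_reg, hρ, deval_ofNat]
  refine hwp_cons (hwp_upd (by norm_num) (by simp [hρ]; omega) (by simp [hρ]; omega) (by simp)
    ?_ (by omega) ?_)
  · rw [dfits_sub]
    exact ⟨dfits_fld_reg (by norm_num) hρ (by omega) (by simp), by simp; omega⟩
  intro _
  rw [deval_sub, deval_fld_reg (by norm_num) hρ]
  simp only [deval_reg, hρ, deval_ofNat]
  set D4 := setF (setF (setF D1 3 (D 2 q) (D 3 q)) inC q 0) cnt q _ with hD4
  have g0 : D4 0 = D 0 := by simp [hD4, hD1, setF_other]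
  have g1 : D4 1 = D 1 := by simp [hD4, hD1, setF_other]
  have g2 : D4 2 = Function.update (D 2) (D 3 q) (D 2 q) := by simp [hD4, hD1, setF_other]
  have g3 : D4 3 = Function.update (D 3) (D 2 q) (D 3 q) := by simp [hD4, hD1, setF_other]
  have g4 : D4 4 = Function.update (D 4) q 0 := by simp [hD4, hD1, setF_other]
  have g5 : D4 5 = D 5 := by simp [hD4, hD1, setF_other]
  have g6 : D4 6 = Function.update (D 6) q (D 6 q - 1) := by simp [hD4, hD1, setF_other]
  have g7 : D4 7 = D 7 := by simp [hD4, hD1, setF_other]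
  have g8 : D4 8 = D 8 := by simp [hD4, hD1, setF_other]
  have g9 : D4 9 = D 9 := by simp [hD4, hD1, setF_other]
  clear_value D4
  have hadj := h.adj q hqW
  refine hwp_cons (hwp_set (dfits_fld_reg (by norm_num) hρ (by omega) (by omega)) ?_)
  intro _
  rw [deval_fld_reg (by norm_num) hρ, g0, hadj.nx_root]
  have hhd : ∀ x ∈ N.live W q, D4 2 x = N.hd x := fun x hx => by
    have := h.mem_W_live hx
    rw [g2, Function.update_of_ne (by omega), (h.arc (N.mem_live.1 hx).1).1]
  have hmap : (N.live W q).map (D4 2) = (N.live W q).map N.hd := List.map_congr_left hhd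
  refine hwp_cons (hwp_mono (drop_loop (q := q) (by omega) (N.live W q) _ D4 _ (by simp [hρ])
    (by simp) ?_ ?_ ?_ ?_) ?_)
  · intro x hx
    have := h.mem_W_live hx
    rw [hhd x hx]
    omega
  · rw [g0]; exact DLL.linked (l₁ := []) hadj
  · rw [hmap]; exact N.live_hd_nodup W q
  · rw [N.live_length]; omega
  · rintro t o ρ' D' k ⟨rfl, ht, hk, hD'⟩ _
    rw [N.live_length] at ht hk
    refine hwp_nil ⟨by simp, ?_, by omega, ?_⟩
    · simp only [cost_fld, cost_reg, cost_ofNat, cost_sub]; omega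
    have hother : ∀ f ≠ 6, D' f = D4 f := fun f hf => by rw [hD']; funext x; simp [hf]
    have hsix : ∀ x, D' 6 x = if x ∈ N.nb q ∩ W then D4 6 x - 1 else D4 6 x := fun x => by
      rw [hD']; simp only [hmap, N.mem_live_hd, true_and]
    clear hD'
    refine ⟨h.subV, (Finset.erase_subset _ _).trans h.subC, ?_, ?_, ?_, ?_, ?_, ?_, ?_, ?_, ?_⟩
    · intro u b hb
      have := N.arc_gt hb
      rw [hother 2 (by norm_num), hother 3 (by norm_num), g2, g3, Function.update_of_ne (by omega), Function.update_of_ne (by omega)]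
      exact h.arc hb
    · intro u hu
      rw [hother 0 (by norm_num), hother 1 (by norm_num), g0, g1]
      exact h.adj u hu
    · refine ⟨(l₁ ++ q :: l₂).filter (· ≠ q), hsort.filter _, fun x => ?_, ?_⟩
      · rw [List.mem_filter, hmem, Finset.mem_erase]; simp [and_comm]
      · rw [hother 2 (by norm_num), hother 3 (by norm_num), g2, g3]
        exact hrem
    · intro u hu
      rw [hother 4 (by norm_num), g4, Function.update_apply, h.inC u hu]
      by_cases hc : u = q <;> simp [hc]
    · intro u hu
      rw [hother 5 (by norm_num), g5]
      exact h.flag u hu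
    · intro u hu
      rw [hsix, g6]
      by_cases huq : u = q
      · subst huq
        rw [if_neg (fun hc => N.irrefl u (Finset.mem_inter.1 hc).1), Function.update_self,
          h.cnt u hu, Finset.inter_erase,
          Finset.card_erase_of_mem (Finset.mem_inter.2 ⟨N.mem_cl_self u, hq⟩)]
      · rw [Function.update_of_ne huq, h.cnt u hu, Finset.inter_erase]
        by_cases hun : q ∈ N.nb u
        · rw [if_pos (Finset.mem_inter.2 ⟨N.symm hun, hu⟩),
            Finset.card_erase_of_mem (Finset.mem_inter.2 ⟨N.mem_cl.2 (Or.inr hun), hq⟩)]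
        · rw [if_neg (fun hc => hun (N.symm (Finset.mem_inter.1 hc).1)), Finset.erase_eq_of_notMem]
          simp [N.mem_cl, hun, Ne.symm huq]
    · intro u hu
      rw [hother 7 (by norm_num), g7]
      exact h.inG u hu
    · intro u hu
      rw [hother 8 (by norm_num), g8]
      exact h.marked u hu
    · intro u hu
      rw [hother 9 (by norm_num), g9]
      exact h.link u hu

end EDSG

/-! ### Deleting a vertex from the adjacency lists -/

namespace EDSG

open RAM Reg

theorem DLL.nx_mem {nx pv : ℕ → ℕ} {u b : ℕ} {l : List ℕ} (h : DLL nx pv u l)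
    (hl : (u :: l).Nodup) (hb : b ∈ l) : nx b ≠ b ∧ (nx b = u ∨ nx b ∈ l) := by
  obtain ⟨l₁, l₂, rfl⟩ := List.append_of_mem hb
  rw [h.nx_mid]
  obtain ⟨h1, h2⟩ := List.nodup_cons.1 hl
  have h3 := (List.nodup_cons.1 (List.nodup_append.1 h2).2.1).1
  rcases headD_mem l₂ u with h0 | h0
  · exact ⟨fun e => h1 (by rw [← h0, e]; simp), Or.inl h0⟩
  · exact ⟨fun e => h3 (by rwa [e] at h0),
      Or.inr (List.mem_append_right _ (List.mem_cons_of_mem _ h0))⟩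

theorem DLL.pv_mem {nx pv : ℕ → ℕ} {u b : ℕ} {l : List ℕ} (h : DLL nx pv u l)
    (hl : (u :: l).Nodup) (hb : b ∈ l) : pv b ≠ b ∧ (pv b = u ∨ pv b ∈ l) := by
  obtain ⟨l₁, l₂, rfl⟩ := List.append_of_mem hb
  rw [h.pv_mid]
  obtain ⟨h1, h2⟩ := List.nodup_cons.1 hl
  have h3 := (List.nodup_append.1 h2).2.2
  rcases getLastD_mem l₁ u with h0 | h0
  · exact ⟨fun e => h1 (by rw [← h0, e]; simp), Or.inl h0⟩
  · exact ⟨fun e => h3 _ h0 _ (by simp) e, Or.inr (List.mem_append_left _ h0)⟩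

/-- The adjacency list of `u` when the arcs to `q` have been removed except for the opposites of
the arcs in `rest`. -/
def Net.partLive (N : Net) (W : Finset ℕ) (q : ℕ) (rest : List ℕ) (u : ℕ) : List ℕ :=
  (N.out u).filter fun a => N.hd a ∈ W ∧ (N.hd a = q → N.tw a ∈ rest)

theorem Net.mem_partLive {N : Net} {W : Finset ℕ} {q : ℕ} {rest : List ℕ} {u a : ℕ} :
    a ∈ N.partLive W q rest u ↔ a ∈ N.out u ∧ N.hd a ∈ W ∧ (N.hd a = q → N.tw a ∈ rest) := by
  simp only [Net.partLive, List.mem_filter, decide_eq_true_eq]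

theorem Net.root_partLive_nodup (N : Net) {W : Finset ℕ} {q : ℕ} {rest : List ℕ} {u : ℕ}
    (hu : u ∈ N.V) : (u :: N.partLive W q rest u).Nodup :=
  List.nodup_cons.2 ⟨fun h => by
    have := N.arc_gt (Net.mem_partLive.1 h).1
    have := N.mem_V.1 hu
    omega, (N.out_nodup u).filter _⟩

/-- The twin of `b` is the only arc from `N.hd b` to `q`, so passing `b` on the list of `q` costs
exactly this arc. -/
theorem Net.partLive_tail (N : Net) {W : Finset ℕ} {q : ℕ} {b : ℕ} {rest : List ℕ}
    (hb : b ∈ N.out q) (hnd : b ∉ rest) (u : ℕ) :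
    N.partLive W q rest u = if u = N.hd b then (N.partLive W q (b :: rest) u).filter (· ≠ N.tw b)
      else N.partLive W q (b :: rest) u := by
  unfold Net.partLive
  split
  · next h =>
    subst h
    rw [List.filter_filter]
    refine List.filter_congr fun c hc => ?_
    have h1 := N.tw_mem hb
    have h2 := N.hd_tw hb
    have h3 := N.tw_tw hb
    have key : c = N.tw b ↔ N.hd c = q :=
      ⟨fun e => by rw [e, h2], fun e => N.hd_inj hc h1 (by rw [e, h2])⟩
    simp only [← Bool.decide_and, decide_eq_decide]
    constructor
    · rintro ⟨h4, h5⟩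
      exact ⟨fun e => hnd (by have := h5 (key.1 e); rwa [e, h3] at this), h4,
        fun e => List.mem_cons_of_mem _ (h5 e)⟩
    · rintro ⟨h4, h5, h6⟩
      exact ⟨h5, fun e => absurd (key.2 e) h4⟩
  · next h =>
    refine List.filter_congr fun c hc => ?_
    simp only [decide_eq_decide, List.mem_cons]
    refine and_congr_right fun _ => forall_congr' fun _ => ?_
    constructor
    · exact Or.inr
    · rintro (e | e)
      · have := N.hd_tw hc
        rw [e] at this
        exact absurd this.symm h
      · exact e

/-- Only the lists of the neighbours of `q` change. The list of `q` itself stays intact while it is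
traversed, and the unlinked arcs keep their own next pointers, which is the last clause. -/
theorem delete_loop {N : Net} {M : Mach} (hR : M.R = N.n + 2 * N.m) {lg : Bool} {d : ℕ} {q : ℕ}
    {W : Finset ℕ} (hW : W ⊆ N.V) (hq : q ∈ W) :
    ∀ (rest pre : List ℕ) (ρ : Reg → ℕ) (D : ℕ → ℕ → ℕ) (T : ℕ), N.live W q = pre ++ rest →
      ρ .p = q → ρ .a = rest.headD q →
      (∀ u, ∀ b ∈ N.out u, D 3 b = N.tw b) → DLL (D 0) (D 1) q (N.live W q) →
      (∀ u ∈ W, u ≠ q → DLL (D 0) (D 1) u (N.partLive W q rest u)) →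
      T + 4 * rest.length ≤ M.S →
      hwp M lg d (whileDo (ne a p)
        [ .set b (fld twin a),
          upd nxt (fld prv b) (fld nxt b),
          upd prv (fld nxt b) (fld prv b),
          .set a (fld nxt a) ]) ρ D T fun t o _ D' k =>
        o = [] ∧ t ≤ 150 * rest.length + 4 ∧ k ≤ 2 * rest.length ∧
          (∀ f, f ≠ 0 → f ≠ 1 → D' f = D f) ∧
          (∀ u ∈ W, u ≠ q → DLL (D' 0) (D' 1) u (N.partLive W q [] u)) ∧
          (∀ u, ∀ c ∈ N.out u, N.hd c = q → D' 0 c = D 0 c) := by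
  intro rest
  have hqV := N.mem_V.1 (hW hq)
  have hMS := M.hS
  induction rest with
  | nil =>
    intro pre ρ D T _ hp ha _ _ hadj _
    simp only [List.headD_nil] at ha
    refine hwp_while (by simp [hp, ha]; omega) (fun h => ?_) fun _ => ?_
    · simp [hp, ha] at h
    · simp only [cost_ne, cost_reg]
      exact ⟨trivial, by simp, by simp, fun _ _ _ => trivial, hadj, fun _ _ _ _ => trivial⟩
  | cons b rest ih =>
    intro pre ρ D T hpre hp ha htw hdq hadj hT
    simp only [List.headD_cons] at ha
    simp only [List.length_cons] at hT
    have hbl : b ∈ N.live W q := by rw [hpre]; simp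
    have hnd := N.live_nodup W q
    have hbrest : b ∉ rest := by
      rw [hpre] at hnd
      exact (List.nodup_cons.1 (List.nodup_append.1 hnd).2.1).1
    have hbo := (N.mem_live.1 hbl).1
    have hwW := (N.mem_live.1 hbl).2
    have hwV := N.mem_V.1 (hW hwW)
    have hbgt := N.arc_gt hbo
    have hble := N.arc_le hbo
    set w := N.hd b with hw
    set c := N.tw b with hc
    have hwq : w ≠ q := N.hd_ne hbo
    have hcw : c ∈ N.out w := N.tw_mem hbo
    have hhc : N.hd c = q := N.hd_tw hbo
    have hcgt := N.arc_gt hcw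
    have hcle := N.arc_le hcw
    have hcl : c ∈ N.partLive W q (b :: rest) w :=
      Net.mem_partLive.2 ⟨hcw, by rw [hhc]; exact hq, fun _ => by rw [hc, N.tw_tw hbo]; simp⟩
    have hdw := hadj w hwW hwq
    have hndw := N.root_partLive_nodup (W := W) (q := q) (rest := b :: rest) (hW hwW)
    obtain ⟨hn1, hn2⟩ := hdw.nx_mem hndw hcl
    obtain ⟨hp1, hp2⟩ := hdw.pv_mem hndw hcl
    have hrem := hdw.remove hndw hcl
    -- The records on the list of `w` belong to no other list, so the two writes leave all other
    -- lists alone.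
    have own : ∀ x, x = w ∨ x ∈ N.partLive W q (b :: rest) w → x ≤ M.R ∧ 0 < x ∧
        ∀ u ∈ N.V, u ≠ w → x ≠ u ∧ x ∉ N.out u := by
      rintro x (rfl | hx)
      · exact ⟨by omega, by omega, fun u hu hne => ⟨hne.symm, fun h => by
          have := N.arc_gt h; omega⟩⟩
      · have hxo := (Net.mem_partLive.1 hx).1
        have h1 := N.arc_gt hxo
        have h2 := N.arc_le hxo
        exact ⟨by omega, by omega, fun u hu hne => ⟨fun e => by
          have := N.mem_V.1 hu; omega, fun h => hne (N.tail_unique h hxo)⟩⟩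
    obtain ⟨hnR, hn0, hnown⟩ := own _ hn2
    obtain ⟨hpR, hp0, hpown⟩ := own _ hp2
    refine hwp_while (by simp [hp, ha]; omega) (fun _ => ?_) fun h => ?_
    swap
    · simp only [deval_ne, deval_reg, hp, ha] at h
      rw [if_neg (by omega)] at h
      omega
    simp only [nxt, prv, twin]
    refine hwp_cons (hwp_set (dfits_fld_reg (by norm_num) ha (by omega) (by simp)) ?_)
    rw [deval_fld_reg (by norm_num) ha, htw q b hbo]
    intro _
    have hρb : Function.update ρ Reg.b c Reg.b = c := by simp
    refine hwp_cons (hwp_upd (by norm_num)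
      (dfits_fld_reg (by norm_num) hρb (by omega) (by simp))
      (by rw [deval_fld_reg (by norm_num) hρb]; exact hpR)
      (by rw [deval_fld_reg (by norm_num) hρb]; omega)
      (dfits_fld_reg (by norm_num) hρb (by omega) (by omega)) (by omega) ?_)
    rw [deval_fld_reg (by norm_num) hρb, deval_fld_reg (by norm_num) hρb]
    intro _
    set D1 := setF D 0 (D 1 c) (D 0 c) with hD1
    have e0 : D1 0 c = D 0 c := by rw [hD1, setF_same, Function.update_of_ne hp1.symm]
    have e1 : D1 1 c = D 1 c := by rw [hD1, setF_other _ _ _ (by norm_num)]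
    refine hwp_cons (hwp_upd (by norm_num)
      (dfits_fld_reg (by norm_num) hρb (by omega) (by omega))
      (by rw [deval_fld_reg (by norm_num) hρb, e0]; exact hnR)
      (by simp)
      (dfits_fld_reg (by norm_num) hρb (by omega) (by simp)) (by omega) ?_)
    rw [deval_fld_reg (by norm_num) hρb, deval_fld_reg (by norm_num) hρb, e0, e1]
    intro _
    set D2 := setF D1 1 (D 0 c) (D 1 c) with hD2
    have g0 : D2 0 = Function.update (D 0) (D 1 c) (D 0 c) := by simp [hD2, hD1, setF_other]
    have g1 : D2 1 = Function.update (D 1) (D 0 c) (D 1 c) := by simp [hD2, hD1, setF_other]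
    have gf : ∀ f, f ≠ 0 → f ≠ 1 → D2 f = D f := fun f h0 h1 => by
      rw [hD2, setF_other _ _ _ h1, hD1, setF_other _ _ _ h0]
    clear_value D2
    have hρa : Function.update ρ Reg.b c Reg.a = b := by simpa using ha
    refine hwp_cons (hwp_set (dfits_fld_reg (by norm_num) hρa (by omega) (by omega)) ?_)
    intro _
    have hne1 := (hpown q (hW hq) hwq.symm)
    have hne2 := (hnown q (hW hq) hwq.symm)
    have hnext : D2 0 b = rest.headD q := by
      rw [g0, Function.update_of_ne (fun e => hne1.2 (by rw [← e]; exact hbo))]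
      rw [hpre] at hdq
      exact hdq.nx_mid
    rw [deval_fld_reg (by norm_num) hρa, hnext]
    refine hwp_nil ?_
    intro _
    refine hwp_mono (ih (pre ++ [b]) _ D2 _ (by rw [hpre]; simp) (by simpa using hp) (by simp)
      (fun u x hx => by rw [gf 3 (by norm_num) (by norm_num)]; exact htw u x hx) ?_ ?_ (by omega)) ?_
    · rw [g0, g1]
      refine hdq.congr fun x hx => ?_
      have hx' : x = q ∨ x ∈ N.out q := hx.imp_right fun h => (N.mem_live.1 h).1
      refine ⟨Function.update_of_ne ?_ _ _, Function.update_of_ne ?_ _ _⟩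
      · rintro rfl; exact hx'.elim hne1.1 hne1.2
      · rintro rfl; exact hx'.elim hne2.1 hne2.2
    · intro u hu huq
      rw [g0, g1, N.partLive_tail hbo hbrest u]
      split
      · next e => rw [e]; exact hrem
      · next e =>
        refine (hadj u hu huq).congr fun x hx => ?_
        have hx' : x = u ∨ x ∈ N.out u := hx.imp_right fun h => (Net.mem_partLive.1 h).1
        have h1 := hpown u (hW hu) e
        have h2 := hnown u (hW hu) e
        refine ⟨Function.update_of_ne ?_ _ _, Function.update_of_ne ?_ _ _⟩
        · rintro rfl; exact hx'.elim h1.1 h1.2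
        · rintro rfl; exact hx'.elim h2.1 h2.2
    · rintro t o ρ' D' k ⟨rfl, ht, hk, hf, hl, hfr⟩
      refine ⟨rfl, ?_, by simp; omega, fun f h0 h1 => by rw [hf f h0 h1, gf f h0 h1], hl, ?_⟩
      · simp only [cost_fld, cost_reg, cost_ne, List.length_cons]; omega
      -- The overwritten next cell is that of `w` or of an arc of `w` other than `c`, and `c` is the
      -- only arc from `w` to `q`.
      · intro u x hx hxq
        rw [hfr u x hx hxq, g0, Function.update_of_ne]
        rintro rfl
        rcases hp2 with e | e
        · rw [e] at hx; have := N.arc_gt hx; omega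
        · exact hp1 (N.hd_inj (Net.mem_partLive.1 e).1 hcw (by rw [hxq, hhc]))

/-- The space that the deletions of vertices from the graph induced by `W` may still need. -/
def SG.pot (G : SG) (W : Finset ℕ) : ℕ := 2 * G.arcs W + W.card

/-- Counting only the arcs that leave `q` as lost is enough to pay for the deletion of `q`. -/
theorem SG.arcs_erase (G : SG) {W : Finset ℕ} {q : ℕ} (hq : q ∈ W) :
    G.arcs (W.erase q) + (G.nb q ∩ W).card ≤ G.arcs W := by
  unfold SG.arcs
  rw [← Finset.add_sum_erase W _ hq, Nat.add_comm]
  exact Nat.add_le_add_left (Finset.sum_le_sum fun u _ =>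
    Finset.card_le_card (Finset.inter_subset_inter_left (Finset.erase_subset _ _))) _

/-- Time is charged to the arcs that disappear and log space to the loss in `SG.pot`, so costs of
successive deletions telescope. By the last clause, a loop standing on an arc to `q` still finds its
next arc after the deletion. -/
theorem delete_spec {N : Net} {M : Mach} (hR : M.R = N.n + 2 * N.m) {lg : Bool} {d : ℕ}
    {D : ℕ → ℕ → ℕ} {T : ℕ} {W C F : Finset ℕ} {mk lk : ℕ → ℕ} (h : Rep N D W C F mk lk) {q : ℕ}
    (hqV : q ∈ N.V) (hqC : q ∉ C) {ρ : Reg → ℕ} (hρ : ρ .p = q) (hT : T + 2 * N.pot W ≤ M.S) :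
    hwp M lg d (edsG.body .delete) ρ D T fun t o _ D' k =>
      o = [] ∧ t + 150 * N.arcs (W.erase q) ≤ 100 + 150 * N.arcs W ∧
        k + N.pot (W.erase q) ≤ N.pot W ∧ Rep N D' (W.erase q) C F mk lk ∧
        (∀ u, ∀ c ∈ N.out u, N.hd c = q → D' 0 c = D 0 c) := by
  have hMS := M.hS
  have hq1 := N.mem_V.1 hqV
  change hwp M lg d deleteBody ρ D T _
  simp only [deleteBody, nxt, prv, twin, inG]
  have hval : deval M ρ D (fld 7 (.reg p)) = if q ∈ W then 1 else 0 := by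
    rw [deval_fld_reg (by norm_num) hρ, h.inG q hqV]
  refine hwp_ifThen (dfits_fld_reg (by norm_num) hρ (by omega) (by simp)) (fun hc => ?_) fun hc => ?_
  · rw [hval] at hc
    have hqW : q ∈ W := by by_contra hn; simp [hn] at hc
    have harcs := N.arcs_erase hqW
    have hcard := Finset.card_erase_of_mem hqW
    have hcpos : 0 < W.card := Finset.card_pos.2 ⟨q, hqW⟩
    unfold SG.pot at hT ⊢
    refine hwp_cons (hwp_upd (by norm_num) (by simp [hρ]; omega) (by simp [hρ]; omega) (by simp)
      (by simp) (by omega) ?_)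
    intro _
    simp only [deval_reg, hρ, deval_ofNat]
    set D1 := setF D 7 q 0 with hD1
    have g7 : D1 7 = Function.update (D 7) q 0 := by simp [hD1]
    have gf : ∀ f ≠ 7, D1 f = D f := fun f hf => setF_other _ _ _ hf
    clear_value D1
    have hdq := h.adj q hqW
    refine hwp_cons (hwp_set (dfits_fld_reg (by norm_num) hρ (by omega) (by omega)) ?_)
    intro _
    rw [deval_fld_reg (by norm_num) hρ, gf 0 (by norm_num), hdq.nx_root]
    refine hwp_cons (hwp_mono (delete_loop hR h.subV hqW (N.live W q) [] _ D1 _ rfl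
      (by simp [hρ]) (by simp)
      (fun u b hb => by rw [gf 3 (by norm_num)]; exact (h.arc hb).2)
      (by rw [gf 0 (by norm_num), gf 1 (by norm_num)]; exact hdq) ?_ ?_) ?_)
    · intro u hu huq
      rw [gf 0 (by norm_num), gf 1 (by norm_num)]
      -- The twin of every live arc to `q` is on the list of `q`, so nothing is missing at the
      -- start.
      have : N.partLive W q (N.live W q) u = N.live W u := List.filter_congr fun c hc => by
        simp only [decide_eq_decide, N.mem_live]
        exact ⟨fun h => h.1, fun h => ⟨h, fun e => ⟨by rw [← e]; exact N.tw_mem hc,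
          by rw [N.hd_tw hc]; exact hu⟩⟩⟩
      rw [this]
      exact h.adj u hu
    · rw [N.live_length]; omega
    · rintro t o ρ' D' k ⟨rfl, ht, hk, hf, hl, hfr⟩ _
      rw [N.live_length] at ht hk
      refine hwp_nil ⟨by simp, ?_, ?_, ?_, ?_⟩
      · simp only [cost_fld, cost_reg, cost_ofNat]; omega
      · omega
      · refine ⟨(Finset.erase_subset _ _).trans h.subV,
          Finset.subset_erase.2 ⟨h.subC, hqC⟩, ?_, ?_, ?_, ?_, ?_, ?_, ?_, ?_, ?_⟩
        · intro u b hb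
          rw [hf 2 (by norm_num) (by norm_num), hf 3 (by norm_num) (by norm_num),
            gf 2 (by norm_num), gf 3 (by norm_num)]
          exact h.arc hb
        · intro u hu
          rw [Finset.mem_erase] at hu
          have e : N.live (W.erase q) u = N.partLive W q [] u := List.filter_congr fun c hc => by
            simp [Finset.mem_erase, and_comm]
          rw [e]
          exact hl u hu.2 hu.1
        · rw [hf 2 (by norm_num) (by norm_num), hf 3 (by norm_num) (by norm_num),
            gf 2 (by norm_num), gf 3 (by norm_num)]
          exact h.cand
        · intro u hu
          rw [hf 4 (by norm_num) (by norm_num), gf 4 (by norm_num)]; exact h.inC u hu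
        · intro u hu
          rw [hf 5 (by norm_num) (by norm_num), gf 5 (by norm_num)]; exact h.flag u hu
        · intro u hu
          rw [hf 6 (by norm_num) (by norm_num), gf 6 (by norm_num)]
          exact h.cnt u (Finset.mem_of_mem_erase hu)
        · intro u hu
          rw [hf 7 (by norm_num) (by norm_num), g7, Function.update_apply, h.inG u hu]
          by_cases e : u = q <;> simp [e]
        · intro u hu
          rw [hf 8 (by norm_num) (by norm_num), gf 8 (by norm_num)]; exact h.marked u hu
        · intro u hu
          rw [hf 9 (by norm_num) (by norm_num), gf 9 (by norm_num)]; exact h.link u hu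
      · intro u x hx hxq
        rw [hfr u x hx hxq, gf 0 (by norm_num)]
  · rw [hval] at hc
    have hqW : q ∉ W := by intro hn; simp [hn] at hc
    rw [Finset.erase_eq_of_notMem hqW]
    refine ⟨rfl, ?_, by omega, h, fun _ _ _ _ => rfl⟩
    simp only [cost_fld, cost_reg]; omega

end EDSG

/-! ### Collecting the vertices that have to stay when `v` is removed -/

namespace EDSG

open RAM Reg

theorem DLL.nx_split {nx pv : ℕ → ℕ} {u : ℕ} {l₁ l₂ : List ℕ} (h : DLL nx pv u (l₁ ++ l₂)) :
    nx (l₁.getLastD u) = l₂.headD u := by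
  rcases List.eq_nil_or_concat l₁ with rfl | ⟨l, b, rfl⟩
  · exact h.nx_root
  · rw [List.concat_eq_append, List.append_assoc] at h
    simpa using h.nx_mid

/-- The vertices that have to stay in a solution without `v` in order to dominate `u`. -/
def SG.forced (G : SG) (C F : Finset ℕ) (v u : ℕ) : Finset ℕ :=
  if u ∉ F ∧ (G.cl u ∩ C).card = 2 then (G.cl u ∩ C).erase v else ∅

/-- The linked list of marked vertices. -/
structure Coll (C : Finset ℕ) (v : ℕ) (mk lk : ℕ → ℕ) (dl : List ℕ) : Prop where
  linked : Linked lk 0 dl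
  nodup : dl.Nodup
  mk_eq : ∀ x, mk x = if x ∈ dl then 1 else 0
  mem : ∀ x ∈ dl, x ∈ C ∧ x ≠ v

theorem Coll.length_le {C : Finset ℕ} {v : ℕ} {mk lk : ℕ → ℕ} {dl : List ℕ}
    (h : Coll C v mk lk dl) : dl.length ≤ C.card := by
  rw [← List.toFinset_card_of_nodup h.nodup]
  exact Finset.card_le_card fun x hx => (h.mem x (List.mem_toFinset.1 hx)).1

theorem Coll.length_lt {C : Finset ℕ} {v w : ℕ} {mk lk : ℕ → ℕ} {dl : List ℕ}
    (h : Coll C v mk lk dl) (hw : w ∈ C) (hwl : w ∉ dl) : dl.length < C.card := by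
  rw [← List.toFinset_card_of_nodup h.nodup]
  refine Finset.card_lt_card ⟨fun x hx => (h.mem x (List.mem_toFinset.1 hx)).1, fun hs => ?_⟩
  exact hwl (List.mem_toFinset.1 (hs hw))

theorem Coll.cons {C : Finset ℕ} {v w : ℕ} {mk lk : ℕ → ℕ} {dl : List ℕ}
    (h : Coll C v mk lk dl) (hw : w ∈ C) (hwv : w ≠ v) (hwl : w ∉ dl) :
    Coll C v (Function.update mk w 1) (Function.update lk w (dl.headD 0)) (w :: dl) where
  linked := by
    intro pre x post e
    cases pre with
    | nil =>
      simp only [List.nil_append, List.cons.injEq] at e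
      rw [← e.1, ← e.2, Function.update_self]
    | cons y pre =>
      simp only [List.cons_append, List.cons.injEq] at e
      rw [Function.update_of_ne, h.linked pre x post e.2]
      rintro rfl
      exact hwl (by rw [e.2]; simp)
  nodup := List.nodup_cons.2 ⟨hwl, h.nodup⟩
  mk_eq x := by
    by_cases hx : x = w
    · subst hx; simp
    · rw [Function.update_of_ne hx, h.mk_eq]; simp [hx]
  mem x hx := by
    rcases List.mem_cons.1 hx with rfl | hx
    · exact ⟨hw, hwv⟩
    · exact h.mem x hx

theorem Rep.setMarked {N : Net} {D : ℕ → ℕ → ℕ} {W C F : Finset ℕ} {mk lk : ℕ → ℕ}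
    (h : Rep N D W C F mk lk) (w x : ℕ) :
    Rep N (setF D 8 w x) W C F (Function.update mk w x) lk where
  subV := h.subV
  subC := h.subC
  arc hb := by simpa [setF_other] using h.arc hb
  adj u hu := by simpa [setF_other] using h.adj u hu
  cand := by simpa [setF_other] using h.cand
  inC u hu := by simpa [setF_other] using h.inC u hu
  flag u hu := by simpa [setF_other] using h.flag u hu
  cnt u hu := by simpa [setF_other] using h.cnt u hu
  inG u hu := by simpa [setF_other] using h.inG u hu
  marked u hu := by simp [Function.update_apply, h.marked u hu]
  link u hu := by simpa [setF_other] using h.link u hu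

theorem Rep.setLink {N : Net} {D : ℕ → ℕ → ℕ} {W C F : Finset ℕ} {mk lk : ℕ → ℕ}
    (h : Rep N D W C F mk lk) (w x : ℕ) :
    Rep N (setF D 9 w x) W C F mk (Function.update lk w x) where
  subV := h.subV
  subC := h.subC
  arc hb := by simpa [setF_other] using h.arc hb
  adj u hu := by simpa [setF_other] using h.adj u hu
  cand := by simpa [setF_other] using h.cand
  inC u hu := by simpa [setF_other] using h.inC u hu
  flag u hu := by simpa [setF_other] using h.flag u hu
  cnt u hu := by simpa [setF_other] using h.cnt u hu
  inG u hu := by simpa [setF_other] using h.inG u hu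
  marked u hu := by simpa [setF_other] using h.marked u hu
  link u hu := by simp [Function.update_apply, h.link u hu]

theorem Rep.setFlag {N : Net} {D : ℕ → ℕ → ℕ} {W C F : Finset ℕ} {mk lk : ℕ → ℕ}
    (h : Rep N D W C F mk lk) (w : ℕ) :
    Rep N (setF D 5 w 1) W C (insert w F) mk lk where
  subV := h.subV
  subC := h.subC
  arc hb := by simpa [setF_other] using h.arc hb
  adj u hu := by simpa [setF_other] using h.adj u hu
  cand := by simpa [setF_other] using h.cand
  inC u hu := by simpa [setF_other] using h.inC u hu
  flag u hu := by
    rw [setF_same, Function.update_apply, h.flag u hu]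
    by_cases e : u = w <;> simp [e]
  cnt u hu := by simpa [setF_other] using h.cnt u hu
  inG u hu := by simpa [setF_other] using h.inG u hu
  marked u hu := by simpa [setF_other] using h.marked u hu
  link u hu := by simpa [setF_other] using h.link u hu

section collect
variable {N : Net} {M : Mach} (hR : M.R = N.n + 2 * N.m) {lg : Bool} {d : ℕ}
include hR

/-- The loop has no test for the end of the list; it stops because a suitable arc is known to lie
ahead. -/
theorem search_loop {D : ℕ → ℕ → ℕ} {T : ℕ} {W C F : Finset ℕ} {mk lk : ℕ → ℕ}
    (h : Rep N D W C F mk lk) {q v : ℕ} (hq : q ∈ W) (hv : v ≤ M.R) :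
    ∀ (rest pre : List ℕ) (ρ : Reg → ℕ), N.live W q = pre ++ rest → ρ .p = v →
      ρ .b = rest.headD q → (∃ c ∈ rest, N.hd c ∈ C ∧ N.hd c ≠ v) →
      hwp M lg d (whileDo (eq ((fld inC (fld head b)) * (ne (fld head b) p)) 0)
        [ .set b (fld nxt b) ]) ρ D T fun t o ρ' D' k =>
        o = [] ∧ t ≤ 50 * rest.length ∧ k = 0 ∧ D' = D ∧
          ∃ c ∈ rest, N.hd c ∈ C ∧ N.hd c ≠ v ∧ ρ' = Function.update ρ .b c := by
  intro rest
  have hMS := M.hS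
  induction rest with
  | nil => rintro _ _ _ _ _ ⟨c, hc, -⟩; simp at hc
  | cons c rest ih =>
    intro pre ρ hpre hp hb hex
    simp only [List.headD_cons] at hb
    have hcl : c ∈ N.live W q := by rw [hpre]; simp
    have hco := (N.mem_live.1 hcl).1
    have hcm := h.mem_W_live hcl
    have hv4 := h.inC (N.hd c) (N.hd_mem hco)
    have hh : D 2 c = N.hd c := (h.arc hco).1
    simp only [inC, head, nxt]
    have hval : deval M ρ D (eq ((fld 4 (fld 2 b)) * (ne (fld 2 b) p)) 0) =
        if N.hd c ∈ C ∧ N.hd c ≠ v then 0 else 1 := by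
      rw [deval_eq, deval_mul, deval_fld_fld (by norm_num) (by norm_num) hb, deval_ne,
        deval_fld_reg (by norm_num) hb, hh, hv4, deval_reg, hp, deval_ofNat]
      by_cases h1 : N.hd c ∈ C <;> by_cases h2 : N.hd c = v <;> simp [h1, h2]
    have hfits : DFits M ρ D (eq ((fld 4 (fld 2 b)) * (ne (fld 2 b) p)) 0) := by
      rw [dfits_eq, dfits_mul, dfits_ne, deval_fld_fld (by norm_num) (by norm_num) hb, deval_ne,
        deval_fld_reg (by norm_num) hb, hh, hv4]
      refine ⟨⟨dfits_fld_fld (by norm_num) (by norm_num) hb (by omega) (by simp) hh (by omega)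
        (by simp), ⟨dfits_fld_reg (by norm_num) hb (by omega) (by simp), ?_⟩, ?_⟩, ?_⟩
      · simp [hp]; omega
      · split <;> split <;> omega
      · simp
    refine hwp_while hfits (fun hc => ?_) fun hc => ?_
    · rw [hval] at hc
      have hnot : ¬ (N.hd c ∈ C ∧ N.hd c ≠ v) := by intro hn; simp [hn] at hc
      refine hwp_cons (hwp_set (dfits_fld_reg (by norm_num) hb (by omega) (by omega)) ?_)
      intro _
      rw [deval_fld_reg (by norm_num) hb]
      have hdq := h.adj q hq
      rw [hpre] at hdq
      rw [hdq.nx_mid]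
      refine hwp_nil ?_
      intro _
      refine hwp_mono (ih (pre ++ [c]) _ (by rw [hpre]; simp) (by simpa using hp) (by simp) ?_) ?_
      · obtain ⟨x, hx, hx'⟩ := hex
        rcases List.mem_cons.1 hx with rfl | hx
        · exact absurd hx' hnot
        · exact ⟨x, hx, hx'⟩
      · rintro t o ρ' D' k ⟨rfl, ht, rfl, rfl, x, hx, hx1, hx2, rfl⟩
        refine ⟨rfl, ?_, by simp, rfl, x, List.mem_cons_of_mem _ hx, hx1, hx2, by simp⟩
        simp only [cost_eq, cost_mul, cost_ne, cost_fld, cost_reg, cost_ofNat, List.length_cons]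
        omega
    · rw [hval] at hc
      have hyes : N.hd c ∈ C ∧ N.hd c ≠ v := by by_contra hn; simp [hn] at hc
      refine ⟨rfl, ?_, rfl, rfl, c, by simp, hyes.1, hyes.2, ?_⟩
      · simp only [cost_eq, cost_mul, cost_ne, cost_fld, cost_reg, cost_ofNat, List.length_cons]
        omega
      · rw [← hb, Function.update_eq_self]

/-- If the counter is 2 and `v` is counted, there is a unique other counted vertex; it is `q` itself
or a head on the list of `q`. The mark keeps it from being linked twice, so there are two log
entries per new element. -/
theorem collect_one {D : ℕ → ℕ → ℕ} {T : ℕ} {W C F : Finset ℕ} {mk lk : ℕ → ℕ}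
    (h : Rep N D W C F mk lk) {q v : ℕ} (hq : q ∈ W) (hv : v ∈ C) (hvq : v ∈ N.cl q)
    {dl : List ℕ} (hc : Coll C v mk lk dl) {ρ : Reg → ℕ} (hp : ρ .p = v) (hu : ρ .u = q)
    (hdel : ρ .del = dl.headD 0) (hT : T + 4 * (C.card - dl.length) ≤ M.S) :
    hwp M lg d (ifThen (eq (fld flag u) 0)
          [ ifThen (eq (fld cnt u) 2)
              [ .set w u,
                ifThen (eq ((fld inC u) * (ne u p)) 0)
                  [ .set b (fld nxt u),
                    whileDo (eq ((fld inC (fld head b)) * (ne (fld head b) p)) 0)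
                      [ .set b (fld nxt b) ],
                    .set w (fld head b) ],
                ifThen (eq (fld marked w) 0)
                  [ upd marked w 1,
                    upd link w del,
                    .set del w ] ] ]) ρ D T fun t o ρ' D' k =>
      o = [] ∧ t ≤ 300 + 50 * (N.nb q ∩ W).card ∧ ρ' .p = v ∧ ρ' .a = ρ .a ∧
        ∃ dl' mk' lk', Rep N D' W C F mk' lk' ∧ Coll C v mk' lk' dl' ∧ ρ' .del = dl'.headD 0 ∧
          (∀ x, x ∈ dl' ↔ x ∈ dl ∨ x ∈ N.forced C F v q) ∧ k + 2 * dl.length = 2 * dl'.length := by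
  have hMS := M.hS
  have hq1 := h.pos hq
  have hv1 := h.pos (h.subC hv)
  have hqV := h.subV hq
  simp only [inC, head, nxt, EDSG.flag, cnt, EDSG.marked, EDSG.link]
  have hnoop : N.forced C F v q = ∅ → ∃ dl' mk' lk', Rep N D W C F mk' lk' ∧ Coll C v mk' lk' dl' ∧
      ρ .del = dl'.headD 0 ∧
      (∀ x, x ∈ dl' ↔ x ∈ dl ∨ x ∈ N.forced C F v q) ∧ 0 + 2 * dl.length = 2 * dl'.length :=
    fun he => ⟨dl, mk, lk, h, hc, hdel, by simp [he], by simp⟩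
  refine hwp_ifThen (by simp only [dfits_eq, dfits_ofNat]; exact
    ⟨dfits_fld_reg (by norm_num) hu (by omega) (by simp), by simp⟩) (fun hf => ?_) fun hf => ?_
  swap
  · rw [deval_eq, deval_fld_reg (by norm_num) hu, h.flag q hqV, deval_ofNat] at hf
    have hF : q ∈ F := by by_contra hn; simp [hn] at hf
    exact ⟨rfl, by simp; omega, hp, rfl, hnoop (by simp [SG.forced, hF])⟩
  rw [deval_eq, deval_fld_reg (by norm_num) hu, h.flag q hqV, deval_ofNat] at hf
  have hF : q ∉ F := by intro hn; simp [hn] at hf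
  refine hwp_cons ?_
  refine hwp_ifThen (by simp only [dfits_eq, dfits_ofNat]; exact
    ⟨dfits_fld_reg (by norm_num) hu (by omega) (by simp), by omega⟩) (fun hf => ?_) fun hf => ?_
  swap
  · rw [deval_eq, deval_fld_reg (by norm_num) hu, h.cnt q hq, deval_ofNat] at hf
    have h2 : (N.cl q ∩ C).card ≠ 2 := by intro hn; simp [hn] at hf
    intro _
    exact hwp_nil ⟨rfl, by simp; omega, hp, rfl, hnoop (by simp [SG.forced, h2])⟩
  rw [deval_eq, deval_fld_reg (by norm_num) hu, h.cnt q hq, deval_ofNat] at hf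
  have h2 : (N.cl q ∩ C).card = 2 := by by_contra hn; simp [hn] at hf
  have hforced : N.forced C F v q = (N.cl q ∩ C).erase v := by simp [SG.forced, hF, h2]
  have hvm : v ∈ N.cl q ∩ C := Finset.mem_inter.2 ⟨hvq, hv⟩
  obtain ⟨z, hz⟩ := Finset.card_eq_one.1 (show ((N.cl q ∩ C).erase v).card = 1 by
    rw [Finset.card_erase_of_mem hvm, h2])
  have hzm : z ≠ v ∧ z ∈ N.cl q ∧ z ∈ C := by
    have : z ∈ (N.cl q ∩ C).erase v := by rw [hz]; simp
    simpa [Finset.mem_erase] using this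
  have hzuniq : ∀ x, x ∈ N.cl q → x ∈ C → x ≠ v → x = z := fun x h1 h2 h3 => by
    have : x ∈ (N.cl q ∩ C).erase v := by simp [h1, h2, h3]
    rw [hz] at this; simpa using this
  have hz1 := h.pos (h.subC hzm.2.2)
  rw [hforced, hz]
  -- the register `w` receives `z`
  refine hwp_cons (hwp_set (by simp [hu]; omega) ?_)
  intro _
  simp only [deval_reg, hu]
  set ρ1 := Function.update ρ Reg.w q with hρ1
  have hu1 : ρ1 .u = q := by simpa [hρ1] using hu
  have hp1 : ρ1 .p = v := by simpa [hρ1] using hp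
  have hv4 := h.inC q hqV
  have hval : deval M ρ1 D (eq ((fld 4 u) * (ne u p)) 0) =
      if q ∈ C ∧ q ≠ v then 0 else 1 := by
    rw [deval_eq, deval_mul, deval_fld_reg (by norm_num) hu1, deval_ne, hv4, deval_reg, hu1,
      deval_reg, hp1, deval_ofNat]
    by_cases h1 : q ∈ C <;> by_cases h2 : q = v <;> simp [h1, h2]
  have hfits : DFits M ρ1 D (eq ((fld 4 u) * (ne u p)) 0) := by
    rw [dfits_eq, dfits_mul, dfits_ne, deval_fld_reg (by norm_num) hu1, deval_ne, hv4]
    refine ⟨⟨dfits_fld_reg (by norm_num) hu1 (by omega) (by simp), ⟨?_, ?_⟩, ?_⟩, ?_⟩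
    · simp [hu1]; omega
    · simp [hp1]; omega
    · split <;> split <;> omega
    · simp
  refine hwp_cons (hwp_mono (Q' := fun t o ρ' D' k => o = [] ∧ t ≤ 60 + 50 * (N.nb q ∩ W).card ∧
    k = 0 ∧ D' = D ∧ ρ' .w = z ∧ ρ' .p = v ∧ ρ' .a = ρ .a ∧ ρ' .del = ρ .del) ?_ ?_)
  · refine hwp_ifThen hfits (fun hcond => ?_) fun hcond => ?_
    · rw [hval] at hcond
      have hnot : ¬ (q ∈ C ∧ q ≠ v) := by intro hn; simp [hn] at hcond
      refine hwp_cons (hwp_set (dfits_fld_reg (by norm_num) hu1 (by omega) (by omega)) ?_)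
      intro _
      rw [deval_fld_reg (by norm_num) hu1, (h.adj q hq).nx_root]
      have hzn : z ∈ N.nb q ∩ W := by
        refine Finset.mem_inter.2 ⟨(N.mem_cl.1 hzm.2.1).resolve_left fun e => ?_,
          h.subC hzm.2.2⟩
        exact hnot ⟨e ▸ hzm.2.2, e ▸ hzm.1⟩
      obtain ⟨c, hcl, hcz⟩ := List.mem_map.1 (N.mem_live_hd.2 hzn)
      refine hwp_cons (hwp_mono (search_loop hR h hq (v := v) (by omega) (N.live W q) [] _ rfl
        (by simpa using hp1) (by simp) ⟨c, hcl, by rw [hcz]; exact hzm.2.2, by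
          rw [hcz]; exact hzm.1⟩) ?_)
      rintro t o ρ' D' k ⟨rfl, ht, rfl, rfl, x, hx, hx1, hx2, rfl⟩ _
      have hxm := h.mem_W_live hx
      have hxo := (N.mem_live.1 hx).1
      have hxz : N.hd x = z := hzuniq _ (N.mem_cl.2 (Or.inr (N.mem_nb.2 ⟨x, hxo, rfl⟩))) hx1 hx2
      rw [N.live_length] at ht
      refine hwp_cons (hwp_set (dfits_fld_reg (x := x) (by norm_num) (by simp) (by omega)
        (by simp)) ?_)
      intro _
      rw [deval_fld_reg (x := x) (by norm_num) (by simp), (h.arc hxo).1, hxz]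
      refine hwp_nil ⟨by simp, ?_, by simp, rfl, by simp, by simpa using hp1, by simp [hρ1],
        by simp [hρ1]⟩
      simp only [cost_eq, cost_mul, cost_ne, cost_fld, cost_reg, cost_ofNat]
      omega
    · rw [hval] at hcond
      have hyes : q ∈ C ∧ q ≠ v := by by_contra hn; simp [hn] at hcond
      refine ⟨rfl, ?_, rfl, rfl, ?_, hp1, by simp [hρ1], by simp [hρ1]⟩
      · simp only [cost_eq, cost_mul, cost_ne, cost_fld, cost_reg, cost_ofNat]
        omega
      · rw [← hzuniq q (N.mem_cl_self q) hyes.1 hyes.2]; simp [hρ1]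
  rintro t o ρ2 D' k ⟨rfl, ht, rfl, rfl, hw2, hp2, ha2, hd2⟩ _
  have hmk := h.marked z (h.subV (h.subC hzm.2.2))
  refine hwp_cons ?_
  refine hwp_ifThen (by simp only [dfits_eq, dfits_ofNat]; exact
    ⟨dfits_fld_reg (by norm_num) hw2 (by omega) (by simp), by simp⟩) (fun hf => ?_) fun hf => ?_
  · rw [deval_eq, deval_fld_reg (by norm_num) hw2, hmk, deval_ofNat, hc.mk_eq] at hf
    have hzl : z ∉ dl := by intro hn; simp [hn] at hf
    have hlt := hc.length_lt hzm.2.2 hzl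
    have hdS : ρ2 .del ≤ M.S := by
      rw [hd2, hdel]
      rcases headD_mem dl 0 with e | e
      · omega
      · have := h.pos (h.subC (hc.mem _ e).1); omega
    refine hwp_cons (hwp_upd (by norm_num) (by simp [hw2]; omega) (by simp [hw2]; omega) (by simp)
      (by simp; omega) (by omega) ?_)
    intro _
    simp only [deval_reg, hw2, deval_ofNat]
    refine hwp_cons (hwp_upd (by norm_num) (by simp [hw2]; omega) (by simp [hw2]; omega) (by simp)
      (by simpa using hdS) (by omega) ?_)
    intro _
    simp only [deval_reg, hw2]
    refine hwp_cons (hwp_set (by simp [hw2]; omega) ?_)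
    intro _
    refine hwp_nil ?_
    intro _
    refine hwp_nil ?_
    intro _
    refine hwp_nil ⟨by simp, ?_, by simpa using hp2, by simpa using ha2, z :: dl, _, _,
      (h.setMarked z 1).setLink z _, by rw [hd2, hdel]; exact hc.cons hzm.2.2 hzm.1 hzl,
      by simp [hw2], fun x => by simp [or_comm], by simp; omega⟩
    simp only [cost_eq, cost_mul, cost_ne, cost_fld, cost_reg, cost_ofNat]
    omega
  · rw [deval_eq, deval_fld_reg (by norm_num) hw2, hmk, deval_ofNat, hc.mk_eq] at hf
    have hzl : z ∈ dl := by by_contra hn; simp [hn] at hf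
    intro _
    refine hwp_nil ?_
    intro _
    refine hwp_nil ⟨by simp, ?_, hp2, ha2, dl, mk, lk, h, hc, by rw [hd2, hdel],
      fun x => by simp; rintro rfl; exact hzl, by simp⟩
    simp only [cost_eq, cost_mul, cost_ne, cost_fld, cost_reg, cost_ofNat]
    omega

end collect

end EDSG

/-! ### The loops of `candG` -/

namespace EDSG

open RAM Reg

section candG
variable {N : Net} {M : Mach} (hR : M.R = N.n + 2 * N.m) {lg : Bool} {d : ℕ}
include hR

/-- The loop tests its condition at the end: it treats `v` first, with `a` at the sentinel, and then
the neighbours of `v`. The list `pre` is the part already passed, so the current arc is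
`pre.getLastD v`. -/
theorem collect_loop {W C F : Finset ℕ} {v : ℕ} (hv : v ∈ C) :
    ∀ (rest pre : List ℕ) (D : ℕ → ℕ → ℕ) (T : ℕ) (mk lk : ℕ → ℕ) (dl : List ℕ) (ρ : Reg → ℕ)
      (q : ℕ), Rep N D W C F mk lk → N.live W v = pre ++ rest → q ∈ W → v ∈ N.cl q →
      Coll C v mk lk dl → ρ .p = v → ρ .u = q → ρ .a = pre.getLastD v → ρ .go = 1 →
      ρ .del = dl.headD 0 → T + 4 * (C.card - dl.length) ≤ M.S →
      hwp M lg d (whileDo go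
        [ ifThen (eq (fld flag u) 0)
          [ ifThen (eq (fld cnt u) 2)
              [ .set w u,
                ifThen (eq ((fld inC u) * (ne u p)) 0)
                  [ .set b (fld nxt u),
                    whileDo (eq ((fld inC (fld head b)) * (ne (fld head b) p)) 0)
                      [ .set b (fld nxt b) ],
                    .set w (fld head b) ],
                ifThen (eq (fld marked w) 0)
                  [ upd marked w 1,
                    upd link w del,
                    .set del w ] ] ],
          .set a (fld nxt a),
          .set u (fld head a),
          .set go (ne a p) ]) ρ D T fun t o ρ' D' k =>
        o = [] ∧ t ≤ 400 * (1 + rest.length) + 50 * ((N.nb q ∩ W).card +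
            (rest.map fun b => (N.nb (N.hd b) ∩ W).card).sum) ∧ ρ' .p = v ∧
          ∃ dl' mk' lk', Rep N D' W C F mk' lk' ∧ Coll C v mk' lk' dl' ∧ ρ' .del = dl'.headD 0 ∧
            (∀ x, x ∈ dl' ↔ x ∈ dl ∨ x ∈ N.forced C F v q ∨ ∃ b ∈ rest, x ∈ N.forced C F v (N.hd b)) ∧
            k + 2 * dl.length = 2 * dl'.length := by
  intro rest
  have hMS := M.hS
  induction rest with
  | nil =>
    intro pre D T mk lk dl ρ q h hpre hq hvq hc hp hu ha hgo hdel hT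
    have hv1 := h.pos (h.subC hv)
    have hlast : ∀ x, x = pre.getLastD v → 1 ≤ x ∧ x ≤ M.R := fun x hx => by
      rcases getLastD_mem pre v with e | e
      · omega
      · have := h.mem_W_live (u := v) (b := pre.getLastD v) (by rw [hpre]; simpa using e); omega
    refine hwp_while (by simp [hgo]; omega) (fun _ => ?_) fun h0 => by simp [hgo] at h0
    refine hwp_cons (hwp_mono (collect_one hR h hq hv hvq hc hp hu hdel hT) ?_)
    rintro t o ρ1 D1 k ⟨rfl, ht, hp1, ha1, dl', mk', lk', h', hc', hdel', hmem, hk⟩ hTS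
    rw [ha] at ha1
    obtain ⟨hl0, hlR⟩ := hlast _ rfl
    refine hwp_cons (hwp_set (dfits_fld_reg (by norm_num) ha1 (by omega) (by omega)) ?_)
    intro _
    have hn : D1 0 (pre.getLastD v) = v := by
      have := h'.adj v (h.subC hv)
      rw [hpre] at this
      exact this.nx_split
    rw [deval_fld_reg (by norm_num) ha1]
    simp only [nxt, hn]
    -- Here `a` is back at the vertex record `v`, whose cell 2 is a candidate pointer and no head.
    -- The value is legal but never used, since `go` becomes 0.
    refine hwp_cons (hwp_set (dfits_fld_reg (x := v) (by norm_num) (by simp) (by omega)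
      (by omega)) ?_)
    intro _
    refine hwp_cons (hwp_set (by simp [hp1]; omega) ?_)
    intro _
    refine hwp_nil ?_
    intro _
    refine hwp_while (by simp [hp1]) (fun h0 => by simp [hp1] at h0) fun _ => ?_
    refine ⟨by simp, ?_, by simpa using hp1, dl', mk', lk', h', hc', by simpa using hdel',
      fun x => by simp [hmem], by omega⟩
    simp
    omega
  | cons c rest ih =>
    intro pre D T mk lk dl ρ q h hpre hq hvq hc hp hu ha hgo hdel hT
    have hv1 := h.pos (h.subC hv)
    have hlast : ∀ x, x = pre.getLastD v → 1 ≤ x ∧ x ≤ M.R := fun x hx => by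
      rcases getLastD_mem pre v with e | e
      · omega
      · have := h.mem_W_live (u := v) (b := pre.getLastD v) (by
          rw [hpre]; exact List.mem_append_left _ e)
        omega
    have hcl : c ∈ N.live W v := by rw [hpre]; simp
    have hcm := h.mem_W_live hcl
    have hco := (N.mem_live.1 hcl).1
    refine hwp_while (by simp [hgo]; omega) (fun _ => ?_) fun h0 => by simp [hgo] at h0
    refine hwp_cons (hwp_mono (collect_one hR h hq hv hvq hc hp hu hdel hT) ?_)
    rintro t o ρ1 D1 k ⟨rfl, ht, hp1, ha1, dl', mk', lk', h', hc', hdel', hmem, hk⟩ hTS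
    rw [ha] at ha1
    obtain ⟨hl0, hlR⟩ := hlast _ rfl
    refine hwp_cons (hwp_set (dfits_fld_reg (by norm_num) ha1 (by omega) (by omega)) ?_)
    intro _
    have hn : D1 0 (pre.getLastD v) = c := by
      have := h'.adj v (h.subC hv)
      rw [hpre] at this
      exact this.nx_split
    rw [deval_fld_reg (by norm_num) ha1]
    simp only [nxt, hn]
    refine hwp_cons (hwp_set (dfits_fld_reg (x := c) (by norm_num) (by simp) (by omega)
      (by omega)) ?_)
    rw [deval_fld_reg (x := c) (by norm_num) (by simp), (h'.arc hco).1]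
    intro _
    refine hwp_cons (hwp_set (by simp [hp1]; omega) ?_)
    intro _
    refine hwp_nil ?_
    intro _
    have hcv : c ≠ v := by omega
    have hlen := hc'.length_le
    refine hwp_mono (ih (pre ++ [c]) D1 _ mk' lk' dl' _ (N.hd c) h' (by rw [hpre]; simp)
      hcm.2.2.1 (N.mem_cl.2 (Or.inr (N.symm (N.mem_nb.2 ⟨c, hco, rfl⟩)))) hc'
      (by simpa using hp1) (by simp) (by simp) (by simp [hp1, hcv]) (by simpa using hdel') ?_) ?_
    · omega
    · rintro t' o' ρ' D' k' ⟨rfl, ht', hp', dl'', mk'', lk'', h'', hc'', hdel'', hmem', hk'⟩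
      refine ⟨by simp, ?_, hp', dl'', mk'', lk'', h'', hc'', hdel'', fun x => ?_, by omega⟩
      · simp only [List.map_cons, List.sum_cons, List.length_cons, cost_reg, cost_fld, cost_ne]
        omega
      · rw [hmem', hmem]
        simp only [List.mem_cons, exists_eq_or_imp, or_assoc]

theorem drops_loop {W F : Finset ℕ} {mk lk : ℕ → ℕ} :
    ∀ (dl : List ℕ) (C : Finset ℕ) (D : ℕ → ℕ → ℕ) (T : ℕ) (ρ : Reg → ℕ), Rep N D W C F mk lk →
      dl.Nodup → (∀ x ∈ dl, x ∈ C) → Linked lk 0 dl → ρ .x = dl.headD 0 →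
      T + 2 * (dl.map fun x => 4 + (N.nb x).card).sum ≤ M.S →
      hwp M lg (d + 1) (whileDo x
      [ .call .drop x,
        .set x (fld link x) ]) ρ D T fun t o ρ' D' k =>
        o = [] ∧ t ≤ 2 + (dl.map fun x => 400 + 80 * (N.nb x ∩ W).card).sum ∧
          k ≤ (dl.map fun x => 4 + (N.nb x).card).sum ∧
          Rep N D' W (C \ dl.toFinset) F mk lk ∧ ∃ y, ρ' = Function.update ρ .x y := by
  intro dl
  have hMS := M.hS
  induction dl with
  | nil =>
    intro C D T ρ h _ _ _ hx hT
    simp only [List.headD_nil] at hx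
    refine hwp_while (by simp [hx]) (fun h0 => by simp [hx] at h0) fun _ => ?_
    exact ⟨rfl, by simp, by simp, by simpa using h, ρ .x, by simp⟩
  | cons z dl ih =>
    intro C D T ρ h hnd hmem hl hx hT
    simp only [List.headD_cons] at hx
    simp only [List.map_cons, List.sum_cons] at hT
    have hzC := hmem z (by simp)
    have hz1 := h.pos (h.subC hzC)
    have hcard : (N.nb z ∩ W).card ≤ (N.nb z).card := Finset.card_le_card Finset.inter_subset_left
    refine hwp_while (by simp [hx]; omega) (fun _ => ?_) fun h0 => by simp [hx] at h0; omega
    refine hwp_cons (hwp_call (by simp [hx]; omega) (hwp_mono (drop_spec hR h hzC (by simp [hx])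
      (by omega)) ?_))
    rintro t o - D1 k ⟨rfl, ht, hk, h1⟩ _
    refine hwp_cons (hwp_set (dfits_fld_reg (by norm_num) hx (by omega) (by simp)) ?_)
    intro _
    rw [deval_fld_reg (by norm_num) hx, h1.link z (h1.subV (h.subC hzC)), hl.head]
    refine hwp_nil ?_
    intro _
    obtain ⟨hzdl, hnd'⟩ := List.nodup_cons.1 hnd
    refine hwp_mono (ih (C.erase z) D1 _ _ h1 hnd' (fun x hx => Finset.mem_erase.2
      ⟨fun e => hzdl (e ▸ hx), hmem x (by simp [hx])⟩) hl.tail (by simp) (by omega)) ?_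
    rintro t' o' ρ' D' k' ⟨rfl, ht', hk', h', y, hy⟩
    refine ⟨by simp, ?_, ?_, ?_, y, by rw [hy]; simp⟩
    · simp only [List.map_cons, List.sum_cons, cost_reg, cost_fld]; omega
    · simp only [List.map_cons, List.sum_cons]; omega
    · have : C \ (z :: dl).toFinset = C.erase z \ dl.toFinset := by
        ext x; simp [Finset.mem_sdiff, Finset.mem_erase]; tauto
      rw [this]
      exact h'

/-- Deleting the head of the current arc removes at most this arc from the list of `q`. So the arcs
ahead remain a suffix of the live list, and only the part already passed can shrink. -/
theorem flag_loop {C : Finset ℕ} {mk lk : ℕ → ℕ} {q : ℕ} :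
    ∀ (rest pre : List ℕ) (W F : Finset ℕ) (D : ℕ → ℕ → ℕ) (T : ℕ) (ρ : Reg → ℕ),
      Rep N D W C F mk lk → q ∈ W → N.live W q = pre ++ rest → ρ .del = q → ρ .a = rest.headD q →
      T + 2 * (rest.length + N.pot W) ≤ M.S →
      hwp M lg (d + 1) (whileDo (ne a del)
          [ .set u (fld head a),
            upd flag u 1,
            ifThen (eq (fld inC u) 0) [ .call .delete u ],
            .set a (fld nxt a) ]) ρ D T fun t o ρ' D' k =>
        o = [] ∧ ρ' .del = q ∧ ρ' .p = ρ .p ∧ ∃ W' F', Rep N D' W' C F' mk lk ∧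
          t + 150 * N.arcs W' ≤ 5 + 300 * rest.length + 150 * N.arcs W ∧
          k + N.pot W' ≤ rest.length + N.pot W ∧
          (∀ x, x ∈ W' ↔ x ∈ W ∧ (x ∈ C ∨ x ∉ rest.map N.hd)) ∧
          (∀ x, x ∈ F' ↔ x ∈ F ∨ x ∈ rest.map N.hd) := by
  intro rest
  have hMS := M.hS
  induction rest with
  | nil =>
    intro pre W F D T ρ h hq _ hdel ha _
    have hq1 := h.pos hq
    simp only [List.headD_nil] at ha
    refine hwp_while (by simp [ha, hdel]; omega) (fun h0 => by simp [ha, hdel] at h0) fun _ => ?_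
    exact ⟨rfl, hdel, rfl, W, F, h, by simp, by simp, by simp, by simp⟩
  | cons c rest ih =>
    intro pre W F D T ρ h hq hpre hdel ha hT
    have hq1 := h.pos hq
    simp only [List.headD_cons] at ha
    simp only [List.length_cons] at hT
    have hcl : c ∈ N.live W q := by rw [hpre]; simp
    have hcm := h.mem_W_live hcl
    have hco := (N.mem_live.1 hcl).1
    have hnd := N.live_nodup W q
    rw [hpre] at hnd
    refine hwp_while (by simp [ha, hdel]; omega) (fun _ => ?_) fun h0 => by
      simp [ha, hdel] at h0; omega
    simp only [head, EDSG.flag, inC, nxt]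
    refine hwp_cons (hwp_set (dfits_fld_reg (by norm_num) ha (by omega) (by simp)) ?_)
    rw [deval_fld_reg (by norm_num) ha, (h.arc hco).1]
    intro _
    set w := N.hd c with hw
    refine hwp_cons (hwp_upd (by norm_num) (by simp; omega) (by simp; omega) (by simp)
      (by simp; omega) (by omega) ?_)
    intro _
    simp only [deval_reg, Function.update_self, deval_ofNat]
    have h1 := h.setFlag w
    set D1 := setF D 5 w 1 with hD1
    have hnext : D1 0 c = rest.headD q := by
      have := h1.adj q hq
      rw [hpre] at this
      exact this.nx_mid
    have hwq : w ≠ q := N.hd_ne hco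
    -- deletion of `w` if it is not a candidate
    refine hwp_cons (hwp_mono (Q' := fun t o ρ' D' k => o = [] ∧
      ρ' = Function.update ρ Reg.u w ∧ D' 0 c = rest.headD q ∧ ∃ W', Rep N D' W' C (insert w F) mk lk ∧
        t + 150 * N.arcs W' ≤ 120 + 150 * N.arcs W ∧ k + N.pot W' ≤ N.pot W ∧
        (∀ x, x ∈ W' ↔ x ∈ W ∧ (x ∈ C ∨ x ≠ w))) ?_ ?_)
    · have hv4 := h1.inC w (h.subV hcm.2.2.1)
      refine hwp_ifThen (by simp only [dfits_eq, dfits_ofNat]; exact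
        ⟨dfits_fld_reg (x := w) (by norm_num) (by simp) (by omega) (by simp), by simp⟩)
        (fun hc => ?_) fun hc => ?_
      · rw [deval_eq, deval_fld_reg (x := w) (by norm_num) (by simp), hv4, deval_ofNat] at hc
        have hwC : w ∉ C := by intro hn; simp [hn] at hc
        refine hwp_cons (hwp_call (by simp; omega) (hwp_mono (delete_spec hR h1
          (h.subV hcm.2.2.1) hwC (by simp) (by omega)) ?_))
        rintro t o - D' k ⟨rfl, ht, hk, h', hfr⟩ _
        refine hwp_nil ⟨by simp, rfl, by rw [hfr q c hco rfl, hnext], W.erase w, h', ?_, by omega,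
          fun x => ?_⟩
        · simp; omega
        · rw [Finset.mem_erase]
          constructor
          · rintro ⟨h3, h4⟩; exact ⟨h4, Or.inr h3⟩
          · rintro ⟨h3, h4 | h4⟩
            · exact ⟨fun e => hwC (e ▸ h4), h3⟩
            · exact ⟨h4, h3⟩
      · rw [deval_eq, deval_fld_reg (x := w) (by norm_num) (by simp), hv4, deval_ofNat] at hc
        have hwC : w ∈ C := by by_contra hn; simp [hn] at hc
        refine ⟨rfl, rfl, hnext, W, h1, by simp, by simp, fun x => ?_⟩
        constructor
        · intro h3; exact ⟨h3, by by_cases e : x = w; exacts [Or.inl (e ▸ hwC), Or.inr e]⟩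
        · exact fun h3 => h3.1
    rintro t o ρ1 D2 k ⟨rfl, hρ1, hn2, W1, h2, ht, hk, hW1⟩ _
    have ha1 : ρ1 .a = c := by simpa [hρ1] using ha
    refine hwp_cons (hwp_set (dfits_fld_reg (by norm_num) ha1 (by omega) (by omega)) ?_)
    rw [deval_fld_reg (by norm_num) ha1, hn2]
    intro _
    refine hwp_nil ?_
    intro _
    have hqW1 : q ∈ W1 := (hW1 q).2 ⟨hq, Or.inr hwq.symm⟩
    have hlive : ∃ pre', N.live W1 q = pre' ++ rest := by
      have e : N.live W1 q = (N.live W q).filter fun x => N.hd x ∈ C ∨ x ≠ c := by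
        unfold Net.live
        rw [List.filter_filter]
        refine List.filter_congr fun x hx => ?_
        rw [← Bool.decide_and, decide_eq_decide, hW1]
        have : N.hd x ≠ w ↔ x ≠ c := not_congr ⟨fun e => N.hd_inj hx hco e, fun e => by rw [e]⟩
        rw [this]; tauto
      rw [e, hpre, List.filter_append, List.filter_cons]
      have e2 : rest.filter (fun x => decide (N.hd x ∈ C ∨ x ≠ c)) = rest :=
        List.filter_eq_self.2 fun x hx => decide_eq_true (Or.inr fun e =>
          (List.nodup_cons.1 (List.nodup_append.1 hnd).2.1).1 (e ▸ hx))
      rw [e2]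
      split
      · exact ⟨_ ++ [c], by rw [List.append_assoc]; rfl⟩
      · exact ⟨_, rfl⟩
    obtain ⟨pre', hpre'⟩ := hlive
    refine hwp_mono (ih pre' W1 (insert w F) D2 _ _ h2 hqW1 hpre' (by simp [hρ1, hdel]) (by simp)
      (by omega)) ?_
    rintro t' o' ρ' D' k' ⟨rfl, hdel', hp', W', F', h', ht', hk', hW', hF'⟩
    refine ⟨by simp, hdel', by rw [hp']; simp [hρ1], W', F', h', ?_, ?_, fun x => ?_, fun x => ?_⟩
    · simp; omega
    · simp; omega
    · rw [hW', hW1]; simp only [List.map_cons, List.mem_cons]; tauto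
    · rw [hF', Finset.mem_insert]; simp only [List.map_cons, List.mem_cons]; tauto

end candG

end EDSG

/-! ### The specification of `candG` -/

namespace EDSG

open RAM Reg

/-- The vertices that have to stay in a solution once `v` is removed from it, computed in the
graph induced by `W`. -/
def SG.dels (G : SG) (W C F : Finset ℕ) (v : ℕ) : Finset ℕ :=
  (G.cl v ∩ W).biUnion (G.forced C F v)

/-- The log space that the computation may still need. -/
def SG.room (G : SG) (C W : Finset ℕ) : ℕ := 8 * ∑ x ∈ C, (1 + (G.nb x).card) + G.pot W

theorem SG.mem_forced {G : SG} {C F : Finset ℕ} {v u x : ℕ} (h : x ∈ G.forced C F v u) :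
    x ∈ C ∧ x ≠ v ∧ u ∉ F ∧ (G.cl u ∩ C).card = 2 ∧ x ∈ G.cl u := by
  unfold SG.forced at h
  split at h
  · next h1 =>
    simp only [Finset.mem_erase, Finset.mem_inter] at h
    exact ⟨h.2.2, h.1, h1.1, h1.2, h.2.1⟩
  · simp at h

theorem SG.card_le_arcs (G : SG) {W : Finset ℕ} {u : ℕ} (hu : u ∈ W) :
    (G.nb u ∩ W).card ≤ G.arcs W :=
  Finset.single_le_sum (f := fun u => (G.nb u ∩ W).card) (fun _ _ => Nat.zero_le _) hu

theorem SG.sum_le_arcs (G : SG) {W U : Finset ℕ} (hU : U ⊆ W) :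
    ∑ u ∈ U, (G.nb u ∩ W).card ≤ G.arcs W :=
  Finset.sum_le_sum_of_subset hU

theorem list_sum_eq {l : List ℕ} (hl : l.Nodup) (f : ℕ → ℕ) :
    (l.map f).sum = ∑ x ∈ l.toFinset, f x := (List.sum_toFinset f hl).symm

section candG
variable {N : Net} {M : Mach} (hR : M.R = N.n + 2 * N.m) {lg : Bool} {d : ℕ}
include hR

/-- The elements of `dl` have left `C` already. If two of them were adjacent, treating the first
would delete the second before its turn; independence of `dl` excludes this. -/
theorem dels_loop {C : Finset ℕ} {lk : ℕ → ℕ} :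
    ∀ (dl : List ℕ) (W F : Finset ℕ) (mk : ℕ → ℕ) (D : ℕ → ℕ → ℕ) (T : ℕ) (ρ : Reg → ℕ),
      Rep N D W C F mk lk → dl.Nodup → (∀ x ∈ dl, x ∈ W ∧ x ∉ C) →
      (∀ x ∈ dl, ∀ y ∈ dl, y ∉ N.nb x) → Linked lk 0 dl → ρ .del = dl.headD 0 →
      T + 2 * ((dl.map fun x => 1 + (N.nb x).card).sum + N.pot W) ≤ M.S →
      hwp M lg (d + 1) (whileDo del
      [ upd marked del 0,
        .set a (fld nxt del),
        whileDo (ne a del)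
          [ .set u (fld head a),
            upd flag u 1,
            ifThen (eq (fld inC u) 0) [ .call .delete u ],
            .set a (fld nxt a) ],
        .call .delete del,
        .set del (fld link del) ]) ρ D T fun t o ρ' D' k =>
        o = [] ∧ ρ' .p = ρ .p ∧ ∃ W' F', Rep N D' W' C F' (fun x => if x ∈ dl then 0 else mk x) lk ∧
          t + 150 * N.arcs W' ≤ 2 + (dl.map fun x => 400 + 300 * (N.nb x ∩ W).card).sum +
            150 * N.arcs W ∧
          k + N.pot W' ≤ (dl.map fun x => 1 + (N.nb x).card).sum + N.pot W ∧
          (∀ x, x ∈ W' ↔ x ∈ W ∧ x ∉ dl ∧ (x ∈ C ∨ ∀ y ∈ dl, x ∉ N.nb y)) ∧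
          (∀ x ∈ W', x ∈ F' ↔ x ∈ F ∨ ∃ y ∈ dl, x ∈ N.nb y) := by
  intro dl
  have hMS := M.hS
  induction dl with
  | nil =>
    intro W F mk D T ρ h _ _ _ _ hdel _
    simp only [List.headD_nil] at hdel
    refine hwp_while (by simp [hdel]) (fun h0 => by simp [hdel] at h0) fun _ => ?_
    exact ⟨rfl, rfl, W, F, by simpa using h, by simp, by simp, by simp, by simp⟩
  | cons z dl ih =>
    intro W F mk D T ρ h hnd hmem hind hl hdel hT
    simp only [List.headD_cons] at hdel
    simp only [List.map_cons, List.sum_cons] at hT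
    obtain ⟨hzdl, hnd'⟩ := List.nodup_cons.1 hnd
    obtain ⟨hzW, hzC⟩ := hmem z (by simp)
    have hz1 := h.pos hzW
    have hzV := h.subV hzW
    have hcard : (N.nb z ∩ W).card ≤ (N.nb z).card := Finset.card_le_card Finset.inter_subset_left
    refine hwp_while (by simp [hdel]; omega) (fun _ => ?_) fun h0 => by simp [hdel] at h0; omega
    refine hwp_cons (hwp_upd (by norm_num) (by simp [hdel]; omega) (by simp [hdel]; omega) (by simp)
      (by simp) (by omega) ?_)
    intro _
    simp only [deval_reg, hdel, deval_ofNat]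
    have h1 := h.setMarked z 0
    refine hwp_cons (hwp_set (dfits_fld_reg (by norm_num) hdel (by omega) (by omega)) ?_)
    intro _
    rw [deval_fld_reg (by norm_num) hdel]
    have hroot : setF D marked z 0 nxt z = (N.live W z).headD z := (h1.adj z hzW).nx_root
    rw [hroot]
    refine hwp_cons (hwp_mono (flag_loop hR (N.live W z) [] W F _ _ _ h1 hzW rfl
      (by simpa using hdel) (by simp) (by rw [N.live_length]; omega)) ?_)
    rintro t o ρ1 D1 k ⟨rfl, hdel1, hp1, W1, F1, h2, ht, hk, hW1, hF1⟩ _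
    rw [N.live_length] at ht hk
    simp only [N.mem_live_hd, Finset.mem_inter] at hW1 hF1
    have hzW1 : z ∈ W1 := (hW1 z).2 ⟨hzW, Or.inr fun e => N.irrefl z e.1⟩
    refine hwp_cons (hwp_call (by simp [hdel1]; omega) (hwp_mono (delete_spec hR h2
      hzV hzC (by simp [hdel1]) (by omega)) ?_))
    rintro t2 o - D2 k2 ⟨rfl, ht2, hk2, h3, -⟩ _
    refine hwp_cons (hwp_set (dfits_fld_reg (by norm_num) hdel1 (by omega) (by simp)) ?_)
    rw [deval_fld_reg (by norm_num) hdel1]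
    have hlk : D2 EDSG.link z = dl.headD 0 := by rw [← hl.head]; exact h3.link z hzV
    rw [hlk]
    intro _
    refine hwp_nil ?_
    intro _
    have hsub : W1.erase z ⊆ W := fun x hx => ((hW1 x).1 (Finset.mem_of_mem_erase hx)).1
    refine hwp_mono (ih (W1.erase z) F1 _ D2 _ _ h3 hnd' (fun x hx => ?_)
      (fun x hx y hy => hind x (by simp [hx]) y (by simp [hy])) hl.tail (by simp) (by omega)) ?_
    · have hx' := hmem x (by simp [hx])
      refine ⟨Finset.mem_erase.2 ⟨fun e => hzdl (e ▸ hx), (hW1 x).2 ⟨hx'.1, Or.inr fun e => ?_⟩⟩,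
        hx'.2⟩
      exact hind z (by simp) x (by simp [hx]) e.1
    · rintro t' o' ρ' D' k' ⟨rfl, hp', W', F', h', ht', hk', hW', hF'⟩
      refine ⟨by simp, by rw [hp']; simp [hp1], W', F', ?_, ?_, ?_, fun x => ?_, fun x hx => ?_⟩
      · convert h' using 1
        funext x
        by_cases hx : x = z
        · subst hx; simp [hzdl]
        · simp [hx]
      · have hle : (dl.map fun x => 400 + 300 * (N.nb x ∩ W1.erase z).card).sum ≤
            (dl.map fun x => 400 + 300 * (N.nb x ∩ W).card).sum :=
          List.sum_le_sum fun x _ => by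
            have := Finset.card_le_card (Finset.inter_subset_inter_left (s := N.nb x) hsub)
            omega
        simp only [List.map_cons, List.sum_cons, cost_reg, cost_fld, cost_ofNat]
        omega
      · simp only [List.map_cons, List.sum_cons]
        omega
      · rw [hW', Finset.mem_erase, hW1]
        simp only [List.mem_cons, forall_eq_or_imp]
        by_cases hxC : x ∈ C
        · simp only [hxC, true_or, and_true]
          tauto
        · simp only [hxC, false_or]
          tauto
      · have hxW := hsub ((hW' x).1 hx).1
        rw [hF' x hx, hF1]
        simp only [List.mem_cons, exists_eq_or_imp, hxW, and_true, or_assoc]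

/-- For the log, an element of degree `δ` that has to stay costs 2 entries for collecting it, `4 +
δ` for dropping it and `1 + δ` for unmarking it and flagging its neighbours; `v` costs `4 + δ`. The
term `8 * (1 + δ)` in `SG.room` covers this, and `SG.pot` pays for the deletions. For the time,
degrees in `W` of distinct vertices add up to at most the number of arcs. -/
theorem candG_spec {D : ℕ → ℕ → ℕ} {T : ℕ} {W C F : Finset ℕ} {lk : ℕ → ℕ}
    (h : Rep N D W C F (fun _ => 0) lk) {v : ℕ} (hv : v ∈ C)
    (hind : ∀ x ∈ N.dels W C F v, ∀ y ∈ N.dels W C F v, y ∉ N.nb x)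
    {ρ : Reg → ℕ} (hρ : ρ .p = v) (hT : T + 2 * N.room C W ≤ M.S) :
    hwp M lg (d + 1) (edsG.body .candG) ρ D T fun t o _ D' k =>
      o = [] ∧ t ≤ 5000 * (1 + C.card + N.arcs W) ∧ ∃ W' F' lk',
        Rep N D' W' (C \ insert v (N.dels W C F v)) F' (fun _ => 0) lk' ∧
        k + N.room (C \ insert v (N.dels W C F v)) W' ≤ N.room C W ∧
        (∀ x, x ∈ W' ↔ x ∈ W ∧ x ∉ N.dels W C F v ∧ (x = v → v ∉ F) ∧
          (x ∈ C \ insert v (N.dels W C F v) ∨ ∀ y ∈ N.dels W C F v, x ∉ N.nb y)) ∧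
        (∀ x ∈ W', x ∈ F' ↔ x ∈ F ∨ ∃ y ∈ N.dels W C F v, x ∈ N.nb y) := by
  have hMS := M.hS
  have hvW := h.subC hv
  have hv1 := h.pos hvW
  have hvV := h.subV hvW
  have hsumv : (1 + (N.nb v).card) + ∑ x ∈ C.erase v, (1 + (N.nb x).card) =
      ∑ x ∈ C, (1 + (N.nb x).card) := Finset.add_sum_erase C (fun x => 1 + (N.nb x).card) hv
  have hCsum : C.card ≤ ∑ x ∈ C, (1 + (N.nb x).card) := by
    have := Finset.card_nsmul_le_sum C (fun x => 1 + (N.nb x).card) 1 (fun _ _ => by omega)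
    simpa using this
  unfold SG.room at hT ⊢
  change hwp M lg (d + 1) candGBody ρ D T _
  unfold candGBody
  refine hwp_cons (hwp_set (by simp) ?_)
  intro _
  refine hwp_cons (hwp_set (by simp [hρ]; omega) ?_)
  intro _
  refine hwp_cons (hwp_set (by simp [hρ]; omega) ?_)
  intro _
  refine hwp_cons (hwp_set (by simp; omega) ?_)
  intro _
  refine hwp_cons (hwp_mono (collect_loop hR hv (N.live W v) [] D _ (fun _ => 0) lk [] _ v h rfl hvW
    (N.mem_cl_self v) ⟨fun pre a post e => by simp at e, List.nodup_nil, by simp, by simp⟩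
    (by simpa using hρ) (by simp [hρ]) (by simp [hρ]) (by simp) (by simp)
    (by simp only [List.length_nil]; omega)) ?_)
  rintro t1 o ρ1 D1 k1 ⟨rfl, ht1, hp1, dl, mk1, lk1, h1, hc, hdel1, hmem, hk1⟩ _
  -- the list is the set `Del`
  have hdels : ∀ x, x ∈ dl ↔ x ∈ N.dels W C F v := by
    intro x
    rw [hmem]
    simp only [List.not_mem_nil, false_or, SG.dels, Finset.mem_biUnion, Finset.mem_inter]
    constructor
    · rintro (h0 | ⟨b, hb, h0⟩)
      · exact ⟨v, ⟨N.mem_cl_self v, hvW⟩, h0⟩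
      · have := Finset.mem_inter.1 (N.mem_live_hd.1 (List.mem_map_of_mem (f := N.hd) hb))
        exact ⟨_, ⟨N.mem_cl.2 (Or.inr this.1), this.2⟩, h0⟩
    · rintro ⟨u, ⟨hu, huW⟩, h0⟩
      rcases N.mem_cl.1 hu with rfl | hu
      · exact Or.inl h0
      · obtain ⟨b, hb, rfl⟩ := List.mem_map.1 (N.mem_live_hd.2 (Finset.mem_inter.2 ⟨hu, huW⟩))
        exact Or.inr ⟨b, hb, h0⟩
  have hdelF : dl.toFinset = N.dels W C F v := by ext x; rw [List.mem_toFinset, hdels]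
  have hdlC : ∀ x ∈ dl, x ∈ C.erase v := fun x hx =>
    Finset.mem_erase.2 ⟨(hc.mem x hx).2, (hc.mem x hx).1⟩
  have hC' : C.erase v \ dl.toFinset = C \ insert v (N.dels W C F v) := by
    ext x; rw [hdelF]; simp [Finset.mem_sdiff, Finset.mem_erase]; tauto
  have hsumdl : (dl.map fun x => 1 + (N.nb x).card).sum +
      ∑ x ∈ C \ insert v (N.dels W C F v), (1 + (N.nb x).card) =
      ∑ x ∈ C.erase v, (1 + (N.nb x).card) := by
    rw [list_sum_eq hc.nodup, ← hC', Nat.add_comm]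
    exact Finset.sum_sdiff fun x hx => hdlC x (List.mem_toFinset.1 hx)
  have hsum4 : (dl.map fun x => 4 + (N.nb x).card).sum ≤
      4 * (dl.map fun x => 1 + (N.nb x).card).sum := by
    rw [← List.sum_map_mul_left]
    exact List.sum_le_sum fun x _ => by omega
  have hlen : dl.length ≤ (dl.map fun x => 1 + (N.nb x).card).sum := by
    rw [list_sum_eq hc.nodup, ← List.toFinset_card_of_nodup hc.nodup]
    have := Finset.card_nsmul_le_sum dl.toFinset (fun x => 1 + (N.nb x).card) 1
      (fun _ _ => by omega)
    simpa using this
  have hlenC := hc.length_le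
  have hdegv : (N.nb v ∩ W).card ≤ (N.nb v).card := Finset.card_le_card Finset.inter_subset_left
  have hav := N.card_le_arcs hvW
  have hdlW : dl.toFinset ⊆ W := fun x hx => h.subC (hc.mem x (List.mem_toFinset.1 hx)).1
  have hsa : ∀ c e, (dl.map fun x => c + e * (N.nb x ∩ W).card).sum ≤ c * C.card + e * N.arcs W := by
    intro c e
    rw [list_sum_eq hc.nodup, Finset.sum_add_distrib, ← Finset.mul_sum, Finset.sum_const,
      smul_eq_mul, List.toFinset_card_of_nodup hc.nodup, Nat.mul_comm _ c]
    exact Nat.add_le_add (Nat.mul_le_mul_left _ hlenC) (Nat.mul_le_mul_left _ (N.sum_le_arcs hdlW))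
  have hsn : ((N.live W v).map fun b => (N.nb (N.hd b) ∩ W).card).sum ≤ N.arcs W := by
    have : ((N.live W v).map fun b => (N.nb (N.hd b) ∩ W).card) =
        ((N.live W v).map N.hd).map fun u => (N.nb u ∩ W).card := by simp
    rw [this, list_sum_eq (N.live_hd_nodup W v)]
    exact N.sum_le_arcs fun x hx =>
      (Finset.mem_inter.1 (N.mem_live_hd.1 (List.mem_toFinset.1 hx))).2
  rw [N.live_length] at ht1
  simp only [List.length_nil] at hk1
  -- drop `v` and `Del`
  refine hwp_cons (hwp_call (by simp [hp1]; omega) (hwp_mono (drop_spec hR h1 hv (by simp [hp1])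
    (by omega)) ?_))
  rintro t2 o - D2 k2 ⟨rfl, ht2, hk2, h2⟩ _
  refine hwp_cons (hwp_set ?_ ?_)
  · simp only [dfits_reg, hdel1]
    rcases headD_mem dl 0 with e | e
    · omega
    · have := h.pos (h.subC (hc.mem _ e).1); omega
  intro _
  refine hwp_cons (hwp_mono (drops_loop hR dl (C.erase v) D2 _ _ h2 hc.nodup hdlC hc.linked
    (by simp [hdel1]) (by omega)) ?_)
  rintro t3 o ρ3 D3 k3 ⟨rfl, ht3, hk3, h3, y, hρ3⟩ _
  rw [hC'] at h3
  have hdel3 : ρ3 .del = dl.headD 0 := by rw [hρ3]; simpa using hdel1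
  have hp3 : ρ3 .p = v := by rw [hρ3]; simpa using hp1
  -- flag the neighbours of `Del`
  refine hwp_cons (hwp_mono (dels_loop hR dl W F mk1 D3 _ ρ3 h3 hc.nodup
    (fun x hx => ⟨hdlW (List.mem_toFinset.2 hx), fun e => (Finset.mem_sdiff.1 e).2
      (Finset.mem_insert_of_mem ((hdels x).1 hx))⟩)
    (fun x hx y hy => hind x ((hdels x).1 hx) y ((hdels y).1 hy)) hc.linked hdel3 (by omega)) ?_)
  rintro t4 o ρ4 D4 k4 ⟨rfl, hp4, W4, F4, h4, ht4, hk4, hW4, hF4⟩ _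
  rw [hp3] at hp4
  have hmk0 : (fun x => if x ∈ dl then 0 else mk1 x) = fun _ => 0 := by
    funext x
    split
    · rfl
    · next hx => rw [hc.mk_eq, if_neg hx]
  rw [hmk0] at h4
  have hs1 := hsa 400 80
  have hs2 := hsa 400 300
  have hflag := h4.flag v hvV
  refine hwp_cons ?_
  refine hwp_ifThen (dfits_fld_reg (by norm_num) hp4 (by omega) (by simp)) (fun hf => ?_) fun hf => ?_
  · rw [deval_fld_reg (by norm_num) hp4] at hf
    simp only [EDSG.flag] at hf
    rw [hflag] at hf
    have hvF : v ∈ F4 := by by_contra hn; simp [hn] at hf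
    refine hwp_cons (hwp_call (by simp [hp4]; omega) (hwp_mono (delete_spec hR h4 hvV (by simp)
      (by simp [hp4]) (by omega)) ?_))
    rintro t5 o - D5 k5 ⟨rfl, ht5, hk5, h5, -⟩ _
    refine hwp_nil ?_
    intro _
    refine hwp_nil ⟨by simp, ?_, W4.erase v, F4, lk1, h5, by omega, fun x => ?_, fun x hx => ?_⟩
    · simp only [cost_reg, cost_fld, cost_ofNat]
      omega
    · rw [Finset.mem_erase, hW4]
      simp only [hdels]
      -- The flag of `v` may also have been set because `v` has a neighbour among the collected
      -- vertices. But then `v`, no longer a candidate, has been deleted already, so only the old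
      -- flag matters.
      by_cases hxv : x = v
      · subst hxv
        simp only [ne_eq, not_true, false_and, false_iff]
        rintro ⟨hxW, h6, h7, h8⟩
        have h9 := h8.resolve_left (by simp)
        have hx4 : x ∈ W4 := (hW4 x).2 ⟨hxW, by rwa [hdels], Or.inr (by simpa only [hdels] using h9)⟩
        rcases (hF4 x hx4).1 hvF with h10 | ⟨y, hy, hxy⟩
        · exact h7 trivial h10
        · exact h9 y ((hdels y).1 hy) hxy
      · simp only [ne_eq, hxv, not_false_iff, true_and, false_implies]
    · rw [hF4 x (Finset.mem_of_mem_erase hx)]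
      simp only [hdels]
  · rw [deval_fld_reg (by norm_num) hp4] at hf
    simp only [EDSG.flag] at hf
    rw [hflag] at hf
    have hvF : v ∉ F4 := by intro hn; simp [hn] at hf
    intro _
    refine hwp_nil ⟨by simp, ?_, W4, F4, lk1, h4, by omega, fun x => ?_, fun x hx => ?_⟩
    · simp only [cost_reg, cost_fld, cost_ofNat]
      omega
    · rw [hW4]
      simp only [hdels]
      constructor
      · rintro ⟨h5, h6, h7⟩
        refine ⟨h5, h6, fun e hvF0 => ?_, h7⟩
        subst e
        have hx4 : x ∈ W4 := (hW4 x).2 ⟨h5, by rwa [hdels], by simpa only [hdels] using h7⟩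
        exact hvF ((hF4 x hx4).2 (Or.inl hvF0))
      · rintro ⟨h5, h6, -, h7⟩
        exact ⟨h5, h6, h7⟩
    · rw [hF4 x hx]
      simp only [hdels]

end candG

end EDSG

namespace EDSG

/-! ## The states of the algorithm -/

namespace SG
variable (G : SG)

/-- The vertices of the current graph for the solution `X` and the candidate set `C`. -/
def verts (X C : Finset ℕ) : Finset ℕ :=
  C ∪ (G.V \ X).filter fun u => Disjoint (G.cl u) (X \ C)

/-- The invariant of the states: every vertex that is not dominated by a non-candidate is
dominated twice. -/
structure Inv (X C : Finset ℕ) : Prop where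
  sub : C ⊆ X
  subV : X ⊆ G.V
  two : ∀ u ∈ G.V, Disjoint (G.cl u) (X \ C) → 2 ≤ (G.cl u ∩ X).card

/-- `F` is right on the vertices of the current graph. -/
def FlagOK (F X C : Finset ℕ) : Prop :=
  ∀ u ∈ G.verts X C, u ∈ F ↔ ¬ Disjoint (G.cl u) (X \ C)

/-- The candidates that have to stay once `v` is removed. -/
def Del (X C : Finset ℕ) (v : ℕ) : Finset ℕ :=
  (C.erase v).filter fun w => ∃ u ∈ G.V, G.cl u ∩ X = {v, w}

/-- The candidates of the child `X \ {v}`. -/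
def child (X C : Finset ℕ) (v : ℕ) : Finset ℕ := C \ insert v (G.Del X C v)

/-- `D` dominates every vertex. -/
def Dom (D : Finset ℕ) : Prop := ∀ u ∈ G.V, ∃ x ∈ G.cl u, x ∈ D

open Classical in
/-- The solutions between `X \ C` and `X`. -/
noncomputable def sols (X C : Finset ℕ) : Finset (Finset ℕ) :=
  X.powerset.filter fun D => X \ C ⊆ D ∧ G.Dom D

variable {G}

theorem mem_cl_comm {u w : ℕ} : w ∈ G.cl u ↔ u ∈ G.cl w := by
  rw [G.mem_cl, G.mem_cl]
  exact ⟨fun h => h.imp Eq.symm G.symm, fun h => h.imp Eq.symm G.symm⟩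

theorem mem_verts {X C : Finset ℕ} {u : ℕ} :
    u ∈ G.verts X C ↔ u ∈ C ∨ (u ∈ G.V ∧ u ∉ X ∧ Disjoint (G.cl u) (X \ C)) := by
  simp [verts, and_assoc]

theorem mem_Del {X C : Finset ℕ} {v w : ℕ} :
    w ∈ G.Del X C v ↔ w ≠ v ∧ w ∈ C ∧ ∃ u ∈ G.V, G.cl u ∩ X = {v, w} := by
  simp [Del, and_assoc]

theorem mem_child {X C : Finset ℕ} {v w : ℕ} :
    w ∈ G.child X C v ↔ w ∈ C ∧ w ≠ v ∧ w ∉ G.Del X C v := by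
  simp [child]

theorem mem_sols {X C D : Finset ℕ} : D ∈ G.sols X C ↔ D ⊆ X ∧ X \ C ⊆ D ∧ G.Dom D := by
  simp [sols]

theorem Del_subset (X C : Finset ℕ) (v : ℕ) : G.Del X C v ⊆ C.erase v := Finset.filter_subset _ _

theorem inter_eq_of_disjoint {X C : Finset ℕ} (hC : C ⊆ X) {u : ℕ}
    (h : Disjoint (G.cl u) (X \ C)) : G.cl u ∩ C = G.cl u ∩ X := by
  ext x
  simp only [Finset.mem_inter]
  refine and_congr_right fun hx => ⟨fun h' => hC h', fun h' => ?_⟩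
  by_contra hn
  exact Finset.disjoint_left.1 h hx (Finset.mem_sdiff.2 ⟨h', hn⟩)

theorem disjoint_of_inter_eq {X C : Finset ℕ} {u v w : ℕ} (hv : v ∈ C) (hw : w ∈ C)
    (h : G.cl u ∩ X = {v, w}) : Disjoint (G.cl u) (X \ C) := by
  refine Finset.disjoint_left.2 fun x hx hx' => ?_
  have : x ∈ G.cl u ∩ X := Finset.mem_inter.2 ⟨hx, (Finset.mem_sdiff.1 hx').1⟩
  rw [h] at this
  simp only [Finset.mem_insert, Finset.mem_singleton] at this
  rcases this with rfl | rfl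
  · exact (Finset.mem_sdiff.1 hx').2 hv
  · exact (Finset.mem_sdiff.1 hx').2 hw

/-- Looking only at the current graph and counting only candidates loses nothing. If a closed
neighbourhood of `u` meets `X` in two candidates `v` and `w`, then `X \ C` does not dominate `u`,
and `u` is `v` or `w` or lies outside `X`. So `u` is an unflagged vertex of the current graph. -/
theorem dels_eq {X C F : Finset ℕ} (h : G.Inv X C) (hF : G.FlagOK F X C) {v : ℕ} (hv : v ∈ C) :
    G.dels (G.verts X C) C F v = G.Del X C v := by
  ext w
  rw [mem_Del]
  simp only [dels, Finset.mem_biUnion, Finset.mem_inter]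
  constructor
  · rintro ⟨u, ⟨hu, huW⟩, hw⟩
    obtain ⟨hwC, hwv, huF, h2, hwu⟩ := G.mem_forced hw
    have hdis : Disjoint (G.cl u) (X \ C) := by
      by_contra hn; exact huF ((hF u huW).2 hn)
    have huV : u ∈ G.V := by
      rcases mem_verts.1 huW with h' | h'
      · exact h.subV (h.sub h')
      · exact h'.1
    refine ⟨hwv, hwC, u, huV, ?_⟩
    rw [← inter_eq_of_disjoint h.sub hdis]
    refine (Finset.eq_of_subset_of_card_le ?_ ?_).symm
    · intro x hx
      simp only [Finset.mem_insert, Finset.mem_singleton] at hx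
      rcases hx with rfl | rfl
      · exact Finset.mem_inter.2 ⟨mem_cl_comm.1 hu, hv⟩
      · exact Finset.mem_inter.2 ⟨hwu, hwC⟩
    · rw [h2, Finset.card_pair hwv.symm]
  · rintro ⟨hwv, hwC, u, huV, hu⟩
    have hdis := disjoint_of_inter_eq hv hwC hu
    have hvm : v ∈ G.cl u ∩ X := by rw [hu]; simp
    have hwm : w ∈ G.cl u ∩ X := by rw [hu]; simp
    have huW : u ∈ G.verts X C := by
      rw [mem_verts]
      by_cases huX : u ∈ X
      · have : u ∈ G.cl u ∩ X := Finset.mem_inter.2 ⟨G.mem_cl_self u, huX⟩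
        rw [hu] at this
        simp only [Finset.mem_insert, Finset.mem_singleton] at this
        rcases this with rfl | rfl
        · exact Or.inl hv
        · exact Or.inl hwC
      · exact Or.inr ⟨huV, huX, hdis⟩
    refine ⟨u, ⟨mem_cl_comm.1 (Finset.mem_inter.1 hvm).1, huW⟩, ?_⟩
    have huF : u ∉ F := fun hf => (hF u huW).1 hf hdis
    have e := inter_eq_of_disjoint h.sub hdis
    unfold forced
    rw [if_pos ⟨huF, by rw [e, hu, Finset.card_pair hwv.symm]⟩, e, hu]
    simp [hwv]

theorem noTriangle {x y z : ℕ} (h1 : y ∈ G.nb x) (h2 : z ∈ G.nb y) (h3 : x ∈ G.nb z) : False := by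
  have n1 : y ≠ x := fun e => G.irrefl _ (e ▸ h1)
  have n2 : z ≠ y := fun e => G.irrefl _ (e ▸ h2)
  have n3 : x ≠ z := fun e => G.irrefl _ (e ▸ h3)
  exact G.noCycle x [y, z] (by simp; tauto) (by simp) (by simp) (by simp; tauto)

theorem noSquare {x y z w : ℕ} (h1 : y ∈ G.nb x) (h2 : z ∈ G.nb y) (h3 : w ∈ G.nb z)
    (h4 : x ∈ G.nb w) (n1 : x ≠ z) (n2 : y ≠ w) : False := by
  have m1 : y ≠ x := fun e => G.irrefl _ (e ▸ h1)
  have m2 : z ≠ y := fun e => G.irrefl _ (e ▸ h2)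
  have m3 : w ≠ z := fun e => G.irrefl _ (e ▸ h3)
  have m4 : x ≠ w := fun e => G.irrefl _ (e ▸ h4)
  exact G.noCycle x [y, z, w] (by simp; tauto) (by simp) (by simp) (by simp; tauto)

/-- A closed neighbourhood that meets `X` in two vertices joins them by an edge, or by a path
through a vertex outside `X`. -/
theorem link_of_inter_eq {X : Finset ℕ} {u v w : ℕ} (h : G.cl u ∩ X = {v, w}) (hvw : w ≠ v) :
    v ∈ X ∧ w ∈ X ∧ ((u = v ∨ u = w) ∧ w ∈ G.nb v ∨ u ∉ X ∧ u ∈ G.nb v ∧ w ∈ G.nb u) := by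
  have hvm : v ∈ G.cl u ∩ X := by rw [h]; simp
  have hwm : w ∈ G.cl u ∩ X := by rw [h]; simp
  obtain ⟨hv1, hv2⟩ := Finset.mem_inter.1 hvm
  obtain ⟨hw1, hw2⟩ := Finset.mem_inter.1 hwm
  refine ⟨hv2, hw2, ?_⟩
  by_cases huX : u ∈ X
  · have : u ∈ G.cl u ∩ X := Finset.mem_inter.2 ⟨G.mem_cl_self u, huX⟩
    rw [h] at this
    simp only [Finset.mem_insert, Finset.mem_singleton] at this
    refine Or.inl ⟨this, ?_⟩
    rcases this with rfl | rfl
    · exact (G.mem_cl.1 hw1).resolve_left hvw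
    · exact G.symm ((G.mem_cl.1 hv1).resolve_left hvw.symm)
  · refine Or.inr ⟨huX, G.symm ((G.mem_cl.1 hv1).resolve_left ?_),
      (G.mem_cl.1 hw1).resolve_left ?_⟩
    · rintro rfl; exact huX hv2
    · rintro rfl; exact huX hw2

/-- Both vertices are joined to `v` by an edge or through a vertex outside `X`, so an edge between
them would close a cycle of length three, four or five. The two links cannot share their middle
vertex, which determines its pair of ends. -/
theorem Del_indep {X C : Finset ℕ} {v : ℕ} :
    ∀ x ∈ G.Del X C v, ∀ y ∈ G.Del X C v, y ∉ G.nb x := by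
  intro x hx y hy hxy
  obtain ⟨hxv, -, u, -, hu⟩ := mem_Del.1 hx
  obtain ⟨hyv, -, u', -, hu'⟩ := mem_Del.1 hy
  have hne : x ≠ y := fun e => G.irrefl x (by rw [← e] at hxy; exact hxy)
  have huu : u ≠ u' := by
    rintro rfl
    rw [hu] at hu'
    have : x ∈ ({v, y} : Finset ℕ) := by rw [← hu']; simp
    simp only [Finset.mem_insert, Finset.mem_singleton] at this
    tauto
  obtain ⟨hvX, hxX, h1⟩ := link_of_inter_eq hu hxv
  obtain ⟨-, hyX, h2⟩ := link_of_inter_eq hu' hyv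
  rcases h1 with ⟨-, h1⟩ | ⟨huX, h1, h1'⟩
  · rcases h2 with ⟨-, h2⟩ | ⟨hu'X, h2, h2'⟩
    · exact noTriangle h1 hxy (G.symm h2)
    · exact noSquare h1 hxy (G.symm h2') (G.symm h2) hyv.symm (by rintro rfl; exact hu'X hxX)
  · rcases h2 with ⟨-, h2⟩ | ⟨hu'X, h2, h2'⟩
    · exact noSquare h1 h1' hxy (G.symm h2) hxv.symm (by rintro rfl; exact huX hyX)
    · refine G.noCycle v [u, x, y, u'] ?_ (by simp) (by simp) ?_
      · have a1 : v ≠ u := by rintro rfl; exact huX hvX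
        have a2 : v ≠ u' := by rintro rfl; exact hu'X hvX
        have a3 : u ≠ x := by rintro rfl; exact huX hxX
        have a4 : u ≠ y := by rintro rfl; exact huX hyX
        have a5 : x ≠ u' := by rintro rfl; exact hu'X hxX
        have a6 : y ≠ u' := by rintro rfl; exact hu'X hyX
        simp; tauto
      · have b1 := G.symm h2'
        have b2 := G.symm h2
        simp; tauto

theorem sdiff_child {X C : Finset ℕ} (hC : C ⊆ X) {v : ℕ} :
    X.erase v \ G.child X C v = (X \ C) \ {v} ∪ G.Del X C v := by
  ext x
  have hD : x ∈ G.Del X C v → x ∈ C ∧ x ≠ v := fun h =>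
    ⟨Finset.mem_of_mem_erase (Del_subset X C v h), Finset.ne_of_mem_erase (Del_subset X C v h)⟩
  have := @hC x
  simp only [Finset.mem_sdiff, Finset.mem_erase, mem_child, Finset.mem_union, Finset.mem_singleton]
  tauto

theorem sdiff_child' {X C : Finset ℕ} (hC : C ⊆ X) {v : ℕ} (hv : v ∈ C) :
    X.erase v \ G.child X C v = (X \ C) ∪ G.Del X C v := by
  rw [sdiff_child hC, Finset.sdiff_singleton_eq_erase, Finset.erase_eq_of_notMem]
  simp [hv]

theorem disjoint_Del {X C : Finset ℕ} {v u : ℕ} (hu : u ∉ G.Del X C v) :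
    Disjoint (G.cl u) (G.Del X C v) ↔ ∀ y ∈ G.Del X C v, u ∉ G.nb y := by
  rw [Finset.disjoint_right]
  refine forall₂_congr fun y hy => not_congr ?_
  rw [G.mem_cl]
  exact ⟨fun h => G.symm (h.resolve_left (by rintro rfl; exact hu hy)), fun h => Or.inr (G.symm h)⟩

/-- The right-hand side is the graph that `candG` leaves behind. The vertex `v` leaves `X`, so it
stays in the graph only as long as no fixed vertex dominates it. -/
theorem verts_child {X C F : Finset ℕ} (h : G.Inv X C) (hF : G.FlagOK F X C) {v : ℕ} (hv : v ∈ C)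
    (x : ℕ) : x ∈ G.verts (X.erase v) (G.child X C v) ↔ x ∈ G.verts X C ∧ x ∉ G.Del X C v ∧
      (x = v → v ∉ F) ∧ (x ∈ G.child X C v ∨ ∀ y ∈ G.Del X C v, x ∉ G.nb y) := by
  rw [mem_verts, sdiff_child' h.sub hv, Finset.disjoint_union_right, mem_verts]
  have hvW : v ∈ G.verts X C := mem_verts.2 (Or.inl hv)
  have hvF := hF v hvW
  constructor
  · rintro (h1 | ⟨h1, h2, h3, h4⟩)
    · have h1' := mem_child.1 h1
      exact ⟨Or.inl h1'.1, h1'.2.2, fun e => absurd e h1'.2.1, Or.inl h1⟩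
    · have hxD : x ∉ G.Del X C v := fun hd => Finset.disjoint_left.1 h4 (G.mem_cl_self x) hd
      refine ⟨?_, hxD, ?_, Or.inr ((disjoint_Del hxD).1 h4)⟩
      · by_cases e : x = v
        · exact Or.inl (e ▸ hv)
        · exact Or.inr ⟨h1, fun hX => h2 (Finset.mem_erase.2 ⟨e, hX⟩), h3⟩
      · rintro rfl hf
        exact hvF.1 hf h3
  · rintro ⟨h1, h2, h3, h4⟩
    by_cases hc : x ∈ G.child X C v
    · exact Or.inl hc
    have h4' := (disjoint_Del h2).2 (h4.resolve_left hc)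
    right
    by_cases e : x = v
    · subst e
      exact ⟨h.subV (h.sub hv), by simp, by by_contra hn; exact h3 rfl (hvF.2 hn), h4'⟩
    · rcases h1 with h1 | ⟨h1, h5, h6⟩
      · exact absurd (mem_child.2 ⟨h1, e, h2⟩) hc
      · exact ⟨h1, fun hX => h5 (Finset.mem_of_mem_erase hX), h6, h4'⟩

theorem flag_child {X C F F' : Finset ℕ} (h : G.Inv X C) (hF : G.FlagOK F X C) {v : ℕ} (hv : v ∈ C)
    (hF' : ∀ x ∈ G.verts (X.erase v) (G.child X C v), x ∈ F' ↔ x ∈ F ∨ ∃ y ∈ G.Del X C v, x ∈ G.nb y) :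
    G.FlagOK F' (X.erase v) (G.child X C v) := by
  intro x hx
  have hx' := (verts_child h hF hv x).1 hx
  rw [hF' x hx, sdiff_child' h.sub hv, Finset.disjoint_union_right, disjoint_Del hx'.2.1,
    hF x hx'.1]
  push Not
  tauto

/-- If only one vertex `w` were left after the removal of `v`, the closed neighbourhood of `u` met
`X` in `{v, w}`. Then `w` belongs to `Del`, so it is now fixed and dominates `u`. -/
theorem Inv.child {X C : Finset ℕ} (h : G.Inv X C) {v : ℕ} (hv : v ∈ C) :
    G.Inv (X.erase v) (G.child X C v) where
  sub x hx := by
    have := mem_child.1 hx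
    exact Finset.mem_erase.2 ⟨this.2.1, h.sub this.1⟩
  subV := (Finset.erase_subset _ _).trans h.subV
  two u hu hd := by
    rw [sdiff_child' h.sub hv, Finset.disjoint_union_right] at hd
    have h2 := h.two u hu hd.1
    rw [Finset.inter_erase]
    by_cases hvu : v ∈ G.cl u ∩ X
    · rw [Finset.card_erase_of_mem hvu]
      by_contra hlt
      have h2' : (G.cl u ∩ X).card = 2 := by omega
      obtain ⟨w, hw⟩ := Finset.card_eq_one.1 (show ((G.cl u ∩ X).erase v).card = 1 by
        rw [Finset.card_erase_of_mem hvu, h2'])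
      have hwm : w ∈ (G.cl u ∩ X).erase v := by rw [hw]; simp
      have heq : G.cl u ∩ X = {v, w} := by rw [← Finset.insert_erase hvu, hw]
      obtain ⟨hwv, hwm⟩ := Finset.mem_erase.1 hwm
      have hwC : w ∈ C := by
        rw [← inter_eq_of_disjoint h.sub hd.1] at hwm
        exact (Finset.mem_inter.1 hwm).2
      exact Finset.disjoint_left.1 hd.2 (Finset.mem_inter.1 hwm).1 (mem_Del.2 ⟨hwv, hwC, u, hu, heq⟩)
    · rw [Finset.erase_eq_of_notMem hvu]; exact h2

theorem sdiff_erase' {X C : Finset ℕ} {v : ℕ} (hv : v ∈ X) :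
    X \ C.erase v = insert v (X \ C) := by
  ext x
  simp only [Finset.mem_sdiff, Finset.mem_erase, Finset.mem_insert]
  by_cases e : x = v
  · subst e; simp [hv]
  · simp [e]

theorem Inv.fix {X C : Finset ℕ} (h : G.Inv X C) {v : ℕ} (hv : v ∈ C) : G.Inv X (C.erase v) where
  sub := (Finset.erase_subset _ _).trans h.sub
  subV := h.subV
  two u hu hd := by
    rw [sdiff_erase' (h.sub hv)] at hd
    exact h.two u hu (hd.mono_right (Finset.subset_insert _ _))

theorem verts_fix {X C : Finset ℕ} (h : G.Inv X C) {v : ℕ} (hv : v ∈ C) (x : ℕ) :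
    x ∈ G.verts X (C.erase v) ↔ x ∈ G.verts X C ∧ x ≠ v ∧ (x ∈ C ∨ x ∉ G.nb v) := by
  rw [mem_verts, sdiff_erase' (h.sub hv), Finset.disjoint_insert_right, mem_verts, Finset.mem_erase,
    G.mem_cl]
  have := h.sub hv
  constructor
  · rintro (⟨h1, h2⟩ | ⟨h1, h2, h3, h4⟩)
    · exact ⟨Or.inl h2, h1, Or.inl h2⟩
    · exact ⟨Or.inr ⟨h1, h2, h4⟩, by rintro rfl; exact h2 this, Or.inr fun e => h3 (Or.inr (G.symm e))⟩
  · rintro ⟨h1 | ⟨h1, h2, h3⟩, h4, h5⟩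
    · exact Or.inl ⟨h4, h1⟩
    · refine Or.inr ⟨h1, h2, ?_, h3⟩
      rintro (rfl | e)
      · exact h4 rfl
      · exact h5.elim (fun e' => h2 (h.sub e')) fun e' => e' (G.symm e)

theorem flag_fix {X C F F' : Finset ℕ} (h : G.Inv X C) (hF : G.FlagOK F X C) {v : ℕ} (hv : v ∈ C)
    (hF' : ∀ x ∈ G.verts X (C.erase v), x ∈ F' ↔ x ∈ F ∨ x ∈ G.nb v) :
    G.FlagOK F' X (C.erase v) := by
  intro x hx
  have hx' := (verts_fix h hv x).1 hx
  rw [hF' x hx, sdiff_erase' (h.sub hv), Finset.disjoint_insert_right, hF x hx'.1, G.mem_cl]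
  have : v ∈ G.nb x ↔ x ∈ G.nb v := ⟨G.symm, G.symm⟩
  rw [this]
  have := hx'.2.1
  tauto

theorem Inv.dom {X C : Finset ℕ} (h : G.Inv X C) : G.Dom X := by
  intro u hu
  by_cases hd : Disjoint (G.cl u) (X \ C)
  · have := h.two u hu hd
    obtain ⟨x, hx⟩ := Finset.card_pos.1 (show 0 < (G.cl u ∩ X).card by omega)
    exact ⟨x, (Finset.mem_inter.1 hx).1, (Finset.mem_inter.1 hx).2⟩
  · obtain ⟨x, hx, hx'⟩ := Finset.not_disjoint_iff.1 hd
    exact ⟨x, hx, (Finset.mem_sdiff.1 hx').1⟩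

theorem self_mem_sols {X C : Finset ℕ} (h : G.Inv X C) : X ∈ G.sols X C :=
  mem_sols.2 ⟨subset_rfl, Finset.sdiff_subset, h.dom⟩

theorem sols_empty {X : Finset ℕ} (h : G.Inv X ∅) : G.sols X ∅ = {X} := by
  ext D
  rw [mem_sols, Finset.sdiff_empty, Finset.mem_singleton]
  exact ⟨fun h' => Finset.Subset.antisymm h'.1 h'.2.1, fun e => by
    subst e; exact ⟨subset_rfl, subset_rfl, h.dom⟩⟩

/-- For `w` in `Del`, some vertex can be dominated within `X` only by `v` or `w`, so a solution
without `v` contains `w`. -/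
theorem mem_sols_child {X C : Finset ℕ} (h : G.Inv X C) {v : ℕ} (hv : v ∈ C) {D : Finset ℕ} :
    D ∈ G.sols (X.erase v) (G.child X C v) ↔ D ∈ G.sols X C ∧ v ∉ D := by
  rw [mem_sols, mem_sols, sdiff_child' h.sub hv]
  constructor
  · rintro ⟨h1, h2, h3⟩
    exact ⟨⟨h1.trans (Finset.erase_subset _ _), Finset.subset_union_left.trans h2, h3⟩,
      fun hD => Finset.notMem_erase v X (h1 hD)⟩
  · rintro ⟨⟨h1, h2, h3⟩, h4⟩
    refine ⟨Finset.subset_erase.2 ⟨h1, h4⟩, Finset.union_subset h2 fun w hw => ?_, h3⟩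
    obtain ⟨hwv, hwC, u, hu, heq⟩ := mem_Del.1 hw
    obtain ⟨x, hx, hxD⟩ := h3 u hu
    have : x ∈ G.cl u ∩ X := Finset.mem_inter.2 ⟨hx, h1 hxD⟩
    rw [heq] at this
    simp only [Finset.mem_insert, Finset.mem_singleton] at this
    rcases this with rfl | rfl
    · exact absurd hxD h4
    · exact hxD

theorem mem_sols_fix {X C : Finset ℕ} (h : G.Inv X C) {v : ℕ} (hv : v ∈ C) {D : Finset ℕ} :
    D ∈ G.sols X (C.erase v) ↔ D ∈ G.sols X C ∧ v ∈ D := by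
  rw [mem_sols, mem_sols, sdiff_erase' (h.sub hv), Finset.insert_subset_iff]
  tauto

end SG

end EDSG

/-! ### The number of arcs of the current graph -/

namespace EDSG

namespace SG
variable {G : SG}

theorem ne_of_mem_nb {u w : ℕ} (h : w ∈ G.nb u) : w ≠ u := fun e => G.irrefl _ (e ▸ h)

/-- The current graph has few arcs. -/
theorem Inv.arcs_le {X C : Finset ℕ} (h : G.Inv X C) :
    G.arcs (G.verts X C) ≤ 4 * C.card ^ 2 := by
  classical
  set W := G.verts X C with hW
  set Z := W \ C with hZ
  -- By the invariant, a vertex of the graph outside `C` has two candidates as neighbours; `α` and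
  -- `β` will choose them.
  have hZ' : ∀ z ∈ Z, z ∉ X ∧ ∃ a b, a ∈ C ∧ b ∈ C ∧ a ∈ G.nb z ∧ b ∈ G.nb z ∧ a ≠ b := by
    intro z hz
    rw [hZ, Finset.mem_sdiff, hW, mem_verts] at hz
    obtain ⟨h1, h2, h3⟩ := hz.1.resolve_left hz.2
    refine ⟨h2, ?_⟩
    have h4 := h.two z h1 h3
    rw [← inter_eq_of_disjoint h.sub h3] at h4
    obtain ⟨a, ha, b, hb, hab⟩ := Finset.one_lt_card.1 (show 1 < (G.cl z ∩ C).card by omega)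
    rw [Finset.mem_inter, G.mem_cl] at ha hb
    exact ⟨a, b, ha.2, hb.2, ha.1.resolve_left fun e => hz.2 (e ▸ ha.2),
      hb.1.resolve_left fun e => hz.2 (e ▸ hb.2), hab⟩
  choose! hZX α β hα hβ hαn hβn hαβ using hZ'
  have hne : ∀ z ∈ Z, ∀ c ∈ C, z ≠ c := fun z hz c hc e => hZX z hz (e ▸ h.sub hc)
  -- A candidate adjacent to `z` and different from `c`.
  let π : ℕ → ℕ → ℕ := fun z c => if α z = c then β z else α z
  have hπ : ∀ z ∈ Z, ∀ c, π z c ∈ C ∧ π z c ∈ G.nb z ∧ π z c ≠ c := by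
    intro z hz c
    by_cases e : α z = c
    · simp only [π, if_pos e]; exact ⟨hβ z hz, hβn z hz, e ▸ (hαβ z hz).symm⟩
    · simp only [π, if_neg e]; exact ⟨hα z hz, hαn z hz, e⟩
  let A : Finset ℕ → Finset ℕ → Finset (ℕ × ℕ) := fun P Q =>
    (P ×ˢ Q).filter fun q => q.2 ∈ G.nb q.1
  have hA : ∀ {P Q q}, q ∈ A P Q ↔ q.1 ∈ P ∧ q.2 ∈ Q ∧ q.2 ∈ G.nb q.1 := by
    simp [A, and_assoc]
  have hCC : (A C C).card ≤ (C ×ˢ C).card := Finset.card_filter_le _ _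
  -- The arc from `c` to `z` is determined by `c` and `π z c`: a second common neighbour of the two
  -- would give a square.
  have hCZ : (A C Z).card ≤ (C ×ˢ C).card := by
    refine Finset.card_le_card_of_injOn (fun q => (q.1, π q.2 q.1)) ?_ ?_
    · intro q hq
      have hq := hA.1 (Finset.mem_coe.1 hq)
      exact Finset.mem_coe.2 (Finset.mk_mem_product hq.1 (hπ _ hq.2.1 _).1)
    · rintro ⟨c, z⟩ hq ⟨c', z'⟩ hq' e
      have hq := hA.1 (Finset.mem_coe.1 hq)
      have hq' := hA.1 (Finset.mem_coe.1 hq')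
      simp only [Prod.mk.injEq] at e hq hq' ⊢
      obtain ⟨rfl, e⟩ := e
      refine ⟨rfl, ?_⟩
      by_contra hn
      have h1 := hπ z hq.2.1 c
      have h2 := hπ z' hq'.2.1 c
      exact noSquare hq.2.2 h1.2.1 (G.symm (e ▸ h2.2.1)) (G.symm hq'.2.2) h1.2.2.symm hn
  have hZC : (A Z C).card ≤ (A C Z).card := by
    refine Finset.card_le_card_of_injOn Prod.swap ?_ Prod.swap_injective.injOn
    intro q hq
    have hq := hA.1 (Finset.mem_coe.1 hq)
    exact Finset.mem_coe.2 (hA.2 ⟨hq.2.1, hq.1, G.symm hq.2.2⟩)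
  -- An arc inside `Z` is determined by the chosen neighbours of its ends: two such arcs would give
  -- a cycle of length three, four or six.
  have hZZ : (A Z Z).card ≤ (C ×ˢ C).card := by
    refine Finset.card_le_card_of_injOn (fun q => (α q.1, α q.2)) ?_ ?_
    · intro q hq
      have hq := hA.1 (Finset.mem_coe.1 hq)
      exact Finset.mem_coe.2 (Finset.mk_mem_product (hα _ hq.1) (hα _ hq.2.1))
    · rintro ⟨y, z⟩ hq ⟨y', z'⟩ hq' e
      have hq := hA.1 (Finset.mem_coe.1 hq)
      have hq' := hA.1 (Finset.mem_coe.1 hq')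
      simp only [Prod.mk.injEq] at e hq hq' ⊢
      obtain ⟨hy, hz, hyz⟩ := hq
      obtain ⟨hy', hz', hyz'⟩ := hq'
      obtain ⟨e1, e2⟩ := e
      have a1 := G.symm (hαn y hy)
      have a2 := hαn z hz
      have a1' := hαn y' hy'
      have a2' := G.symm (hαn z' hz')
      rw [← e1] at a1'
      rw [← e2] at a2'
      have c1 := hα y hy
      have c2 := hα z hz
      have n12 : α y ≠ α z := fun e => noTriangle a1 hyz (e ▸ a2)
      by_contra hn
      by_cases h1 : y = y'
      · subst h1
        by_cases h2 : z = z'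
        · exact hn ⟨rfl, h2⟩
        · exact noSquare hyz a2 a2' (G.symm hyz') (fun e => hne y hy _ c2 e) h2
      by_cases h2 : z = z'
      · subst h2
        exact noSquare a1 hyz (G.symm hyz') a1' (fun e => hne z hz _ c1 e.symm) h1
      by_cases h3 : y = z'
      · subst h3
        exact noTriangle hyz a2 a2'
      by_cases h4 : z = y'
      · subst h4
        exact noTriangle a1 hyz a1'
      have m1 := hne y hy _ c1
      have m2 := hne y hy _ c2
      have m3 := hne z hz _ c1
      have m4 := hne z hz _ c2
      have m5 := hne y' hy' _ c1
      have m6 := hne y' hy' _ c2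
      have m7 := hne z' hz' _ c1
      have m8 := hne z' hz' _ c2
      have m9 := ne_of_mem_nb hyz
      have m10 := ne_of_mem_nb hyz'
      refine G.noCycle (α y) [y, z, α z, z', y'] ?_ (by simp) (by simp) ?_
      · simp only [List.nodup_cons, List.mem_cons, List.not_mem_nil, not_or, or_false,
          List.nodup_nil, and_true, not_false_eq_true]
        refine ⟨⟨m1.symm, m3.symm, n12, m7.symm, m5.symm⟩, ⟨m9.symm, m2, h3, h1⟩, ⟨m4, h2, h4⟩,
          ⟨m8.symm, m6.symm⟩, m10⟩
      · have := G.symm hyz'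
        simp; tauto
  have hsplit : G.arcs W ≤ (A C C ∪ A C Z ∪ (A Z C ∪ A Z Z)).card := by
    have : G.arcs W = (A W W).card := by
      simp only [SG.arcs, A]
      rw [Finset.card_filter, Finset.sum_product]
      refine Finset.sum_congr rfl fun u _ => ?_
      rw [← Finset.card_filter, Finset.inter_comm]
      exact congrArg Finset.card (Finset.filter_mem_eq_inter).symm
    rw [this]
    refine Finset.card_le_card fun q hq => ?_
    have hq := hA.1 hq
    simp only [Finset.mem_union, hA, hZ, Finset.mem_sdiff]
    tauto
  have hu1 := Finset.card_union_le (A C C ∪ A C Z) (A Z C ∪ A Z Z)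
  have hu2 := Finset.card_union_le (A C C) (A C Z)
  have hu3 := Finset.card_union_le (A Z C) (A Z Z)
  rw [Finset.card_product] at hCC hCZ hZZ
  have : C.card ^ 2 = C.card * C.card := sq _
  omega

end SG
end EDSG

/-! ### Undoing changes, and fixing a vertex in the solution -/

namespace EDSG

open RAM Reg

section rules
variable {M : Mach} {lg : Bool} {d : ℕ} {ρ : Reg → ℕ} {D : ℕ → ℕ → ℕ} {T : ℕ}
  {Q : ℕ → List ℕ → (Reg → ℕ) → (ℕ → ℕ → ℕ) → ℕ → Prop}

/-- The bound `k ≤ t` on the number of log entries allows the time of undoing to be charged to the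
changes. -/
theorem hwp_mono_le {s : C} {Q' : ℕ → List ℕ → (Reg → ℕ) → (ℕ → ℕ → ℕ) → ℕ → Prop}
    (h : hwp M lg d s ρ D T Q') (hQ : ∀ t o ρ' D' k, k ≤ t → Q' t o ρ' D' k → Q t o ρ' D' k) :
    hwp M lg d s ρ D T Q := fun μ hμ => by
  obtain ⟨t, o, ρ', μ', D', k, h1, h2, h3, h4, h5⟩ := h μ hμ
  exact ⟨t, o, ρ', μ', D', k, h1, h2, h3, h4, hQ _ _ _ _ _ h4 h5⟩

theorem hwp_set_top {r : Reg} (h : Q 3 [] (Function.update ρ r T) D 0) :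
    hwp M lg d (.set r top) ρ D T Q := fun μ hμ => by
  have hS := M.hS
  have h0 := hμ.1
  have := Exec.set (prog := edsG) (d := d) (r := r) (ρ := ρ) (μ := μ) (S := M.S) (input := M.inp)
    (e := top) (show Expr.Fits _ _ _ _ (.mem (.num 0)) from ⟨Nat.zero_le _, by change 0 < M.S; omega,
      by change μ 0 ≤ M.S; rw [h0]; exact hμ.2.2.1⟩)
  rw [show Expr.eval M.inp ρ μ top = T from h0] at this
  exact ⟨_, _, _, _, D, 0, this, hμ, fun _ _ _ => rfl, by simp, h⟩

end rules

/-- Each block ends with a `skip` of one step, and the joined block has only one of them. -/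
theorem exec_block_append {S d : ℕ} {inp : List ℕ} {l₂ : List C} {t₂ : ℕ} {o₂ : List ℕ}
    {ρ₁ ρ₂ : Reg → ℕ} {μ₁ μ₂ : ℕ → ℕ} (h₂ : Exec edsG S inp d (block l₂) ρ₁ μ₁ t₂ o₂ ρ₂ μ₂) :
    ∀ {l₁ : List C} {t₁ : ℕ} {o₁ : List ℕ} {ρ : Reg → ℕ} {μ : ℕ → ℕ},
      Exec edsG S inp d (block l₁) ρ μ t₁ o₁ ρ₁ μ₁ →
      ∃ t, t + 1 = t₁ + t₂ ∧ Exec edsG S inp d (block (l₁ ++ l₂)) ρ μ t (o₁ ++ o₂) ρ₂ μ₂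
  | [], _, _, _, _, h => by
      cases h
      exact ⟨t₂, by omega, h₂⟩
  | s :: l₁, _, _, _, _, h => by
      cases h with
      | seq h h' =>
        obtain ⟨t, ht, h''⟩ := exec_block_append h₂ h'
        rw [List.append_assoc]
        exact ⟨_, by omega, .seq h h''⟩

/-- Run `l₁`, then undo all its changes. -/
theorem hwp_undo {M : Mach} {lg : Bool} {d : ℕ} {ρ : Reg → ℕ} {D : ℕ → ℕ → ℕ} {T : ℕ}
    {Q : ℕ → List ℕ → (Reg → ℕ) → (ℕ → ℕ → ℕ) → ℕ → Prop} {r : Reg} {l₁ l₂ : List C}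
    (h : hwp M true (d + 1) (block l₁) ρ D T fun t o ρ' _ k => ρ' r = T ∧
      hwp M lg (d + 1) (block l₂) ρ' D T fun t' o' ρ'' D' k' =>
        -- Two steps for the call and `21 * k + 5` for `undo`; one step is saved by joining the
        -- blocks.
        ∀ s, s + 1 = t + (21 * k + 7) + t' → Q s (o ++ o') ρ'' D' k') :
    hwp M lg (d + 1) (block (l₁ ++ .call .undo (.reg r) :: l₂)) ρ D T Q := fun μ hμ => by
  obtain ⟨t, o, ρ', μ', D', k, h1, h2, h3, h4, h5, h6⟩ := h μ hμ
  have h0 := hμ.1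
  have hB := hμ.2.1
  obtain ⟨μ2, i1, i2⟩ := exec_undo (M := M) (μ₀ := μ) (d := d)
    (ρ := Function.update (fun _ => 0) edsG.param (ρ' r)) (by
      change Function.update (fun _ => 0) Reg.p (ρ' r) Reg.p = _
      rw [Function.update_self, h5, h0]) (by omega)
    (h3 rfl) (by rw [h2.1]; exact h2.2.2.1)
  have hcall : Exec edsG M.S M.inp (d + 1) (.call .undo (.reg r)) ρ' μ' (1 + 1 + (21 * k + 5)) []
      ρ' μ2 := Exec.call (e := .reg r) (by
        change ρ' r ≤ M.S; rw [h5]; exact hμ.2.2.1) i1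
  have hH : Holds M D T μ2 := hμ.congr le_rfl hμ.2.2.1 (by rw [i2 0 (by omega), h0])
    (fun x hx _ => i2 x (by omega))
  obtain ⟨t', o', ρ'', μ'', D'', k', j1, j2, j3, j4, j5⟩ := h6 μ2 hH
  obtain ⟨s, hs, hex⟩ := exec_block_append (show Exec edsG M.S M.inp (d + 1)
    (block (.call .undo (.reg r) :: l₂)) _ _ _ _ _ _ from .seq hcall j1) h1
  refine ⟨_, _, _, _, D'', k', hex, j2, fun hl => ?_, by omega, ?_⟩
  · have : Logged M μ 0 μ2 := i2
    simpa using this.trans hμ.pos (j3 hl)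
  · exact j5 s (by omega)

section fix
variable {N : Net} {M : Mach} (hR : M.R = N.n + 2 * N.m) {lg : Bool} {d : ℕ}
include hR

/-- In contrast to `flag_loop`, only candidates receive the flag. The other neighbours vanish from
the graph, so the flags are described on `W'` only. -/
theorem fix_loop {C : Finset ℕ} {mk lk : ℕ → ℕ} {q : ℕ} :
    ∀ (rest pre : List ℕ) (W F : Finset ℕ) (D : ℕ → ℕ → ℕ) (T : ℕ) (ρ : Reg → ℕ),
      Rep N D W C F mk lk → q ∈ W → N.live W q = pre ++ rest → ρ .v = q → ρ .a = rest.headD q →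
      T + 2 * (rest.length + N.pot W) ≤ M.S →
      hwp M lg (d + 1) (whileDo (ne a v)
          [ .set u (fld head a),
            .ite (fld inC u) (upd flag u 1) (.call .delete u),
            .set a (fld nxt a) ]) ρ D T fun t o ρ' D' k =>
        o = [] ∧ ρ' .v = q ∧ ∃ W' F', Rep N D' W' C F' mk lk ∧
          t + 150 * N.arcs W' ≤ 5 + 300 * rest.length + 150 * N.arcs W ∧
          k + N.pot W' ≤ rest.length + N.pot W ∧
          (∀ x, x ∈ W' ↔ x ∈ W ∧ (x ∈ C ∨ x ∉ rest.map N.hd)) ∧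
          (∀ x ∈ W', x ∈ F' ↔ x ∈ F ∨ x ∈ rest.map N.hd) := by
  intro rest
  have hMS := M.hS
  induction rest with
  | nil =>
    intro pre W F D T ρ h hq _ hdel ha _
    have hq1 := h.pos hq
    simp only [List.headD_nil] at ha
    refine hwp_while (by simp [ha, hdel]; omega) (fun h0 => by simp [ha, hdel] at h0) fun _ => ?_
    exact ⟨rfl, hdel, W, F, h, by simp, by simp, by simp, by simp⟩
  | cons c rest ih =>
    intro pre W F D T ρ h hq hpre hdel ha hT
    have hq1 := h.pos hq
    simp only [List.headD_cons] at ha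
    simp only [List.length_cons] at hT
    have hcl : c ∈ N.live W q := by rw [hpre]; simp
    have hcm := h.mem_W_live hcl
    have hco := (N.mem_live.1 hcl).1
    have hnd := N.live_nodup W q
    rw [hpre] at hnd
    refine hwp_while (by simp [ha, hdel]; omega) (fun _ => ?_) fun h0 => by
      simp [ha, hdel] at h0; omega
    simp only [head, EDSG.flag, inC, nxt]
    refine hwp_cons (hwp_set (dfits_fld_reg (by norm_num) ha (by omega) (by simp)) ?_)
    rw [deval_fld_reg (by norm_num) ha, (h.arc hco).1]
    intro _
    set w := N.hd c with hw
    have hnext : D 0 c = rest.headD q := by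
      have := h.adj q hq
      rw [hpre] at this
      exact this.nx_mid
    have hwq : w ≠ q := N.hd_ne hco
    have hv4 := h.inC w (h.subV hcm.2.2.1)
    refine hwp_cons (hwp_mono (Q' := fun t o ρ' D' k => o = [] ∧
      ρ' = Function.update ρ Reg.u w ∧ D' 0 c = rest.headD q ∧ ∃ W' F', Rep N D' W' C F' mk lk ∧
        t + 150 * N.arcs W' ≤ 120 + 150 * N.arcs W ∧ k + N.pot W' ≤ 1 + N.pot W ∧
        (∀ x, x ∈ W' ↔ x ∈ W ∧ (x ∈ C ∨ x ≠ w)) ∧ (∀ x ∈ W', x ∈ F' ↔ x ∈ F ∨ x = w)) ?_ ?_)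
    · refine hwp_ite (dfits_fld_reg (x := w) (by norm_num) (by simp) (by omega) (by simp))
        (fun hc => ?_) fun hc => ?_
      · rw [deval_fld_reg (x := w) (by norm_num) (by simp), hv4] at hc
        have hwC : w ∈ C := by by_contra hn; simp [hn] at hc
        refine hwp_upd (by norm_num) (by simp; omega) (by simp; omega) (by simp)
          (by simp; omega) (by omega) ?_
        simp only [deval_reg, Function.update_self, deval_ofNat]
        refine ⟨trivial, trivial, hnext, W, insert w F, h.setFlag w, by simp, by omega, fun x => ?_,
          fun x _ => by rw [Finset.mem_insert]; tauto⟩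
        constructor
        · intro h3; exact ⟨h3, by by_cases e : x = w; exacts [Or.inl (e ▸ hwC), Or.inr e]⟩
        · exact fun h3 => h3.1
      · rw [deval_fld_reg (x := w) (by norm_num) (by simp), hv4] at hc
        have hwC : w ∉ C := by intro hn; simp [hn] at hc
        refine hwp_call (by simp; omega) (hwp_mono (delete_spec hR h
          (h.subV hcm.2.2.1) hwC (by simp) (by omega)) ?_)
        rintro t o - D' k ⟨rfl, ht, hk, h', hfr⟩
        refine ⟨rfl, rfl, by rw [hfr q c hco rfl, hnext], W.erase w, F, h', by simp; omega, by omega,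
          fun x => ?_, fun x hx => ?_⟩
        · rw [Finset.mem_erase]
          constructor
          · rintro ⟨h3, h4⟩; exact ⟨h4, Or.inr h3⟩
          · rintro ⟨h3, h4 | h4⟩
            · exact ⟨fun e => hwC (e ▸ h4), h3⟩
            · exact ⟨h4, h3⟩
        · have := Finset.ne_of_mem_erase hx; tauto
    rintro t o ρ1 D2 k ⟨rfl, hρ1, hn2, W1, F1, h2, ht, hk, hW1, hF1⟩ _
    have ha1 : ρ1 .a = c := by simpa [hρ1] using ha
    refine hwp_cons (hwp_set (dfits_fld_reg (by norm_num) ha1 (by omega) (by omega)) ?_)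
    rw [deval_fld_reg (by norm_num) ha1, hn2]
    intro _
    refine hwp_nil ?_
    intro _
    have hqW1 : q ∈ W1 := (hW1 q).2 ⟨hq, Or.inr hwq.symm⟩
    have hlive : ∃ pre', N.live W1 q = pre' ++ rest := by
      have e : N.live W1 q = (N.live W q).filter fun x => N.hd x ∈ C ∨ x ≠ c := by
        unfold Net.live
        rw [List.filter_filter]
        refine List.filter_congr fun x hx => ?_
        rw [← Bool.decide_and, decide_eq_decide, hW1]
        have : N.hd x ≠ w ↔ x ≠ c := not_congr ⟨fun e => N.hd_inj hx hco e, fun e => by rw [e]⟩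
        rw [this]; tauto
      rw [e, hpre, List.filter_append, List.filter_cons]
      have e2 : rest.filter (fun x => decide (N.hd x ∈ C ∨ x ≠ c)) = rest :=
        List.filter_eq_self.2 fun x hx => decide_eq_true (Or.inr fun e =>
          (List.nodup_cons.1 (List.nodup_append.1 hnd).2.1).1 (e ▸ hx))
      rw [e2]
      split
      · exact ⟨_ ++ [c], by rw [List.append_assoc]; rfl⟩
      · exact ⟨_, rfl⟩
    obtain ⟨pre', hpre'⟩ := hlive
    refine hwp_mono (ih pre' W1 F1 D2 _ _ h2 hqW1 hpre' (by simp [hρ1, hdel]) (by simp)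
      (by omega)) ?_
    rintro t' o' ρ' D' k' ⟨rfl, hdel', W', F', h', ht', hk', hW', hF'⟩
    refine ⟨by simp, hdel', W', F', h', ?_, ?_, fun x => ?_, fun x hx => ?_⟩
    · simp; omega
    · simp; omega
    · rw [hW', hW1]; simp only [List.map_cons, List.mem_cons]; tauto
    · rw [hF' x hx, hF1 x ((hW' x).1 hx).1]; simp only [List.map_cons, List.mem_cons]; tauto

end fix

end EDSG

namespace EDSG

/-! ## The output -/

/-- The set of vertices that a set of words stands for. -/
def hat (n : ℕ) (X : Finset ℕ) : Finset (Fin n) := Finset.univ.filter fun i => (i : ℕ) + 1 ∈ X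

theorem mem_hat {n : ℕ} {X : Finset ℕ} {i : Fin n} : i ∈ hat n X ↔ (i : ℕ) + 1 ∈ X := by
  simp [hat]

theorem hat_flip {n v : ℕ} (hv : 1 ≤ v) (X : Finset ℕ) :
    symmDiff (hat n X) (Finset.univ.filter fun i : Fin n => (i : ℕ) = v - 1) =
      hat n (symmDiff X {v}) := by
  ext i
  have : (i : ℕ) = v - 1 ↔ (i : ℕ) + 1 = v := by omega
  simp only [Finset.mem_symmDiff, mem_hat, Finset.mem_filter, Finset.mem_univ, true_and,
    Finset.mem_singleton, this]

theorem decode_flip {n v : ℕ} (hv : 1 ≤ v) (X : Finset ℕ) (l : List ℕ) :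
    decode (hat n X) (v :: l) = decode (hat n (symmDiff X {v})) l := by
  obtain ⟨k, rfl⟩ := Nat.exists_eq_add_of_le' hv
  rw [← hat_flip hv]
  rfl

/-- Read from the current set `X`, the output `o` declares the solutions in `S`, each of them
once, and returns to `X`. -/
def Out (n : ℕ) (X : Finset ℕ) (S : Finset (Finset ℕ)) (o : List ℕ) : Prop :=
  ∃ L : List (Finset ℕ), L.Nodup ∧ (∀ D, D ∈ L ↔ D ∈ S) ∧
    ∀ l, decode (hat n X) (o ++ l) = L.map (hat n) ++ decode (hat n X) l

theorem Out.nil (n : ℕ) (X : Finset ℕ) : Out n X ∅ [] := ⟨[], by simp, by simp, by simp⟩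

theorem Out.cons_zero {n : ℕ} {X : Finset ℕ} {S : Finset (Finset ℕ)} {o : List ℕ}
    (h : Out n X (S.erase X) o) (hX : X ∈ S) : Out n X S (0 :: o) := by
  obtain ⟨L, h1, h2, h3⟩ := h
  refine ⟨X :: L, List.nodup_cons.2 ⟨by simp [h2], h1⟩, fun D => ?_, fun l => ?_⟩
  · rw [List.mem_cons, h2, Finset.mem_erase]
    constructor
    · rintro (rfl | h); exacts [hX, h.2]
    · intro h; by_cases e : D = X; exacts [Or.inl e, Or.inr ⟨e, h⟩]
  · rw [List.cons_append, List.map_cons, List.cons_append, ← h3]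
    rfl

theorem Out.append {n : ℕ} {X : Finset ℕ} {S S' : Finset (Finset ℕ)} {o o' : List ℕ}
    (h : Out n X S o) (h' : Out n X S' o') (hd : Disjoint S S') : Out n X (S ∪ S') (o ++ o') := by
  obtain ⟨L, h1, h2, h3⟩ := h
  obtain ⟨L', h1', h2', h3'⟩ := h'
  refine ⟨L ++ L', List.nodup_append.2 ⟨h1, h1', ?_⟩, by simp [h2, h2'], fun l => ?_⟩
  · rintro a ha b hb rfl
    exact Finset.disjoint_left.1 hd ((h2 a).1 ha) ((h2' a).1 hb)
  · rw [List.append_assoc, h3, h3', List.map_append, List.append_assoc]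

/-- The words `v` around the output of the child take `v` out of the current set and put it back. -/
theorem Out.flip {n v : ℕ} {X : Finset ℕ} {S : Finset (Finset ℕ)} {o : List ℕ}
    (h : Out n (X.erase v) S o) (hv : 1 ≤ v) (hX : v ∈ X) : Out n X S (v :: (o ++ [v])) := by
  obtain ⟨L, h1, h2, h3⟩ := h
  refine ⟨L, h1, h2, fun l => ?_⟩
  have e1 : symmDiff X {v} = X.erase v := by
    ext x; simp only [Finset.mem_symmDiff, Finset.mem_singleton, Finset.mem_erase]
    by_cases e : x = v
    · subst e; simp [hX]
    · simp [e]
  have e2 : symmDiff (X.erase v) {v} = X := by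
    rw [← e1, symmDiff_symmDiff_cancel_right]
  rw [List.cons_append, decode_flip hv, e1, List.append_assoc, h3, List.singleton_append,
    decode_flip hv, e2]

/-! ## The recursion -/

/-- A bound for the time that the loop of `allChildren` takes in the state `X`, `C`. -/
noncomputable def loopCost (G : SG) (X C : Finset ℕ) : ℕ :=
  if h : C.Nonempty then
    10 ^ 6 * (1 + C.card ^ 2) + loopCost G (X.erase (C.max' h)) (G.child X C (C.max' h)) +
      loopCost G X (C.erase (C.max' h))
  else 10 ^ 6
termination_by C.card
decreasing_by
  · refine Finset.card_lt_card ⟨Finset.sdiff_subset, fun hs => ?_⟩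
    have := hs (C.max'_mem h)
    simp [SG.child] at this
  · exact Finset.card_erase_lt_of_mem (C.max'_mem h)

namespace SG
variable {G : SG}

theorem card_child_lt {X C : Finset ℕ} {v : ℕ} (hv : v ∈ C) : (G.child X C v).card < C.card := by
  refine Finset.card_lt_card ⟨Finset.sdiff_subset, fun hs => ?_⟩
  have := hs hv
  simp [SG.child] at this

/-- Solutions split by whether they contain `v`. The set `X` is erased because it is declared before
the loop starts; as `v ∈ X`, it belongs to the part that keeps `v`. -/
theorem sols_split {X C : Finset ℕ} (h : G.Inv X C) {v : ℕ} (hv : v ∈ C) :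
    (G.sols X C).erase X = G.sols (X.erase v) (G.child X C v) ∪ (G.sols X (C.erase v)).erase X ∧
      Disjoint (G.sols (X.erase v) (G.child X C v)) (G.sols X (C.erase v)) := by
  constructor
  · ext D
    rw [Finset.mem_erase, Finset.mem_union, Finset.mem_erase, mem_sols_child h hv, mem_sols_fix h hv]
    have : D = X → v ∈ D := by rintro rfl; exact h.sub hv
    tauto
  · rw [Finset.disjoint_left]
    intro D h1 h2
    exact ((mem_sols_child h hv).1 h1).2 ((mem_sols_fix h hv).1 h2).2

end SG

/-- The factor 150000 covers `22 * 5000` for `candG` with its undoing and `31 * 1000` for fixing `v`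
with the credit for its log entries. -/
theorem iteration_cost {c A : ℕ} (hA : A ≤ 4 * c ^ 2) :
    150000 * (1 + c + A) ≤ 900000 * (1 + c ^ 2) := by
  have : c ≤ c ^ 2 := Nat.le_self_pow (by norm_num) c
  omega

open RAM Reg

/-- The loop of `allChildren`. -/
def allChildrenLoop : List C :=
  [ .set mark top,
    .call .candG v,
    .emit v,
    .call .allChildren 0,
    .call .undo mark,
    .emit v,
    .set a (fld nxt v),
    whileDo (ne a v)
      [ .set u (fld head a),
        .ite (fld inC u) (upd flag u 1) (.call .delete u),
        .set a (fld nxt a) ],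
    .call .drop v,
    .call .delete v,
    .set v (fld cprev 0) ]

theorem Rep.last_cand {N : Net} {D : ℕ → ℕ → ℕ} {W C F : Finset ℕ} {mk lk : ℕ → ℕ}
    (h : Rep N D W C F mk lk) : D 3 0 = if h : C.Nonempty then C.max' h else 0 := by
  obtain ⟨l, hs, hm, hl⟩ := h.cand
  rw [hl.pv_root]
  split_ifs with hC
  · rcases List.eq_nil_or_concat l with rfl | ⟨l', b, rfl⟩
    · obtain ⟨x, hx⟩ := hC
      simpa using (hm x).2 hx
    · rw [List.concat_eq_append] at hs hm ⊢
      rw [List.getLastD_concat]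
      refine (le_antisymm ?_ ?_)
      · exact C.le_max' _ ((hm b).1 (by simp))
      · refine C.max'_le _ _ fun y hy => ?_
        have := (hm y).2 hy
        rw [List.mem_append, List.mem_singleton] at this
        rcases this with h1 | rfl
        · exact ((List.pairwise_append.1 hs).2.2 y h1 b (by simp)).le
        · exact le_rfl
  · rw [Finset.not_nonempty_iff_eq_empty] at hC
    subst hC
    have : l = [] := List.eq_nil_iff_forall_not_mem.2 fun x hx => by simpa using (hm x).1 hx
    rw [this]; rfl

/-- The credit of 30 per pending log entry prepays its later undoing, which takes 21 steps. -/
theorem allChildren_of_loop {N : Net} {M : Mach} {D : ℕ → ℕ → ℕ} {T d t₀ : ℕ}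
    {ρ : Reg → ℕ} {lg : Bool} {X : Finset ℕ} {S : Finset (Finset ℕ)}
    (hX : X ∈ S) (hl : ∀ ρ : Reg → ℕ, ρ .v = D 3 0 → hwp M lg d (whileDo v allChildrenLoop) ρ D T
      fun t o _ _ k => Out N.n X (S.erase X) o ∧ t + 30 * k ≤ t₀) :
    hwp M lg d (edsG.body .allChildren) ρ D T
      fun t o _ _ k => Out N.n X S o ∧ t + 30 * k ≤ t₀ + 10 := by
  have hMS := M.hS
  change hwp M lg d (block [.emit 0, .set v (fld cprev 0), whileDo v allChildrenLoop]) ρ D T _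
  refine hwp_cons (hwp_emit (by simp) ?_)
  intro _
  have hval : deval M ρ D (fld cprev 0) = D 3 0 := by
    rw [deval_fld M ρ D (by norm_num)]; rfl
  refine hwp_cons (hwp_set ((dfits_fld M ρ D (by norm_num) _).2 ⟨by simp, by simp, by simp⟩) ?_)
  rw [hval]
  intro _
  refine hwp_cons (hwp_mono (hl _ (by simp)) ?_)
  rintro t o ρ' D' k ⟨ho, ht⟩ _
  refine hwp_nil ⟨?_, ?_⟩
  · simpa using ho.cons_zero hX
  · simp only [cost_fld, cost_ofNat]; omega

section loop
variable {N : Net} {M : Mach} (hR : M.R = N.n + 2 * N.m)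
include hR

theorem fix_spec {X C F : Finset ℕ} {lk : ℕ → ℕ} {D : ℕ → ℕ → ℕ} {T d : ℕ} {ρ : Reg → ℕ}
    {lg : Bool} {q : ℕ} (hI : N.Inv X C) (hF : N.FlagOK F X C)
    (h : Rep N D (N.verts X C) C F (fun _ => 0) lk) (hq : q ∈ C) (hρ : ρ .v = q)
    (hT : T + 2 * N.room C (N.verts X C) ≤ M.S) :
    hwp M lg (d + 1) (block
      [ .set a (fld nxt v),
        whileDo (ne a v)
          [ .set u (fld head a),
            .ite (fld inC u) (upd flag u 1) (.call .delete u),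
            .set a (fld nxt a) ],
        .call .drop v,
        .call .delete v,
        .set v (fld cprev 0) ]) ρ D T fun t o ρ' D' k =>
      o = [] ∧ ρ' .v = D' 3 0 ∧ t ≤ 1000 * (1 + N.arcs (N.verts X C)) ∧
        k + N.room (C.erase q) (N.verts X (C.erase q)) ≤ N.room C (N.verts X C) ∧
        ∃ F', N.FlagOK F' X (C.erase q) ∧
          Rep N D' (N.verts X (C.erase q)) (C.erase q) F' (fun _ => 0) lk := by
  have hMS := M.hS
  set W := N.verts X C with hWdef
  have hqW := h.subC hq
  have hq1 := h.pos hqW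
  have hsum : (1 + (N.nb q).card) + ∑ x ∈ C.erase q, (1 + (N.nb x).card) =
      ∑ x ∈ C, (1 + (N.nb x).card) := Finset.add_sum_erase C (fun x => 1 + (N.nb x).card) hq
  have hdeg : (N.nb q ∩ W).card ≤ (N.nb q).card := Finset.card_le_card Finset.inter_subset_left
  have hqa := N.card_le_arcs hqW
  unfold SG.room at hT ⊢
  refine hwp_cons (hwp_set (dfits_fld_reg (by norm_num) hρ (by omega) (by omega)) ?_)
  rw [deval_fld_reg (by norm_num) hρ, (h.adj q hqW).nx_root]
  intro _
  have hlen := N.live_length W q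
  refine hwp_cons (hwp_mono (fix_loop hR (N.live W q) [] W F D _ _ h hqW rfl (by simpa using hρ)
    (by simp) (by omega)) ?_)
  rintro t1 o ρ1 D1 k1 ⟨rfl, hv1, W1, F1, h1, ht1, hk1, hW1, hF1⟩ _
  have hW1s : W1 ⊆ W := fun x hx => ((hW1 x).1 hx).1
  have hdeg1 : (N.nb q ∩ W1).card ≤ (N.nb q ∩ W).card :=
    Finset.card_le_card (Finset.inter_subset_inter_left hW1s)
  refine hwp_cons (hwp_call (by simp [hv1]; omega) (hwp_mono (drop_spec hR h1 hq (by simp [hv1])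
    (by omega)) ?_))
  rintro t2 o - D2 k2 ⟨rfl, ht2, hk2, h2⟩ _
  refine hwp_cons (hwp_call (by simp [hv1]; omega) (hwp_mono (delete_spec hR h2 (h.subV hqW)
    (Finset.notMem_erase _ _) (by simp [hv1]) (by omega)) ?_))
  rintro t3 o - D3 k3 ⟨rfl, ht3, hk3, h3, -⟩ _
  have hval : deval M ρ1 D3 (fld cprev 0) = D3 3 0 := by
    rw [deval_fld M ρ1 D3 (by norm_num)]; rfl
  refine hwp_cons (hwp_set ((dfits_fld M ρ1 D3 (by norm_num) _).2 ⟨by simp, by simp, by simp⟩) ?_)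
  rw [hval]
  intro _
  have hWe : W1.erase q = N.verts X (C.erase q) := by
    ext x
    rw [SG.verts_fix hI hq, Finset.mem_erase, hW1, N.mem_live_hd, Finset.mem_inter]
    tauto
  rw [hWe] at h3 ht3 hk3
  refine hwp_nil ⟨rfl, by simp, ?_, by omega, F1, SG.flag_fix hI hF hq fun x hx => ?_, h3⟩
  · simp only [cost_fld, cost_ofNat, cost_reg]; omega
  · have hx1 : x ∈ W1 := by rw [← hWe] at hx; exact Finset.mem_of_mem_erase hx
    rw [hF1 x hx1, N.mem_live_hd, Finset.mem_inter]
    have := hW1s hx1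
    tauto

/-- The child and the rest of the loop both have fewer candidates. A child takes one more activation
record, so `C.card` records serve the recursion and two more serve `candG` and the procedures it
calls. The log of the child starts higher by no more than the loss in `SG.room`. After `undo` the
log top is `T` again, and the rest of the loop loses as much room as fixing `v` adds entries. -/
theorem allChildren_loop : ∀ (c : ℕ) (X C F : Finset ℕ) (lk : ℕ → ℕ) (D : ℕ → ℕ → ℕ) (T : ℕ)
    (ρ : Reg → ℕ) (d : ℕ) (lg : Bool), C.card = c → N.Inv X C → N.FlagOK F X C →
    Rep N D (N.verts X C) C F (fun _ => 0) lk → ρ .v = D 3 0 → C.card + 2 ≤ d →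
    T + 2 * N.room C (N.verts X C) ≤ M.S →
    hwp M lg d (whileDo v allChildrenLoop) ρ D T fun t o _ _ k =>
      Out N.n X ((N.sols X C).erase X) o ∧ t + 30 * k ≤ loopCost N.toSG X C := by
  intro c
  have hMS := M.hS
  induction c using Nat.strong_induction_on with
  | _ c ih =>
  intro X C F lk D T ρ d lg hc hI hF h hv hd hT
  rw [h.last_cand] at hv
  have hlc : loopCost N.toSG X C = _ := loopCost.eq_1 N.toSG X C
  by_cases hC : C.Nonempty
  swap
  · rw [dif_neg hC] at hv hlc
    rw [Finset.not_nonempty_iff_eq_empty] at hC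
    refine hwp_while (by simp [hv]) (fun h0 => absurd hv (by simpa using h0)) fun _ => ?_
    rw [hlc]
    subst hC
    rw [SG.sols_empty hI]
    exact ⟨by simpa using Out.nil _ _, by simp⟩
  rw [dif_pos hC] at hv hlc
  have hvC := C.max'_mem hC
  set v := C.max' hC with hvdef
  have hv1 := h.pos (h.subC hvC)
  have hvW := h.subC hvC
  have hvV := h.subV hvW
  obtain ⟨hsplit, hdisj⟩ := SG.sols_split hI hvC
  have hdels := SG.dels_eq hI hF hvC
  obtain ⟨e, rfl⟩ : ∃ e, d = e + 2 := ⟨d - 2, by omega⟩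
  have harcs := hI.arcs_le
  refine hwp_while (by simp [hv]; omega) (fun _ => ?_) fun h0 => by simp [hv] at h0; omega
  unfold allChildrenLoop
  refine hwp_undo (l₁ := [_, _, _, _]) ?_
  refine hwp_cons (hwp_set_top ?_)
  intro _
  -- the state of the child
  refine hwp_cons (hwp_call (by simp [hv]; omega) (hwp_mono_le (candG_spec hR h hvC
    (by rw [hdels]; exact fun x hx y hy => SG.Del_indep x hx y hy) (by simp [hv]) (by omega)) ?_))
  rintro t1 o - D1 k1 hk1 ⟨rfl, ht1, W1, F1, lk1, h1, hr1, hW1, hF1⟩ _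
  have hWc : W1 = N.verts (X.erase v) (N.child X C v) := by
    ext x
    rw [hdels] at hW1
    rw [hW1, SG.verts_child hI hF hvC]
    rfl
  rw [hdels] at h1 hr1 hF1
  change Rep N D1 W1 (N.child X C v) F1 _ lk1 at h1
  change k1 + N.room (N.child X C v) W1 ≤ _ at hr1
  subst hWc
  have hIc := hI.child hvC
  have hcc := SG.card_child_lt (G := N.toSG) (X := X) hvC
  refine hwp_cons (hwp_emit (by simp [hv]; omega) ?_)
  intro _
  refine hwp_cons (hwp_call (by simp) (hwp_mono (allChildren_of_loop (SG.self_mem_sols hIc)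
    fun ρ' hρ' => ih _ (hc ▸ hcc) _ _ F1 lk1 D1 _ ρ' (e + 1) true rfl hIc
      (SG.flag_child hI hF hvC hF1) h1 hρ' (by omega) (by omega)) ?_))
  rintro t2 o2 - D2 k2 ⟨ho2, ht2⟩ _
  refine hwp_nil ⟨by simp, ?_⟩
  refine hwp_cons (hwp_emit (by simp [hv]; omega) ?_)
  intro _
  refine hwp_mono_le (fix_spec hR hI hF h hvC (by simp [hv]) (by omega)) ?_
  rintro t3 o ρ3 D3 k3 hk3 ⟨rfl, hv3, ht3, hr3, F3, hF3, h3⟩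
  intro s hs _
  refine hwp_mono (ih (C.erase v).card (hc ▸ Finset.card_erase_lt_of_mem hvC) X (C.erase v) F3 lk D3
    _ ρ3 _ lg rfl (hI.fix hvC) hF3 h3 hv3
    (by have := Finset.card_erase_lt_of_mem hvC; omega) (by omega)) ?_
  rintro t4 o4 - - k4 ⟨ho4, ht4⟩
  have hic := iteration_cost harcs
  refine ⟨?_, ?_⟩
  · rw [hsplit]
    have := (ho2.flip (by omega) (hI.sub hvC)).append ho4
      (hdisj.mono_right (Finset.erase_subset _ _))
    simpa [hv] using this
  · rw [hlc]
    simp only [cost_reg, cost_ofNat] at hs ⊢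
    omega

end loop

end EDSG

namespace EDSG

/-! ## The amortisation -/

namespace SG
variable {G : SG}

/-- The link between `v` and `w` as the list of its inner vertices. -/
theorem exists_link {X : Finset ℕ} {v w : ℕ} (hvw : w ≠ v) (h : ∃ u ∈ G.V, G.cl u ∩ X = {v, w}) :
    v ∈ X ∧ w ∈ X ∧ ∃ m : List ℕ, m.length ≤ 1 ∧ (∀ x ∈ m, x ∉ X ∧ G.cl x ∩ X = {v, w}) ∧
      List.IsChain (fun a b => b ∈ G.nb a) (v :: (m ++ [w])) := by
  obtain ⟨u, -, hu⟩ := h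
  obtain ⟨h1, h2, ⟨-, h3⟩ | ⟨h3, h4, h5⟩⟩ := link_of_inter_eq hu hvw
  · exact ⟨h1, h2, [], by simp, by simp, by simpa using h3⟩
  · exact ⟨h1, h2, [u], by simp, by simp [h3, hu], by simp [h4, h5]⟩

/-- Otherwise the links from `v` over `w`, `v'` and `w'` back to `v`, each of length one or two,
form a cycle of length between four and eight. -/
theorem link_unique {X : Finset ℕ} {v v' w w' : ℕ} (h1 : w ≠ v ∧ ∃ u ∈ G.V, G.cl u ∩ X = {v, w})
    (h2 : w' ≠ v ∧ ∃ u ∈ G.V, G.cl u ∩ X = {v, w'})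
    (h3 : w ≠ v' ∧ ∃ u ∈ G.V, G.cl u ∩ X = {v', w})
    (h4 : w' ≠ v' ∧ ∃ u ∈ G.V, G.cl u ∩ X = {v', w'}) (hw : w ≠ w') : v = v' := by
  by_contra hv
  obtain ⟨hvX, hwX, m1, l1, s1, c1⟩ := exists_link h1.1 h1.2
  obtain ⟨hwX', -, m2, l2, s2, c2⟩ := exists_link h2.1.symm
    (by simpa only [Finset.pair_comm] using h2.2)
  obtain ⟨-, hvX', m3, l3, s3, c3⟩ := exists_link h3.1.symm
    (by simpa only [Finset.pair_comm] using h3.2)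
  obtain ⟨-, -, m4, l4, s4, c4⟩ := exists_link h4.1 h4.2
  -- The closed neighbourhood of an inner vertex meets `X` in the ends of its link, so links between
  -- different pairs have no inner vertex in common.
  have hd : ∀ {m m' : List ℕ} {a b c d : ℕ}, (∀ x ∈ m, x ∉ X ∧ G.cl x ∩ X = {a, b}) →
      (∀ x ∈ m', x ∉ X ∧ G.cl x ∩ X = {c, d}) → (a ≠ c ∧ a ≠ d ∨ b ≠ c ∧ b ≠ d) →
      ∀ x ∈ m, x ∉ m' := by
    intro m m' a b c d h h' hn x hx hx'
    have e : ({a, b} : Finset ℕ) = {c, d} := (h x hx).2.symm.trans (h' x hx').2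
    have ha : a ∈ ({c, d} : Finset ℕ) := by rw [← e]; simp
    have hb : b ∈ ({c, d} : Finset ℕ) := by rw [← e]; simp
    simp only [Finset.mem_insert, Finset.mem_singleton] at ha hb
    tauto
  have hnd : ∀ {m : List ℕ}, m.length ≤ 1 → m.Nodup := by
    intro m hm
    match m, hm with
    | [], _ => simp
    | [x], _ => simp
  have hX : ∀ {m : List ℕ} {a b : ℕ}, (∀ x ∈ m, x ∉ X ∧ G.cl x ∩ X = {a, b}) →
      ∀ {y}, y ∈ X → y ∉ m := fun h y hy hm => (h y hm).1 hy
  refine G.noCycle v (m1 ++ w :: (m3 ++ v' :: (m4 ++ w' :: m2))) ?_ ?_ ?_ ?_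
  · have d12 := hd s1 s2 (by tauto)
    have d13 := hd s1 s3 (by tauto)
    have d14 := hd s1 s4 (by tauto)
    have d34 := hd s3 s4 (by tauto)
    have d32 := hd s3 s2 (by tauto)
    have d42 := hd s4 s2 (by tauto)
    have e1 := @hX m1 _ _ s1
    have e2 := @hX m2 _ _ s2
    have e3 := @hX m3 _ _ s3
    have e4 := @hX m4 _ _ s4
    have n1 := hnd l1
    have n2 := hnd l2
    have n3 := hnd l3
    have n4 := hnd l4
    have k1 := e1 hvX
    have k2 := e2 hvX
    have k3 := e3 hvX
    have k4 := e4 hvX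
    have k5 := e1 hwX
    have k6 := e2 hwX
    have k7 := e3 hwX
    have k8 := e4 hwX
    have k9 := e1 hvX'
    have k10 := e2 hvX'
    have k11 := e3 hvX'
    have k12 := e4 hvX'
    have k13 := e1 hwX'
    have k14 := e2 hwX'
    have k15 := e3 hwX'
    have k16 := e4 hwX'
    obtain ⟨h1, -⟩ := h1
    obtain ⟨h2, -⟩ := h2
    obtain ⟨h3, -⟩ := h3
    obtain ⟨h4, -⟩ := h4
    clear hd hX hnd e1 e2 e3 e4 s1 s2 s3 s4 c1 c2 c3 c4 l1 l2 l3 l4 hvX hvX' hwX hwX'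
    simp only [List.nodup_cons, List.nodup_append, List.mem_append, List.mem_cons, not_or, ne_eq]
    grind only
  · simp; omega
  · simp; omega
  · simp only [List.append_assoc, List.cons_append]
    refine List.isChain_cons_split.2 ⟨c1, List.isChain_cons_split.2 ⟨c3,
      List.isChain_cons_split.2 ⟨c4, c2⟩⟩⟩

/-- The candidates that are left when `v` becomes the largest one. -/
def lower (C : Finset ℕ) (v : ℕ) : Finset ℕ := C.filter (· ≤ v)

theorem mem_lower {C : Finset ℕ} {v x : ℕ} : x ∈ lower C v ↔ x ∈ C ∧ x ≤ v := Finset.mem_filter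

theorem lower_subset (C : Finset ℕ) (v : ℕ) : lower C v ⊆ C := Finset.filter_subset _ _

/-- By `link_unique`, an ordered pair of distinct vertices lies in the set `Del` of at most one `v`,
so the numbers `d (d - 1)` of such pairs sum to at most `|C|²`. For integers `(d - 4) (d - 5) ≥ 0`,
that is, `8 d ≤ 20 + d (d - 1)`. -/
theorem sum_card_Del_le (G : SG) (X C : Finset ℕ) :
    8 * ∑ v ∈ C, (G.Del X (lower C v) v).card ≤ 20 * C.card + C.card ^ 2 := by
  classical
  set d := fun v => G.Del X (lower C v) v with hd
  have hmem : ∀ {v w}, w ∈ d v → w ∈ C ∧ w ≠ v ∧ ∃ u ∈ G.V, G.cl u ∩ X = {v, w} := by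
    intro v w h
    have := mem_Del.1 h
    exact ⟨(mem_lower.1 this.2.1).1, this.1, this.2.2⟩
  have hpairs : ∑ v ∈ C, ((d v).card * (d v).card - (d v).card) ≤ C.card ^ 2 := by
    have h1 : ∀ v ∈ C, ((d v).card * (d v).card - (d v).card) = ((d v).offDiag).card :=
      fun v _ => (Finset.offDiag_card _).symm
    rw [Finset.sum_congr rfl h1, ← Finset.card_biUnion]
    · rw [sq, ← Finset.card_product]
      refine Finset.card_le_card fun q hq => ?_
      simp only [Finset.mem_biUnion, Finset.mem_offDiag] at hq
      obtain ⟨v, -, hq1, hq2, -⟩ := hq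
      exact Finset.mem_product.2 ⟨(hmem hq1).1, (hmem hq2).1⟩
    · intro v _ v' _ hne
      rw [Function.onFun, Finset.disjoint_left]
      intro q h h'
      rw [Finset.mem_offDiag] at h h'
      exact hne (link_unique (hmem h.1).2 (hmem h.2.1).2 (hmem h'.1).2 (hmem h'.2.1).2 h.2.2)
  have hpt : ∀ v ∈ C, 8 * (d v).card ≤ 20 + ((d v).card * (d v).card - (d v).card) := by
    intro v _
    generalize (d v).card = x
    rcases le_or_gt 8 x with h | h
    · obtain ⟨y, rfl⟩ := Nat.exists_eq_add_of_le h
      have : (8 + y) * (8 + y) = 64 + 16 * y + y * y := by ring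
      omega
    · interval_cases x <;> simp
  have := Finset.sum_le_sum hpt
  rw [← Finset.mul_sum, Finset.sum_add_distrib, Finset.sum_const, smul_eq_mul] at this
  simp only [hd] at this hpairs
  omega

theorem lower_insert_max {a : ℕ} {s : Finset ℕ} (ha : ∀ x ∈ s, x < a) :
    lower (insert a s) a = insert a s := Finset.filter_true_of_mem fun x hx => by
  rcases Finset.mem_insert.1 hx with rfl | h
  exacts [le_rfl, (ha x h).le]

theorem lower_insert {a : ℕ} {s : Finset ℕ} (ha : ∀ x ∈ s, x < a) {v : ℕ} (hv : v ∈ s) :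
    lower (insert a s) v = lower s v := by
  unfold lower
  rw [Finset.filter_insert, if_neg (by have := ha v hv; omega)]

theorem sum_card_lower (C : Finset ℕ) :
    2 * ∑ v ∈ C, (lower C v).card = C.card * (C.card + 1) := by
  induction C using Finset.induction_on_max with
  | empty => simp
  | insert a s ha ih =>
    have hn : a ∉ s := fun h => lt_irrefl _ (ha a h)
    rw [Finset.sum_insert hn, lower_insert_max ha,
      Finset.sum_congr rfl fun v hv => by rw [lower_insert ha hv], Finset.card_insert_of_notMem hn,
      Nat.mul_add, ih]
    ring

theorem max'_insert_max {a : ℕ} {s : Finset ℕ} (ha : ∀ x ∈ s, x < a) (h : (insert a s).Nonempty) :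
    (insert a s).max' h = a := by
  refine le_antisymm (Finset.max'_le _ _ _ fun y hy => ?_) (Finset.le_max' _ _ (by simp))
  rcases Finset.mem_insert.1 hy with rfl | h
  exacts [le_rfl, (ha y h).le]

/-- Unrolling the second recursive call turns the loop into a sum over the candidates; `lower C v`
is what is left of `C` at the turn of `v`. -/
theorem loopCost_eq_sum (G : SG) (X C : Finset ℕ) :
    loopCost G X C = 10 ^ 6 + ∑ v ∈ C, (10 ^ 6 * (1 + (lower C v).card ^ 2) +
      loopCost G (X.erase v) (G.child X (lower C v) v)) := by
  induction C using Finset.induction_on_max with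
  | empty => rw [loopCost]; simp
  | insert a s ha ih =>
    have hn : a ∉ s := fun h => lt_irrefl _ (ha a h)
    have hne : (insert a s).Nonempty := ⟨a, by simp⟩
    rw [Finset.sum_insert hn, lower_insert_max ha,
      Finset.sum_congr rfl fun v hv => by rw [lower_insert ha hv], loopCost, dif_pos hne,
      max'_insert_max ha, Finset.erase_insert hn, ih]
    ring

theorem Inv.mono {X C C' : Finset ℕ} (h : G.Inv X C) (hC : C' ⊆ C) : G.Inv X C' where
  sub := hC.trans h.sub
  subV := h.subV
  two u hu hd := h.two u hu (hd.mono_right (Finset.sdiff_subset_sdiff le_rfl hC))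

/-- A solution other than `X` is counted at the largest candidate that it misses; the 1 stands for
`X`. -/
theorem card_sols_eq_sum {X C : Finset ℕ} (h : G.Inv X C) :
    (G.sols X C).card = 1 + ∑ v ∈ C, (G.sols (X.erase v) (G.child X (lower C v) v)).card := by
  induction C using Finset.induction_on_max with
  | empty => rw [sols_empty h]; simp
  | insert a s ha ih =>
    have hn : a ∉ s := fun h => lt_irrefl _ (ha a h)
    have hs := h.mono (Finset.subset_insert a s)
    obtain ⟨h1, h2⟩ := sols_split h (Finset.mem_insert_self a s)
    rw [Finset.erase_insert hn] at h1 h2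
    have e := congrArg Finset.card h1
    rw [Finset.card_union_of_disjoint (h2.mono_right (Finset.erase_subset _ _)),
      Finset.card_erase_of_mem (self_mem_sols h), Finset.card_erase_of_mem (self_mem_sols hs),
      ih hs] at e
    have := Finset.card_pos.2 ⟨_, self_mem_sols h⟩
    rw [Finset.sum_insert hn, lower_insert_max ha,
      Finset.sum_congr rfl fun v hv => by rw [lower_insert ha hv]]
    omega

theorem card_child_add (X : Finset ℕ) {C : Finset ℕ} {v : ℕ} (hv : v ∈ C) :
    (G.child X C v).card + 1 + (G.Del X C v).card = C.card := by
  have hD := Del_subset (G := G) X C v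
  have h1 : v ∉ G.Del X C v := fun h => Finset.notMem_erase _ _ (hD h)
  have h2 : insert v (G.Del X C v) ⊆ C :=
    Finset.insert_subset hv (hD.trans (Finset.erase_subset _ _))
  have := Finset.card_sdiff_add_card_eq_card h2
  rw [Finset.card_insert_of_notMem h1] at this
  unfold child
  omega

/-- With `c = |C|`, the children keep in total at least `c (c + 1) / 2 - c - (20 c + c²) / 8 = 3 c²
/ 8 - 3 c ≥ c² / 8` candidates. Cauchy–Schwarz turns this into the bound for the squares. -/
theorem cube_le_sum_sq (G : SG) (X : Finset ℕ) {C : Finset ℕ} (hC : 128 ≤ C.card) :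
    C.card ^ 3 ≤ 64 * ∑ v ∈ C, (G.child X (lower C v) v).card ^ 2 := by
  have h1 : ∑ v ∈ C, (G.child X (lower C v) v).card + C.card +
      ∑ v ∈ C, (G.Del X (lower C v) v).card = ∑ v ∈ C, (lower C v).card := by
    rw [Finset.card_eq_sum_ones, ← Finset.sum_add_distrib, ← Finset.sum_add_distrib]
    exact Finset.sum_congr rfl fun v hv => card_child_add X (mem_lower.2 ⟨hv, le_rfl⟩)
  have h2 := sum_card_lower C
  have h3 := sum_card_Del_le G X C
  have h4 : (∑ v ∈ C, (G.child X (lower C v) v).card) ^ 2 ≤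
      C.card * ∑ v ∈ C, (G.child X (lower C v) v).card ^ 2 := sq_sum_le_card_mul_sum_sq
  generalize ∑ v ∈ C, (G.child X (lower C v) v).card = r at *
  generalize ∑ v ∈ C, (G.child X (lower C v) v).card ^ 2 = q at *
  have h5 : C.card ^ 2 ≤ 8 * r := by nlinarith
  have h6 : C.card * C.card ^ 3 ≤ C.card * (64 * q) := by nlinarith
  exact Nat.le_of_mul_le_mul_left h6 (by omega)

/-- The time of the loop is at most proportional to the number of solutions. -/
theorem loopCost_le : ∀ (c : ℕ) (X C : Finset ℕ), C.card = c → G.Inv X C →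
    loopCost G X C + 384 * 10 ^ 6 * C.card ^ 2 ≤ 10 ^ 13 * (G.sols X C).card := by
  intro c
  induction c using Nat.strong_induction_on with
  | _ c ih =>
  intro X C hc h
  have hN := card_sols_eq_sum h
  have hL := loopCost_eq_sum G X C
  have hstep : ∑ v ∈ C, (loopCost G (X.erase v) (G.child X (lower C v) v) +
      384 * 10 ^ 6 * (G.child X (lower C v) v).card ^ 2) ≤
      ∑ v ∈ C, 10 ^ 13 * (G.sols (X.erase v) (G.child X (lower C v) v)).card := by
    refine Finset.sum_le_sum fun v hv => ?_
    have hvl : v ∈ lower C v := mem_lower.2 ⟨hv, le_rfl⟩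
    have := card_child_lt (G := G) (X := X) hvl
    have := Finset.card_le_card (lower_subset C v)
    exact ih _ (by omega) _ _ rfl ((h.mono (lower_subset C v)).child hvl)
  have hl : ∑ v ∈ C, (1 + (lower C v).card ^ 2) ≤ C.card * (1 + C.card ^ 2) := by
    rw [← smul_eq_mul]
    exact Finset.sum_le_card_nsmul _ _ _ fun v _ => Nat.add_le_add_left
      (Nat.pow_le_pow_left (Finset.card_le_card (lower_subset C v)) 2) 1
  rw [Finset.sum_add_distrib, ← Finset.mul_sum] at hL
  rw [Finset.sum_add_distrib, ← Finset.mul_sum, ← Finset.mul_sum] at hstep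
  -- In units of `10 ^ 6`: the cost of the rounds and the potential of `C` are paid by the solution
  -- `X`, worth `10 ^ 7`, and by the potentials of the children. For `128 ≤ |C|` the latter give at
  -- least `6 |C|³`, while `384 |C|² ≤ 3 |C|³`. For smaller `C` the solution `X` alone suffices.
  have key : 1 + C.card * (1 + C.card ^ 2) + 384 * C.card ^ 2 ≤
      10 ^ 7 + 384 * ∑ v ∈ C, (G.child X (lower C v) v).card ^ 2 := by
    rcases lt_or_ge C.card 128 with hk | hk
    · have h1 : C.card ^ 2 ≤ 127 ^ 2 := Nat.pow_le_pow_left (by omega) 2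
      have h2 : C.card * (1 + C.card ^ 2) ≤ 127 * (1 + 127 ^ 2) :=
        Nat.mul_le_mul (by omega) (by omega)
      omega
    · have h1 := cube_le_sum_sq G X hk
      have h2 : 128 * C.card ^ 2 ≤ C.card ^ 3 := by
        rw [pow_succ' _ 2]; exact Nat.mul_le_mul_right _ hk
      have h3 : C.card ≤ C.card ^ 3 := Nat.le_self_pow (by norm_num) _
      have h4 : C.card * (1 + C.card ^ 2) = C.card + C.card ^ 3 := by ring
      omega
  omega

end SG
end EDSG

namespace EDSG

/-! ## The input graph -/

/-- Two edges are split off the closed walk because `x ≠ z` is what keeps the second edge from being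
the first one traversed backwards. -/
theorem isCycle_of_walk {V : Type*} {G : SimpleGraph V} {x y z : V} (h : G.Adj x y) (h' : G.Adj y z)
    (p : G.Walk z x) (hp : (y :: p.support).Nodup) (hxz : x ≠ z) :
    (SimpleGraph.Walk.cons h (.cons h' p)).IsCycle := by
  rw [SimpleGraph.Walk.cons_isCycle_iff, SimpleGraph.Walk.isPath_def, SimpleGraph.Walk.support_cons]
  refine ⟨hp, ?_⟩
  rw [SimpleGraph.Walk.edges_cons, List.mem_cons, not_or, Sym2.eq_iff]
  refine ⟨?_, fun hm => (List.nodup_cons.1 hp).1 (p.snd_mem_support_of_mem_edges hm)⟩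
  rintro (⟨rfl, -⟩ | ⟨h1, -⟩)
  · exact G.loopless.irrefl _ h
  · exact hxz h1

section input
variable {n : ℕ} (G : SimpleGraph (Fin n))

open Classical in
/-- The words for the neighbours of the vertex with word `u`. -/
noncomputable def wordNb (u : ℕ) : Finset ℕ :=
  (Finset.univ.filter fun i : Fin n => ∃ j : Fin n, (j : ℕ) + 1 = u ∧ G.Adj j i).image
    fun i : Fin n => (i : ℕ) + 1

variable {G}

theorem mem_wordNb {u w : ℕ} : w ∈ wordNb G u ↔
    ∃ j i : Fin n, (j : ℕ) + 1 = u ∧ (i : ℕ) + 1 = w ∧ G.Adj j i := by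
  simp only [wordNb, Finset.mem_image, Finset.mem_filter, Finset.mem_univ, true_and]
  constructor
  · rintro ⟨i, ⟨j, h1, h2⟩, h3⟩; exact ⟨j, i, h1, h3, h2⟩
  · rintro ⟨j, i, h1, h3, h2⟩; exact ⟨i, ⟨j, h1, h2⟩, h3⟩

theorem mem_wordNb' {j i : Fin n} : (i : ℕ) + 1 ∈ wordNb G ((j : ℕ) + 1) ↔ G.Adj j i := by
  rw [mem_wordNb]
  constructor
  · rintro ⟨j', i', h1, h2, h3⟩
    rwa [Fin.ext (show (j' : ℕ) = j by omega), Fin.ext (show (i' : ℕ) = i by omega)] at h3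
  · exact fun h => ⟨j, i, rfl, rfl, h⟩

theorem exists_walk : ∀ (l : List ℕ) (x y : Fin n),
    List.IsChain (fun a b => b ∈ wordNb G a) (((x : ℕ) + 1) :: (l ++ [(y : ℕ) + 1])) →
    ∃ p : G.Walk x y, p.support.map (fun i : Fin n => (i : ℕ) + 1) = ((x : ℕ) + 1) :: (l ++ [(y : ℕ) + 1])
  | [], x, y, h => by
      simp only [List.nil_append, List.isChain_pair] at h
      exact ⟨.cons (mem_wordNb'.1 h) .nil, by simp⟩
  | a :: l, x, y, h => by
      rw [List.cons_append, List.isChain_cons_cons] at h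
      obtain ⟨-, i, -, rfl, -⟩ := mem_wordNb.1 h.1
      obtain ⟨p, hp⟩ := exists_walk l i y h.2
      exact ⟨.cons (mem_wordNb'.1 h.1) p, by simp [hp]⟩

theorem wordNb_noCycle (hG : 9 ≤ G.egirth) (x : ℕ) (l : List ℕ) (hnd : (x :: l).Nodup)
    (h2 : 2 ≤ l.length) (h7 : l.length ≤ 7)
    (hc : List.IsChain (fun a b => b ∈ wordNb G a) (x :: (l ++ [x]))) : False := by
  obtain ⟨y, z, l, rfl⟩ : ∃ y z l', l = y :: z :: l' := by
    match l, h2 with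
    | y :: z :: l', _ => exact ⟨y, z, l', rfl⟩
  simp only [List.cons_append, List.isChain_cons_cons] at hc
  obtain ⟨h, h', hc⟩ := hc
  obtain ⟨x, y, rfl, rfl, hxy⟩ := mem_wordNb.1 h
  obtain ⟨-, z, -, rfl, -⟩ := mem_wordNb.1 h'
  obtain ⟨p, hp⟩ := exists_walk l z x hc
  have hlen := congrArg List.length hp
  rw [List.length_map, SimpleGraph.Walk.length_support] at hlen
  have hcyc := isCycle_of_walk hxy (mem_wordNb'.1 h') p (by
    have hn : ((y :: p.support).map fun i : Fin n => (i : ℕ) + 1).Nodup := by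
      rw [List.map_cons, hp, ← List.cons_append, ← List.cons_append]
      rw [List.nodup_cons] at hnd
      refine List.nodup_append.2 ⟨hnd.2, by simp, ?_⟩
      rintro a ha b hb rfl
      rw [List.mem_singleton] at hb
      exact hnd.1 (hb ▸ ha)
    exact List.Nodup.of_map _ hn) (by
      rintro rfl; simp at hnd)
  have := hG.trans (SimpleGraph.egirth_le_length hcyc)
  simp only [SimpleGraph.Walk.length_cons] at this
  simp only [List.length_cons, List.length_append, List.length_nil] at hlen h7
  have h9 : 9 ≤ p.length + 1 + 1 := by exact_mod_cast this
  omega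

/-- The graph on the words `1, …, n`. -/
noncomputable def wordGraph (G : SimpleGraph (Fin n)) (hG : 9 ≤ G.egirth) : SG where
  V := Finset.Icc 1 n
  nb := wordNb G
  symm h := by
    obtain ⟨j, i, rfl, rfl, h'⟩ := mem_wordNb.1 h
    exact mem_wordNb'.2 h'.symm
  irrefl u h := by
    obtain ⟨j, i, rfl, h1, h⟩ := mem_wordNb.1 h
    rw [Fin.ext (show (i : ℕ) = j by omega)] at h
    exact G.loopless.irrefl _ h
  sub h := by
    obtain ⟨j, i, -, rfl, h⟩ := mem_wordNb.1 h
    have := i.2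
    rw [Finset.mem_Icc]; omega
  noCycle := wordNb_noCycle hG

/-- The tail of the arc `a`: the arcs `n + 1, …, n + 2m` belong to the words of the input from
position `2` on. -/
def arcTail (inp : List ℕ) (n a : ℕ) : ℕ := inp.getD (a - n + 1) 0

/-- The opposite arc. -/
def arcTwin (n a : ℕ) : ℕ := if (a - n) % 2 = 1 then a + 1 else a - 1

/-- The arcs that belong to the first `k` words, the last one first. -/
def arcList (n k : ℕ) : List ℕ := ((List.range k).map fun j => n + 1 + j).reverse

theorem mem_arcList {n k a : ℕ} : a ∈ arcList n k ↔ n < a ∧ a ≤ n + k := by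
  simp only [arcList, List.mem_reverse, List.mem_map, List.mem_range]
  constructor
  · rintro ⟨j, h, rfl⟩; omega
  · intro h; exact ⟨a - n - 1, by omega, by omega⟩

theorem arcList_nodup (n k : ℕ) : (arcList n k).Nodup := by
  rw [arcList, List.nodup_reverse]
  exact List.nodup_range.map fun a b h => by simpa using h

theorem arcList_succ (n k : ℕ) : arcList n (k + 1) = (n + 1 + k) :: arcList n k := by
  simp [arcList, List.range_succ]

variable {es : List (Fin n × Fin n)}

theorem encode_getD : ∀ (es : List (Fin n × Fin n)) (i : ℕ) (hi : i < es.length),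
    (es.flatMap fun e => [(e.1 : ℕ) + 1, (e.2 : ℕ) + 1]).getD (2 * i) 0 = (es[i].1 : ℕ) + 1 ∧
    (es.flatMap fun e => [(e.1 : ℕ) + 1, (e.2 : ℕ) + 1]).getD (2 * i + 1) 0 = (es[i].2 : ℕ) + 1
  | e :: es, 0, _ => by simp
  | e :: es, i + 1, hi => by
      have := encode_getD es i (by simpa using hi)
      simpa [Nat.mul_add, List.getD] using this

theorem arcTail_odd {i : ℕ} (hi : i < es.length) :
    arcTail (encode n es) n (n + 2 * i + 1) = (es[i].1 : ℕ) + 1 := by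
  rw [← (encode_getD es i hi).1]
  unfold arcTail encode
  rw [show n + 2 * i + 1 - n + 1 = 2 * i + 1 + 1 by omega, List.getD_cons_succ, List.getD_cons_succ]

theorem arcTail_even {i : ℕ} (hi : i < es.length) :
    arcTail (encode n es) n (n + 2 * i + 2) = (es[i].2 : ℕ) + 1 := by
  rw [← (encode_getD es i hi).2]
  unfold arcTail encode
  rw [show n + 2 * i + 2 - n + 1 = 2 * i + 1 + 1 + 1 by omega, List.getD_cons_succ,
    List.getD_cons_succ]

theorem arcTwin_odd (n i : ℕ) : arcTwin n (n + 2 * i + 1) = n + 2 * i + 2 := by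
  unfold arcTwin; split_ifs <;> omega

theorem arcTwin_even (n i : ℕ) : arcTwin n (n + 2 * i + 2) = n + 2 * i + 1 := by
  unfold arcTwin; split_ifs <;> omega

theorem arc_cases {m a : ℕ} (h1 : n < a) (h2 : a ≤ n + 2 * m) :
    ∃ i < m, a = n + 2 * i + 1 ∨ a = n + 2 * i + 2 := ⟨(a - n - 1) / 2, by omega, by omega⟩

/-- Arcs have the ends of an edge as tail and head. -/
theorem exists_edge {a : ℕ} (h1 : n < a) (h2 : a ≤ n + 2 * es.length) :
    ∃ (i : ℕ) (hi : i < es.length) (x y : Fin n), arcTail (encode n es) n a = x + 1 ∧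
      arcTail (encode n es) n (arcTwin n a) = y + 1 ∧ s(es[i].1, es[i].2) = s(x, y) ∧
      (a = n + 2 * i + 1 ∧ (x, y) = es[i] ∨ a = n + 2 * i + 2 ∧ (y, x) = es[i]) := by
  obtain ⟨i, hi, rfl | rfl⟩ := arc_cases h1 h2
  · exact ⟨i, hi, es[i].1, es[i].2, arcTail_odd hi, by rw [arcTwin_odd, arcTail_even hi], rfl,
      Or.inl ⟨rfl, rfl⟩⟩
  · exact ⟨i, hi, es[i].2, es[i].1, arcTail_even hi, by rw [arcTwin_even, arcTail_odd hi],
      Sym2.eq_swap, Or.inr ⟨rfl, rfl⟩⟩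

theorem adj_of_edge (hes : G.IsEdgeList es) {i : ℕ} (hi : i < es.length) {x y : Fin n}
    (h : s(es[i].1, es[i].2) = s(x, y)) : G.Adj x y := by
  rw [← SimpleGraph.mem_edgeSet, ← hes.2, ← h]
  exact List.mem_map.2 ⟨es[i], List.getElem_mem hi, rfl⟩

/-- The input as a network. -/
noncomputable def inputNet (hG : 9 ≤ G.egirth) (hes : G.IsEdgeList es) : Net where
  toSG := wordGraph G hG
  n := n
  m := es.length
  mem_V := Finset.mem_Icc
  out u := (arcList n (2 * es.length)).filter fun a => arcTail (encode n es) n a = u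
  hd a := arcTail (encode n es) n (arcTwin n a)
  tw := arcTwin n
  arc_gt h := (mem_arcList.1 (List.mem_of_mem_filter h)).1
  arc_le h := (mem_arcList.1 (List.mem_of_mem_filter h)).2
  tail_unique h h' := by
    rw [List.mem_filter, decide_eq_true_iff] at h h'
    exact h.2.symm.trans h'.2
  out_nodup u := (arcList_nodup _ _).filter _
  tw_mem h := by
    rw [List.mem_filter, mem_arcList, decide_eq_true_iff] at h ⊢
    refine ⟨?_, rfl⟩
    obtain ⟨i, hi, rfl | rfl⟩ := arc_cases h.1.1 h.1.2
    · rw [arcTwin_odd]; omega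
    · rw [arcTwin_even]; omega
  hd_tw h := by
    rw [List.mem_filter, mem_arcList, decide_eq_true_iff] at h
    obtain ⟨i, hi, rfl | rfl⟩ := arc_cases h.1.1 h.1.2
    · rw [arcTwin_odd, arcTwin_even]; exact h.2
    · rw [arcTwin_even, arcTwin_odd]; exact h.2
  tw_tw h := by
    rw [List.mem_filter, mem_arcList] at h
    obtain ⟨i, hi, rfl | rfl⟩ := arc_cases h.1.1 h.1.2
    · rw [arcTwin_odd, arcTwin_even]
    · rw [arcTwin_even, arcTwin_odd]
  hd_inj := by
    intro u a b h h' e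
    rw [List.mem_filter, mem_arcList, decide_eq_true_iff] at h h'
    obtain ⟨i, hi, x, y, h1, h2, h3, h4⟩ := exists_edge h.1.1 h.1.2
    obtain ⟨i', hi', x', y', h1', h2', h3', h4'⟩ := exists_edge h'.1.1 h'.1.2
    have ex : x = x' := Fin.ext (by have := h.2; have := h'.2; omega)
    have ey : y = y' := Fin.ext (by rw [h2, h2'] at e; omega)
    subst ex ey
    -- Each edge is listed once, so arcs with the same ends come from the same position of the
    -- input. Then the direction decides, as an edge is no loop.
    have hii : i = i' := by
      have hnd := hes.1
      have := (List.Nodup.getElem_inj_iff hnd (hi := by simpa using hi) (hj := by simpa using hi')).1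
        (by rw [List.getElem_map, List.getElem_map]; exact h3.trans h3'.symm)
      exact this
    subst hii
    have hxy := (adj_of_edge hes hi h3).ne
    rcases h4 with ⟨rfl, h4⟩ | ⟨rfl, h4⟩ <;> rcases h4' with ⟨rfl, h4'⟩ | ⟨rfl, h4'⟩
    · rfl
    · exact absurd (Prod.ext_iff.1 (h4.trans h4'.symm)).1 hxy
    · exact absurd (Prod.ext_iff.1 (h4.trans h4'.symm)).2 hxy
    · rfl
  mem_nb := by
    intro u w
    change w ∈ wordNb G u ↔ _
    rw [mem_wordNb]
    constructor
    · rintro ⟨j, i, rfl, rfl, h⟩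
      rw [← SimpleGraph.mem_edgeSet, ← hes.2] at h
      obtain ⟨e, he, heq⟩ := List.mem_map.1 h
      obtain ⟨k, hk, rfl⟩ := List.getElem_of_mem he
      rcases Sym2.eq_iff.1 heq with ⟨h1, h2⟩ | ⟨h1, h2⟩
      · refine ⟨n + 2 * k + 1, ?_, by rw [arcTwin_odd, arcTail_even hk, h2]⟩
        rw [List.mem_filter, mem_arcList, decide_eq_true_iff, arcTail_odd hk, h1]
        exact ⟨by omega, rfl⟩
      · refine ⟨n + 2 * k + 2, ?_, by rw [arcTwin_even, arcTail_odd hk, h1]⟩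
        rw [List.mem_filter, mem_arcList, decide_eq_true_iff, arcTail_even hk, h2]
        exact ⟨by omega, rfl⟩
    · rintro ⟨a, h, rfl⟩
      rw [List.mem_filter, mem_arcList, decide_eq_true_iff] at h
      obtain ⟨i, hi, x, y, h1, h2, h3, h4⟩ := exists_edge h.1.1 h.1.2
      exact ⟨x, y, h1.symm.trans h.2, h2.symm, adj_of_edge hes hi h3⟩

end input

end EDSG

namespace EDSG

open RAM Reg

/-! ## Building the data structures -/

/-- The network `N` is the one that the words of the input describe. -/
structure IsInput (N : Net) (inp : List ℕ) : Prop where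
  n_eq : inp.getD 0 0 = N.n
  m_eq : inp.getD 1 0 = N.m
  out_eq : ∀ u, N.out u = (arcList N.n (2 * N.m)).filter fun a => arcTail inp N.n a = u
  hd_eq : ∀ a, N.hd a = arcTail inp N.n (arcTwin N.n a)
  tw_eq : ∀ a, N.tw a = arcTwin N.n a
  tail_mem : ∀ a, N.n < a → a ≤ N.n + 2 * N.m → arcTail inp N.n a ∈ N.V

/-- The adjacency lists of the arcs of the first `k` words. -/
structure Built (N : Net) (inp : List ℕ) (D : ℕ → ℕ → ℕ) (k : ℕ) : Prop where
  adj : ∀ u ∈ N.V, DLL (D 0) (D 1) u ((arcList N.n k).filter fun a => arcTail inp N.n a = u)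
  cnt : ∀ u ∈ N.V, D 6 u = ((arcList N.n k).filter fun a => arcTail inp N.n a = u).length
  head : ∀ a, N.n < a → a ≤ N.n + k → D 2 a = arcTail inp N.n (arcTwin N.n a)
  next : ∀ r ≤ N.n, D 2 r = 0
  prev : ∀ r ≤ N.n, D 3 r = 0
  zero : ∀ r, D 4 r = 0 ∧ D 5 r = 0 ∧ D 7 r = 0 ∧ D 8 r = 0 ∧ D 9 r = 0

section build
variable {N : Net} {M : Mach} (hR : M.R = N.n + 2 * N.m) {d : ℕ}
include hR

/-- The words written here turn the empty set into `V` for the reader of the output, without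
declaring a solution. -/
theorem init_vertices : ∀ (j i : ℕ) (D : ℕ → ℕ → ℕ) (T : ℕ) (ρ : Reg → ℕ), i + j = N.n →
    ρ .i = i → ρ .n = N.n → (∀ r, 1 ≤ r → r ≤ i → D 0 r = r ∧ D 1 r = r) →
    (∀ f, 2 ≤ f → ∀ r, D f r = 0) →
    hwp M false d (whileDo (ne Reg.i Reg.n)
      [ .set .i (Reg.i + 1),
        .emit Reg.i,
        .store (addr nxt Reg.i) Reg.i,
        .store (addr prv Reg.i) Reg.i ]) ρ D T fun t o ρ' D' k =>
      o = List.range' (i + 1) j ∧ k = 0 ∧ t ≤ 4 + 100 * j ∧ ρ' .n = ρ .n ∧ ρ' .m = ρ .m ∧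
        (∀ r ∈ N.V, D' 0 r = r ∧ D' 1 r = r) ∧ ∀ f, 2 ≤ f → ∀ r, D' f r = 0 := by
  intro j
  have hMS := M.hS
  induction j with
  | zero =>
    intro i D T ρ hij hi hn hD hf
    refine hwp_while (by simp [hi, hn]; omega) (fun h0 => by simp [hi, hn] at h0; omega) fun _ => ?_
    refine ⟨by simp, rfl, by simp, rfl, rfl, fun r hr => ?_, hf⟩
    have := N.mem_V.1 hr
    exact hD r (by omega) (by omega)
  | succ j ih =>
    intro i D T ρ hij hi hn hD hf
    refine hwp_while (by simp [hi, hn]; omega) (fun _ => ?_) fun h0 => by simp [hi, hn] at h0; omega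
    refine hwp_cons (hwp_set (by simp [hi]; omega) ?_)
    intro _
    simp only [deval_add, deval_reg, deval_ofNat, hi]
    refine hwp_cons (hwp_emit (by simp; omega) ?_)
    intro _
    refine hwp_cons (hwp_store (by norm_num) (by simp; omega) (by simp; omega) (by simp)
      (by simp; omega) ?_)
    intro _
    refine hwp_cons (hwp_store (by norm_num) (by simp; omega) (by simp; omega) (by simp)
      (by simp; omega) ?_)
    intro _
    refine hwp_nil ?_
    intro _
    simp only [deval_reg, Function.update_self]
    refine hwp_mono (ih (i + 1) _ _ _ (by omega) (by simp) (by simpa using hn) ?_ ?_) ?_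
    · intro r h1 h2
      simp only [setF_apply]
      by_cases e : r = i + 1
      · simp [e]
      · simpa [e] using hD r h1 (by omega)
    · intro f h2 r
      simp only [setF_apply]
      rw [if_neg (by simp only [nxt, prv]; omega), if_neg (by simp only [nxt, prv]; omega)]
      exact hf f h2 r
    · rintro t o ρ' D' k ⟨rfl, rfl, ht, hn', hm', h1, h2⟩
      refine ⟨?_, by simp, ?_, by simpa using hn', by simpa using hm', h1, h2⟩
      · simp [List.range'_succ]
      · simp only [cost_ne, cost_reg, cost_add, cost_ofNat, cost_addr]; omega

omit hR in
theorem Built.set_twin {inp : List ℕ} {D : ℕ → ℕ → ℕ} {k : ℕ} (h : Built N inp D k) {a x : ℕ}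
    (ha : N.n < a) : Built N inp (setF D 3 a x) k where
  adj := by simpa [setF_other] using h.adj
  cnt := by simpa [setF_other] using h.cnt
  head := by simpa [setF_other] using h.head
  next := by simpa [setF_other] using h.next
  prev r hr := by
    rw [setF_apply, if_neg (by omega)]; exact h.prev r hr
  zero := by simpa [setF_other] using h.zero

omit hR in
theorem Built.root_nodup {inp : List ℕ} {u : ℕ} (hu : u ∈ N.V) (k : ℕ) :
    (u :: (arcList N.n k).filter fun a => arcTail inp N.n a = u).Nodup :=
  List.nodup_cons.2 ⟨fun h => by
    have := (mem_arcList.1 (List.mem_of_mem_filter h)).1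
    have := N.mem_V.1 hu
    omega, (arcList_nodup _ _).filter _⟩

omit hR in
-- Arcs are inserted at the head in increasing order, which is why `arcList` has the last arc first.
-- The new arc lies on no list yet, and the lists of different vertices share no record.
theorem Built.insert {inp : List ℕ} {D D' : ℕ → ℕ → ℕ} {k a u : ℕ} (h : Built N inp D k)
    (ha : a = N.n + 1 + k) (hu : u ∈ N.V) (htail : arcTail inp N.n a = u)
    (h0 : D' 0 = Function.update (Function.update (D 0) a (D 0 u)) u a)
    (h1 : D' 1 = Function.update (Function.update (D 1) a u) (D 0 u) a)
    (h2 : D' 2 = Function.update (D 2) a (arcTail inp N.n (arcTwin N.n a)))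
    (h6 : D' 6 = Function.update (D 6) u (D 6 u + 1))
    (hf : ∀ f, f ≠ 0 → f ≠ 1 → f ≠ 2 → f ≠ 6 → D' f = D f) : Built N inp D' (k + 1) where
  adj u' hu' := by
    have hu1 := N.mem_V.1 hu
    have hu1' := N.mem_V.1 hu'
    rw [arcList_succ, ← ha, List.filter_cons, h0, h1]
    by_cases e : u' = u
    · subst e
      rw [if_pos (by simpa using htail)]
      refine (h.adj u' hu').insert_head (Built.root_nodup hu' k) (by omega) fun hm => ?_
      have := (mem_arcList.1 (List.mem_of_mem_filter hm)).2
      omega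
    · rw [if_neg (by simp [htail]; omega)]
      refine (h.adj u' hu').congr fun x hx => ?_
      have hxa : x ≠ a := by
        rcases hx with rfl | hx
        · omega
        · have := (mem_arcList.1 (List.mem_of_mem_filter hx)).2
          omega
      have hxu : x ≠ u := by
        rcases hx with rfl | hx
        · exact e
        · have := (mem_arcList.1 (List.mem_of_mem_filter hx)).1
          omega
      have hxn : x ≠ D 0 u := by
        rw [(h.adj u hu).nx_root]
        rintro rfl
        rcases headD_mem ((arcList N.n k).filter fun a => arcTail inp N.n a = u) u with h' | h'
        · rw [h'] at hxu; exact hxu rfl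
        · rcases hx with hx | hx
          · have := (mem_arcList.1 (List.mem_of_mem_filter h')).1
            omega
          · have e1 := (List.mem_filter.1 hx).2
            have e2 := (List.mem_filter.1 h').2
            rw [decide_eq_true_iff] at e1 e2
            exact e (e1.symm.trans e2)
      rw [Function.update_of_ne hxu, Function.update_of_ne hxa, Function.update_of_ne hxn,
        Function.update_of_ne hxa]
      exact ⟨rfl, rfl⟩
  cnt u' hu' := by
    rw [arcList_succ, ← ha, List.filter_cons, h6]
    by_cases e : u' = u
    · subst e
      rw [if_pos (by simpa using htail), Function.update_self, List.length_cons, h.cnt u' hu']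
    · rw [if_neg (by simp [htail]; omega), Function.update_of_ne e, h.cnt u' hu']
  head b hb hb' := by
    rw [h2]
    by_cases e : b = a
    · subst e; rw [Function.update_self]
    · rw [Function.update_of_ne e]; exact h.head b hb (by omega)
  next r hr := by
    rw [h2, Function.update_of_ne (by omega)]; exact h.next r hr
  prev r hr := by
    rw [hf 3 (by norm_num) (by norm_num) (by norm_num) (by norm_num)]; exact h.prev r hr
  zero r := by
    rw [hf 4, hf 5, hf 7, hf 8, hf 9]
    · exact h.zero r
    all_goals norm_num

theorem insertArc_spec {D : ℕ → ℕ → ℕ} {T k a u w : ℕ} {ρ : Reg → ℕ} {ra ru rw : Reg}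
    (h : Built N M.inp D k) (hk : k < 2 * N.m) (ha : a = N.n + 1 + k) (hu : u ∈ N.V)
    (htail : arcTail M.inp N.n a = u) (hw : w = arcTail M.inp N.n (arcTwin N.n a)) (hwn : w ≤ N.n)
    (hra : ρ ra = a) (hru : ρ ru = u) (hrw : ρ rw = w) :
    hwp M false d (block (insertArc (.reg ra) (.reg ru) (.reg rw))) ρ D T fun t o ρ' D' k' =>
      o = [] ∧ ρ' = ρ ∧ t ≤ 100 ∧ k' = 0 ∧ Built N M.inp D' (k + 1) ∧ D' 3 = D 3 := by
  have hMS := M.hS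
  have hu1 := N.mem_V.1 hu
  have hnu : D 0 u ≤ N.n + 2 * N.m ∧ 0 < D 0 u := by
    rw [(h.adj u hu).nx_root]
    rcases headD_mem ((arcList N.n k).filter fun a => arcTail M.inp N.n a = u) u with h' | h'
    · rw [h']; omega
    · have := mem_arcList.1 (List.mem_of_mem_filter h')
      omega
  have hau : a ≠ u := by omega
  have hcu : D 6 u ≤ k := by
    rw [h.cnt u hu]
    refine (List.length_filter_le _ _).trans ?_
    simp [arcList]
  unfold insertArc
  simp only [head, nxt, prv, EDSG.cnt]
  refine hwp_cons (hwp_store (by norm_num) (by simp [hra]; omega) (by simp [hra]; omega) (by simp)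
    (by simp [hrw]; omega) ?_)
  simp only [deval_reg, hra, hrw]
  intro _
  refine hwp_cons (hwp_store (by norm_num) (by simp [hra]; omega) (by simp [hra]; omega)
    (by simp [hra]; omega) (dfits_fld_reg (by norm_num) hru (by omega) (by omega)) ?_)
  rw [deval_fld_reg (by norm_num) hru]
  simp only [deval_reg, hra, setF_apply]
  intro _
  refine hwp_cons (hwp_store (by norm_num) (by simp [hra]; omega) (by simp [hra]; omega)
    (by simp) (by simp [hru]; omega) ?_)
  simp only [deval_reg, hra, hru]
  intro _
  have hfld : ∀ {D1 : ℕ → ℕ → ℕ}, D1 0 u = D 0 u → deval M ρ D1 (fld 0 (.reg ru)) = D 0 u := by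
    intro D1 h1
    rw [deval_fld_reg (by norm_num) hru, h1]
  refine hwp_cons (hwp_store (by norm_num) (dfits_fld_reg (by norm_num) hru (by omega) (by omega))
    (by rw [hfld (by simp [setF_apply, hau.symm])]; omega) (by simp) (by simp [hra]; omega) ?_)
  rw [hfld (by simp [setF_apply, hau.symm])]
  simp only [deval_reg, hra]
  intro _
  refine hwp_cons (hwp_store (by norm_num) (by simp [hru]; omega) (by simp [hru]; omega)
    (by simp [hru]; omega) (by simp [hra]; omega) ?_)
  simp only [deval_reg, hra, hru]
  intro _
  refine hwp_cons (hwp_store (by norm_num) (by simp [hru]; omega) (by simp [hru]; omega)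
    (by simp) ?_ ?_)
  · rw [dfits_add]
    refine ⟨dfits_fld_reg (by norm_num) hru (by omega) (by omega), by simp; omega, ?_⟩
    rw [deval_fld_reg (by norm_num) hru]
    simp [setF_apply]; omega
  rw [deval_add, deval_fld_reg (by norm_num) hru]
  simp only [deval_reg, deval_ofNat, hru]
  intro _
  refine hwp_nil ⟨rfl, rfl, ?_, rfl, ?_, ?_⟩
  · simp only [cost_addr, cost_reg, cost_fld, cost_add, cost_ofNat]; omega
  · refine h.insert ha hu htail ?_ ?_ ?_ ?_ ?_
    · ext x; simp [setF_apply, Function.update_apply, hau, hau.symm]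
    · ext x; simp [setF_apply, Function.update_apply]
    · ext x; simp [setF_apply, Function.update_apply, hw]
    · ext x; simp [setF_apply, Function.update_apply]
    · intro f h0 h1 h2 h6
      ext x; simp [setF_apply, h0, h1, h2, h6]
  · ext x; simp [setF_apply]

end build

end EDSG

/-! ### The arcs and the candidates of the initial state -/

namespace EDSG

open RAM Reg

section build
variable {N : Net} {M : Mach} (hR : M.R = N.n + 2 * N.m) {d : ℕ}
include hR

theorem init_arcs (hin : IsInput N M.inp) : ∀ (j i : ℕ) (D : ℕ → ℕ → ℕ) (T : ℕ) (ρ : Reg → ℕ),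
    i + j = N.m → ρ .i = i → ρ .n = N.n → ρ .m = N.m → Built N M.inp D (2 * i) →
    (∀ a, N.n < a → a ≤ N.n + 2 * i → D 3 a = arcTwin N.n a) →
    hwp M false d (whileDo (ne Reg.i Reg.m)
      [ .set .u (.inp (2 * Reg.i + 2)),
        .set .w (.inp (2 * Reg.i + 3)),
        .set .a (Reg.n + 2 * Reg.i + 1),
        .set .b (Reg.n + 2 * Reg.i + 2),
        .store (addr twin Reg.a) Reg.b,
        .store (addr twin Reg.b) Reg.a,
        block (insertArc Reg.a Reg.u Reg.w),
        block (insertArc Reg.b Reg.w Reg.u),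
        .set .i (Reg.i + 1) ]) ρ D T fun t o ρ' D' k =>
      o = [] ∧ k = 0 ∧ t ≤ 4 + 500 * j ∧ ρ' .n = ρ .n ∧ Built N M.inp D' (2 * N.m) ∧
        ∀ a, N.n < a → a ≤ N.n + 2 * N.m → D' 3 a = arcTwin N.n a := by
  intro j
  have hMS := M.hS
  induction j with
  | zero =>
    intro i D T ρ hij hi hn hm hB hD
    refine hwp_while (by simp [hi, hm]; omega) (fun h0 => by simp [hi, hm] at h0; omega) fun _ => ?_
    obtain rfl : i = N.m := by omega
    exact ⟨rfl, rfl, by simp, rfl, hB, hD⟩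
  | succ j ih =>
    intro i D T ρ hij hi hn hm hB hD
    have ha1 : N.n + 2 * i + 1 = N.n + 1 + 2 * i := by ring
    have ha2 : N.n + 2 * i + 2 = N.n + 1 + (2 * i + 1) := by ring
    have hmem1 := hin.tail_mem (N.n + 2 * i + 1) (by omega) (by omega)
    have hmem2 := hin.tail_mem (N.n + 2 * i + 2) (by omega) (by omega)
    have hin1 : M.inp.getD (2 * i + 2) 0 = arcTail M.inp N.n (N.n + 2 * i + 1) := by
      unfold arcTail; congr 1; omega
    have hin2 : M.inp.getD (2 * i + 3) 0 = arcTail M.inp N.n (N.n + 2 * i + 2) := by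
      unfold arcTail; congr 1; omega
    have htw1 := arcTwin_odd N.n i
    have htw2 := arcTwin_even N.n i
    set p := arcTail M.inp N.n (N.n + 2 * i + 1) with hp
    set q := arcTail M.inp N.n (N.n + 2 * i + 2) with hq
    have hp1 := N.mem_V.1 hmem1
    have hq1 := N.mem_V.1 hmem2
    refine hwp_while (by simp [hi, hm]; omega) (fun _ => ?_) fun h0 => by simp [hi, hm] at h0; omega
    refine hwp_cons (hwp_set (by simp [hi, hin1, -List.getD_eq_getElem?_getD]; omega) ?_)
    simp only [deval_inp, deval_add, deval_mul, deval_reg, deval_ofNat, hi, hin1]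
    intro _
    refine hwp_cons (hwp_set (by simp [hi, hin2, -List.getD_eq_getElem?_getD]; omega) ?_)
    simp only [deval_inp, deval_add, deval_mul, deval_reg, deval_ofNat, hi, hin2,
      Function.update_of_ne, ne_eq, reduceCtorEq, not_false_eq_true]
    intro _
    refine hwp_cons (hwp_set (by simp [hi, hn]; omega) ?_)
    simp only [deval_inp, deval_add, deval_mul, deval_reg, deval_ofNat, hi, hn,
      Function.update_of_ne, ne_eq, reduceCtorEq, not_false_eq_true]
    intro _
    refine hwp_cons (hwp_set (by simp [hi, hn]; omega) ?_)
    simp only [deval_inp, deval_add, deval_mul, deval_reg, deval_ofNat, hi, hn,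
      Function.update_of_ne, ne_eq, reduceCtorEq, not_false_eq_true]
    intro _
    set ρ1 := Function.update (Function.update (Function.update (Function.update ρ .u p) .w q)
      .a (N.n + 2 * i + 1)) .b (N.n + 2 * i + 2) with hρ1
    have e1 : ρ1 .u = p := by simp [hρ1]
    have e2 : ρ1 .w = q := by simp [hρ1]
    have e3 : ρ1 .a = N.n + 2 * i + 1 := by simp [hρ1]
    have e4 : ρ1 .b = N.n + 2 * i + 2 := by simp [hρ1]
    have e5 : ρ1 .i = i := by simp [hρ1, hi]
    have e6 : ρ1 .n = N.n := by simp [hρ1, hn]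
    have e7 : ρ1 .m = N.m := by simp [hρ1, hm]
    clear_value ρ1
    refine hwp_cons (hwp_store (by norm_num) (by simp [e3]; omega) (by simp [e3]; omega) (by simp)
      (by simp [e4]; omega) ?_)
    simp only [deval_reg, e3, e4]
    intro _
    refine hwp_cons (hwp_store (by norm_num) (by simp [e4]; omega) (by simp [e4]; omega) (by simp)
      (by simp [e3]; omega) ?_)
    simp only [deval_reg, e3, e4]
    intro _
    have hB2 := (hB.set_twin (a := N.n + 2 * i + 1) (x := N.n + 2 * i + 2) (by omega)).set_twin
      (a := N.n + 2 * i + 2) (x := N.n + 2 * i + 1) (by omega)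
    refine hwp_cons (hwp_mono (insertArc_spec hR hB2 (by omega) ha1 hmem1 rfl (by rw [htw1])
      hq1.2 e3 e1 e2) ?_)
    rintro t1 o ρ' D1 k ⟨rfl, rfl, ht1, rfl, hB3, hD1⟩ _
    refine hwp_cons (hwp_mono (insertArc_spec hR hB3 (by omega) ha2 hmem2 rfl (by rw [htw2])
      hp1.2 e4 e2 e1) ?_)
    rintro t2 o ρ' D2 k ⟨rfl, rfl, ht2, rfl, hB4, hD2⟩ _
    refine hwp_cons (hwp_set (by simp [e5]; omega) ?_)
    simp only [deval_add, deval_reg, deval_ofNat, e5]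
    intro _
    refine hwp_nil ?_
    intro _
    refine hwp_mono (ih (i + 1) D2 _ _ (by omega) (by simp) (by simpa using e6) (by simpa using e7)
      hB4 ?_) ?_
    · intro a h1 h2
      rw [hD2, hD1]
      simp only [setF_apply]
      by_cases c1 : a = N.n + 2 * i + 2
      · subst c1; simp [htw2]
      by_cases c2 : a = N.n + 2 * i + 1
      · subst c2; simp [htw1]
      · rw [if_neg (by tauto), if_neg (by tauto)]
        exact hD a h1 (by omega)
    · rintro t o ρ' D' k ⟨rfl, rfl, ht, hn', h1, h2⟩
      refine ⟨by simp, by simp, ?_, by rw [hn']; simp [e6, hn], h1, h2⟩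
      simp only [cost_ne, cost_reg, cost_add, cost_ofNat, cost_addr, cost_inp, cost_mul]; omega

/-- The vertices that are not isolated. -/
def SG.core (G : SG) : Finset ℕ := G.V.filter fun u => (G.nb u).Nonempty

omit hR in
theorem mem_core {u : ℕ} : u ∈ N.core ↔ u ∈ N.V ∧ (N.nb u).Nonempty := Finset.mem_filter

/-- The data structures with the candidates `1, …, i`. -/
structure Cands (N : Net) (D : ℕ → ℕ → ℕ) (i : ℕ) : Prop where
  adj : ∀ u ∈ N.V, DLL (D 0) (D 1) u (N.out u)
  list : DLL (D 2) (D 3) 0 ((List.range' 1 i).filter (· ∈ N.core))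
  next : ∀ r, i < r → r ≤ N.n → D 2 r = 0
  arc : ∀ a, N.n < a → a ≤ N.n + 2 * N.m → D 2 a = N.hd a ∧ D 3 a = N.tw a
  cnt : ∀ u ∈ N.V, D 6 u = (N.out u).length + if u ≤ i ∧ u ∈ N.core then 1 else 0
  inC : ∀ u ∈ N.V, D 4 u = if u ≤ i ∧ u ∈ N.core then 1 else 0
  inG : ∀ u ∈ N.V, D 7 u = if u ≤ i ∧ u ∈ N.core then 1 else 0
  zero : ∀ r, D 5 r = 0 ∧ D 8 r = 0 ∧ D 9 r = 0

omit hR in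
theorem Built.cands (hin : IsInput N M.inp) {D : ℕ → ℕ → ℕ} (h : Built N M.inp D (2 * N.m))
    (ht : ∀ a, N.n < a → a ≤ N.n + 2 * N.m → D 3 a = arcTwin N.n a) : Cands N D 0 where
  adj u hu := by rw [hin.out_eq]; exact h.adj u hu
  list := DLL.nil (h.next 0 (Nat.zero_le _)) (h.prev 0 (Nat.zero_le _))
  next r _ hr := h.next r hr
  arc a h1 h2 := ⟨by rw [h.head a h1 h2, hin.hd_eq], by rw [ht a h1 h2, hin.tw_eq]⟩
  cnt u hu := by
    have := N.mem_V.1 hu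
    rw [h.cnt u hu, hin.out_eq, if_neg (by omega)]; rfl
  inC u hu := by
    have := N.mem_V.1 hu
    rw [(h.zero u).1, if_neg (by omega)]
  inG u hu := by
    have := N.mem_V.1 hu
    rw [(h.zero u).2.2.1, if_neg (by omega)]
  zero r := ⟨(h.zero r).2.1, (h.zero r).2.2.2⟩

omit hR in
theorem Cands.succ_of_notMem {D : ℕ → ℕ → ℕ} {i : ℕ} (h : Cands N D i) (hi : i + 1 ∉ N.core) :
    Cands N D (i + 1) := by
  have e : ∀ u, u ≤ i + 1 ∧ u ∈ N.core ↔ u ≤ i ∧ u ∈ N.core := fun u => by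
    constructor
    · rintro ⟨h1, h2⟩
      exact ⟨by have : u ≠ i + 1 := (fun e => hi (e ▸ h2)); omega, h2⟩
    · rintro ⟨h1, h2⟩; exact ⟨by omega, h2⟩
  refine ⟨h.adj, ?_, fun r hr => h.next r (by omega), h.arc, ?_, ?_, ?_, h.zero⟩
  · rw [List.range'_1_concat, List.filter_append, List.filter_cons, if_neg (by simpa [add_comm] using hi)]
    simpa using h.list
  · simpa only [e] using h.cnt
  · simpa only [e] using h.inC
  · simpa only [e] using h.inG

omit hR in
theorem Cands.succ_of_mem {D D' : ℕ → ℕ → ℕ} {i : ℕ} (h : Cands N D i) (hi : i + 1 ∈ N.core)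
    (h0 : D' 0 = D 0) (h1 : D' 1 = D 1)
    (h2 : D' 2 = Function.update (D 2) (D 3 0) (i + 1))
    (h3 : D' 3 = Function.update (Function.update (D 3) (i + 1) (D 3 0)) 0 (i + 1))
    (h4 : D' 4 = Function.update (D 4) (i + 1) 1) (h5 : D' 5 = D 5)
    (h6 : D' 6 = Function.update (D 6) (i + 1) (D 6 (i + 1) + 1))
    (h7 : D' 7 = Function.update (D 7) (i + 1) 1) (h8 : D' 8 = D 8) (h9 : D' 9 = D 9) :
    Cands N D' (i + 1) := by
  have hiV := N.mem_V.1 (mem_core.1 hi).1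
  have hlast : D 3 0 ≤ i := by
    rw [h.list.pv_root]
    rcases getLastD_mem ((List.range' 1 i).filter (· ∈ N.core)) 0 with e | e
    · omega
    · have := List.mem_range'_1.1 (List.mem_of_mem_filter e); omega
  have e : ∀ u, u ≠ i + 1 → (u ≤ i + 1 ∧ u ∈ N.core ↔ u ≤ i ∧ u ∈ N.core) := fun u hu =>
    and_congr_left fun _ => by omega
  refine ⟨by rw [h0, h1]; exact h.adj, ?_, fun r hr hr' => ?_, fun a ha ha' => ?_, fun u hu => ?_,
    fun u hu => ?_, fun u hu => ?_, by rw [h5, h8, h9]; exact h.zero⟩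
  · rw [List.range'_1_concat, List.filter_append, List.filter_cons,
      if_pos (by simpa [add_comm] using hi), add_comm 1 i, h2, h3]
    -- The next cell of the new last candidate has never been written, so it holds 0, the sentinel.
    refine h.list.insert_last ?_ (by omega) (fun hm => ?_) (h.next _ (by omega) (by omega))
    · refine List.nodup_cons.2 ⟨fun hm => ?_, List.Nodup.filter _ List.nodup_range'⟩
      have := List.mem_range'_1.1 (List.mem_of_mem_filter hm); omega
    · have := List.mem_range'_1.1 (List.mem_of_mem_filter hm); omega
  · rw [h2, Function.update_of_ne (by omega)]; exact h.next r (by omega) hr'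
  · rw [h2, h3, Function.update_of_ne (by omega), Function.update_of_ne (by omega),
      Function.update_of_ne (by omega)]
    exact h.arc a ha ha'
  · rw [h6]
    by_cases c : u = i + 1
    · subst c
      rw [Function.update_self, h.cnt _ hu, if_neg (by omega), if_pos ⟨le_rfl, hi⟩]
    · rw [Function.update_of_ne c, h.cnt _ hu]; simp only [e u c]
  · rw [h4]
    by_cases c : u = i + 1
    · subst c; rw [Function.update_self, if_pos ⟨le_rfl, hi⟩]
    · rw [Function.update_of_ne c, h.inC _ hu]; simp only [e u c]
  · rw [h7]
    by_cases c : u = i + 1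
    · subst c; rw [Function.update_self, if_pos ⟨le_rfl, hi⟩]
    · rw [Function.update_of_ne c, h.inG _ hu]; simp only [e u c]

omit hR in
theorem length_out (N : Net) (u : ℕ) : (N.out u).length = (N.nb u).card := by
  rw [← List.length_map (f := N.hd), ← List.toFinset_card_of_nodup
    ((List.nodup_map_iff_inj_on (N.out_nodup u)).2 fun _ hx _ hy e => N.hd_inj hx hy e)]
  congr 1
  ext w
  rw [List.mem_toFinset, List.mem_map, N.mem_nb]

omit hR in
theorem nb_subset_core (N : Net) {u : ℕ} : N.nb u ⊆ N.core := fun _ hw =>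
  mem_core.2 ⟨N.sub hw, ⟨u, N.symm hw⟩⟩

omit hR in
-- All neighbours of a vertex are non-isolated, so restricting to the candidates loses no arc, and
-- every counter is the degree plus one.
theorem Cands.rep {D : ℕ → ℕ → ℕ} (h : Cands N D N.n) :
    Rep N D N.core N.core ∅ (fun _ => 0) (fun _ => 0) where
  subV u hu := (mem_core.1 hu).1
  subC := subset_rfl
  arc ha := h.arc _ (N.arc_gt ha) (N.arc_le ha)
  adj u hu := by
    have : N.live N.core u = N.out u := List.filter_eq_self.2 fun a ha =>
      decide_eq_true (nb_subset_core N (N.mem_nb.2 ⟨a, ha, rfl⟩))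
    rw [this]
    exact h.adj u (mem_core.1 hu).1
  cand := by
    refine ⟨_, List.Pairwise.filter _ List.pairwise_lt_range', fun x => ?_, h.list⟩
    rw [List.mem_filter, List.mem_range'_1, decide_eq_true_iff]
    refine ⟨And.right, fun hx => ⟨?_, hx⟩⟩
    have := N.mem_V.1 (mem_core.1 hx).1
    omega
  inC u hu := by
    rw [h.inC u hu]; have := (N.mem_V.1 hu).2; simp [this]
  flag u _ := by rw [(h.zero u).1]; simp
  cnt u hu := by
    have hs : N.cl u ∩ N.core = N.cl u := Finset.inter_eq_left.2
      (Finset.insert_subset hu (nb_subset_core N))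
    rw [h.cnt u (mem_core.1 hu).1, if_pos ⟨(N.mem_V.1 (mem_core.1 hu).1).2, hu⟩, hs, length_out]
    exact (Finset.card_insert_of_notMem (N.irrefl u)).symm
  inG u hu := by
    rw [h.inG u hu]; have := (N.mem_V.1 hu).2; simp [this]
  marked u _ := (h.zero u).2.1
  link u _ := (h.zero u).2.2

theorem init_cands : ∀ (j i : ℕ) (D : ℕ → ℕ → ℕ) (T : ℕ) (ρ : Reg → ℕ),
    i + j = N.n → ρ .i = i → ρ .n = N.n → Cands N D i →
    hwp M false d (whileDo (ne Reg.i Reg.n)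
      [ .set .i (Reg.i + 1),
        ifThen (ne (fld nxt Reg.i) Reg.i)
          [ .store (addr inG Reg.i) 1,
            .store (addr inC Reg.i) 1,
            .store (addr cnt Reg.i) (fld cnt Reg.i + 1),
            .store (addr cprev Reg.i) (fld cprev 0),
            .store (addr cnext (fld cprev 0)) Reg.i,
            .store (addr cprev 0) Reg.i ] ]) ρ D T fun t o _ D' k =>
      o = [] ∧ k = 0 ∧ t ≤ 4 + 200 * j ∧ Cands N D' N.n := by
  intro j
  have hMS := M.hS
  induction j with
  | zero =>
    intro i D T ρ hij hi hn hD
    refine hwp_while (by simp [hi, hn]; omega) (fun h0 => by simp [hi, hn] at h0; omega) fun _ => ?_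
    obtain rfl : i = N.n := by omega
    exact ⟨rfl, rfl, by simp, hD⟩
  | succ j ih =>
    intro i D T ρ hij hi hn hD
    have hiV : i + 1 ∈ N.V := N.mem_V.2 ⟨by omega, by omega⟩
    refine hwp_while (by simp [hi, hn]; omega) (fun _ => ?_) fun h0 => by simp [hi, hn] at h0; omega
    refine hwp_cons (hwp_set (by simp [hi]; omega) ?_)
    simp only [deval_add, deval_reg, deval_ofNat, hi]
    intro _
    set ρ1 := Function.update ρ .i (i + 1) with hρ1
    have e1 : ρ1 .i = i + 1 := by simp [hρ1]
    have e2 : ρ1 .n = N.n := by simp [hρ1, hn]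
    clear_value ρ1
    -- A vertex is isolated when its circular list is empty, so that the sentinel points to itself;
    -- arcs have larger numbers.
    have hnx : D 0 (i + 1) = i + 1 ↔ i + 1 ∉ N.core := by
      rw [(hD.adj _ hiV).nx_root, mem_core, not_and]
      have hout : N.out (i + 1) = [] ↔ ¬ (N.nb (i + 1)).Nonempty := by
        rw [Finset.not_nonempty_iff_eq_empty, ← Finset.card_eq_zero, ← length_out,
          List.length_eq_zero_iff]
      constructor
      · intro h _
        rw [← hout]
        rcases headD_mem (N.out (i + 1)) (i + 1) with e | e
        · by_contra hne
          obtain ⟨a, l, hl⟩ := List.exists_cons_of_ne_nil hne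
          rw [hl, List.headD_cons] at h
          have := N.arc_gt (u := i + 1) (a := a) (by rw [hl]; simp)
          omega
        · rw [h] at e; have := N.arc_gt e; omega
      · intro h
        rw [hout.2 (h hiV)]; rfl
    refine hwp_cons (hwp_mono (Q' := fun t o ρ' D' k => o = [] ∧ k = 0 ∧ t ≤ 150 ∧ ρ' = ρ1 ∧
      Cands N D' (i + 1)) ?_ ?_)
    · have hval : deval M ρ1 D (fld 0 (.reg .i)) = D 0 (i + 1) := deval_fld_reg (by norm_num) e1
      refine hwp_ifThen ?_ (fun h0 => ?_) fun h0 => ?_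
      · rw [dfits_ne]
        exact ⟨dfits_fld_reg (by norm_num) e1 (by omega) (by omega), by simp [e1]; omega⟩
      · rw [deval_ne, hval, deval_reg, e1] at h0
        have hc : i + 1 ∈ N.core := by
          by_contra hn; rw [if_pos (hnx.2 hn)] at h0; exact h0 rfl
        have hlast : D 3 0 ≤ i := by
          rw [hD.list.pv_root]
          rcases getLastD_mem ((List.range' 1 i).filter (· ∈ N.core)) 0 with e | e
          · omega
          · have := List.mem_range'_1.1 (List.mem_of_mem_filter e); omega
        have hcnt : D 6 (i + 1) ≤ N.n + 2 * N.m := by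
          rw [hD.cnt _ hiV, if_neg (by omega), length_out]
          have h1 : N.nb (i + 1) ⊆ N.V := fun x hx => N.sub hx
          have h2 : N.V = Finset.Icc 1 N.n := by ext u; rw [N.mem_V, Finset.mem_Icc]
          have := Finset.card_le_card h1
          rw [h2, Nat.card_Icc] at this
          omega
        have hfld0 : ∀ {D1 : ℕ → ℕ → ℕ}, D1 3 0 = D 3 0 → deval M ρ1 D1 (fld 3 0) = D 3 0 := by
          intro D1 h1
          rw [deval_fld _ _ _ (by norm_num), ← h1]; rfl
        have hfit0 : ∀ {D1 : ℕ → ℕ → ℕ}, DFits M ρ1 D1 (fld 3 0) := fun {D1} =>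
          (dfits_fld M ρ1 D1 (by norm_num) _).2 ⟨by simp, by simp, by simp⟩
        simp only [inG, inC, EDSG.cnt, cprev, cnext]
        refine hwp_cons (hwp_store (by norm_num) (by simp [e1]; omega) (by simp [e1]; omega)
          (by simp) (by simp; omega) ?_)
        simp only [deval_reg, deval_ofNat, e1]
        intro _
        refine hwp_cons (hwp_store (by norm_num) (by simp [e1]; omega) (by simp [e1]; omega)
          (by simp) (by simp; omega) ?_)
        simp only [deval_reg, deval_ofNat, e1]
        intro _
        refine hwp_cons (hwp_store (by norm_num) (by simp [e1]; omega) (by simp [e1]; omega)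
          (by simp) ?_ ?_)
        · rw [dfits_add]
          refine ⟨dfits_fld_reg (by norm_num) e1 (by omega) (by omega), by simp; omega, ?_⟩
          rw [deval_fld_reg (by norm_num) e1]
          simp [setF_apply]; omega
        rw [deval_add, deval_fld_reg (by norm_num) e1]
        simp only [deval_reg, deval_ofNat, e1]
        intro _
        refine hwp_cons (hwp_store (by norm_num) (by simp [e1]; omega) (by simp [e1]; omega)
          (by simp) hfit0 ?_)
        rw [hfld0 (by simp [setF_apply])]
        simp only [deval_reg, e1]
        intro _
        refine hwp_cons (hwp_store (by norm_num) hfit0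
          (by rw [hfld0 (by simp [setF_apply])]; omega) (by simp) (by simp [e1]; omega) ?_)
        rw [hfld0 (by simp [setF_apply])]
        simp only [deval_reg, e1]
        intro _
        refine hwp_cons (hwp_store (by norm_num) (by simp) (by simp)
          (by simp) (by simp [e1]; omega) ?_)
        simp only [deval_reg, deval_ofNat, e1]
        intro _
        refine hwp_nil ⟨rfl, rfl, ?_, rfl, ?_⟩
        · simp only [cost_ne, cost_addr, cost_reg, cost_fld, cost_add, cost_ofNat]; omega
        · refine hD.succ_of_mem hc ?_ ?_ ?_ ?_ ?_ ?_ ?_ ?_ ?_ ?_ <;> ext x <;>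
            simp [setF_apply, Function.update_apply]
      · rw [deval_ne, hval, deval_reg, e1] at h0
        have hc : i + 1 ∉ N.core := by
          rw [← hnx]; by_contra hn; rw [if_neg hn] at h0; exact one_ne_zero h0
        exact ⟨rfl, rfl, by simp, rfl, hD.succ_of_notMem hc⟩
    rintro t1 o ρ' D1 k ⟨rfl, rfl, ht1, rfl, hD1⟩ _
    refine hwp_nil ?_
    intro _
    refine hwp_mono (ih (i + 1) D1 _ _ (by omega) e1 e2 hD1) ?_
    rintro t o ρ'' D' k ⟨rfl, rfl, ht, h1⟩
    refine ⟨by simp, by simp, ?_, h1⟩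
    simp only [cost_ne, cost_reg, cost_add, cost_ofNat]; omega

end build

end EDSG

/-! ### The initial state and the whole run -/

namespace EDSG

open RAM Reg

namespace SG
variable (G : SG)

theorem cl_subset_core {u : ℕ} (hu : u ∈ G.core) : G.cl u ⊆ G.core := by
  have h := Finset.mem_filter.1 hu
  refine Finset.insert_subset hu fun w hw => Finset.mem_filter.2 ⟨G.sub hw, ⟨u, G.symm hw⟩⟩

theorem verts_core : G.verts G.V G.core = G.core := by simp [verts]

/-- A vertex with a neighbour is dominated by itself and by that neighbour; an isolated vertex is
fixed and dominates itself. -/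
theorem inv_core : G.Inv G.V G.core where
  sub := Finset.filter_subset _ _
  subV := subset_rfl
  two u hu hd := by
    have huc : u ∈ G.core := by
      by_contra hn
      exact Finset.disjoint_left.1 hd (G.mem_cl_self u) (Finset.mem_sdiff.2 ⟨hu, hn⟩)
    obtain ⟨w, hw⟩ := (Finset.mem_filter.1 huc).2
    have : ({u, w} : Finset ℕ) ⊆ G.cl u ∩ G.V := by
      intro x hx
      simp only [Finset.mem_insert, Finset.mem_singleton] at hx
      rcases hx with rfl | rfl
      · exact Finset.mem_inter.2 ⟨G.mem_cl_self _, hu⟩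
      · exact Finset.mem_inter.2 ⟨G.mem_cl.2 (Or.inr hw), G.sub hw⟩
    have h2 := Finset.card_le_card this
    rwa [Finset.card_pair (ne_of_mem_nb hw).symm] at h2

theorem flagOK_core : G.FlagOK ∅ G.V G.core := by
  intro u hu
  rw [verts_core] at hu
  simp only [Finset.notMem_empty, false_iff, not_not]
  exact Finset.disjoint_of_subset_left (G.cl_subset_core hu) Finset.disjoint_sdiff

end SG

section main
variable {N : Net} {M : Mach} (hR : M.R = N.n + 2 * N.m)
include hR

theorem main_build (hin : IsInput N M.inp) {d T : ℕ} {ρ : Reg → ℕ} (hn : ρ .n = N.n)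
    (hm : ρ .m = N.m) (hd : N.core.card + 3 ≤ d) (hT : T + 2 * N.room N.core N.core ≤ M.S) :
    hwp M false d (block
      [ .set i 0,
        whileDo (ne i n)
          [ .set i (i + 1),
            .emit i,
            .store (addr nxt i) i,
            .store (addr prv i) i ],
        .set i 0,
        whileDo (ne i m)
          [ .set u (.inp (2 * i + 2)),
            .set w (.inp (2 * i + 3)),
            .set a (n + 2 * i + 1),
            .set b (n + 2 * i + 2),
            .store (addr twin a) b,
            .store (addr twin b) a,
            block (insertArc a u w),
            block (insertArc b w u),
            .set i (i + 1) ],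
        .set i 0,
        whileDo (ne i n)
          [ .set i (i + 1),
            ifThen (ne (fld nxt i) i)
              [ .store (addr inG i) 1,
                .store (addr inC i) 1,
                .store (addr cnt i) (fld cnt i + 1),
                .store (addr cprev i) (fld cprev 0),
                .store (addr cnext (fld cprev 0)) i,
                .store (addr cprev 0) i ] ],
        .call .allChildren 0 ]) ρ (fun _ _ => 0) T fun t o _ _ _ =>
      ∃ o', o = List.range' 1 N.n ++ o' ∧ Out N.n N.V (N.sols N.V N.core) o' ∧
        t ≤ 600 * (N.n + N.m + 1) + loopCost N.toSG N.V N.core := by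
  obtain ⟨e, rfl⟩ : ∃ e, d = e + 1 := ⟨d - 1, by omega⟩
  refine hwp_cons (hwp_set (by simp) ?_)
  simp only [deval_ofNat]
  intro _
  refine hwp_cons (hwp_mono (init_vertices hR N.n 0 _ _ _ (by omega) (by simp) (by simpa using hn)
    (fun r h1 h2 => by omega) (fun _ _ _ => rfl)) ?_)
  rintro t1 o1 ρ1 D1 k ⟨rfl, rfl, ht1, hn1, hm1, h01, hz1⟩ _
  simp only [Function.update_of_ne, ne_eq, reduceCtorEq, not_false_eq_true, hn, hm] at hn1 hm1
  refine hwp_cons (hwp_set (by simp) ?_)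
  simp only [deval_ofNat]
  intro _
  have hB : Built N M.inp D1 (2 * 0) := by
    refine ⟨fun u hu => ?_, fun u _ => hz1 6 (by norm_num) u, fun a h1 h2 => by omega,
      fun r _ => hz1 2 (by norm_num) r, fun r _ => hz1 3 (by norm_num) r, fun r => ?_⟩
    · exact DLL.nil (h01 u hu).1 (h01 u hu).2
    · exact ⟨hz1 4 (by norm_num) r, hz1 5 (by norm_num) r, hz1 7 (by norm_num) r,
        hz1 8 (by norm_num) r, hz1 9 (by norm_num) r⟩
  refine hwp_cons (hwp_mono (init_arcs hR hin N.m 0 D1 _ _ (by omega) (by simp) (by simpa using hn1)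
    (by simpa using hm1) hB (fun a h1 h2 => by omega)) ?_)
  rintro t2 o2 ρ2 D2 k ⟨rfl, rfl, ht2, hn2, hB2, htw⟩ _
  simp only [Function.update_of_ne, ne_eq, reduceCtorEq, not_false_eq_true, hn1] at hn2
  refine hwp_cons (hwp_set (by simp) ?_)
  simp only [deval_ofNat]
  intro _
  refine hwp_cons (hwp_mono (init_cands hR N.n 0 D2 _ _ (by omega) (by simp) (by simpa using hn2)
    (hB2.cands hin htw)) ?_)
  rintro t3 o3 ρ3 D3 k ⟨rfl, rfl, ht3, hC⟩ _
  have hrep := hC.rep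
  have hrep' : Rep N D3 (N.verts N.V N.core) N.core ∅ (fun _ => 0) (fun _ => 0) := by
    rw [N.verts_core]; exact hrep
  refine hwp_cons (hwp_call (by simp) (hwp_mono (allChildren_of_loop (SG.self_mem_sols N.inv_core)
    fun ρ' hρ' => allChildren_loop hR _ N.V N.core ∅ _ D3 _ ρ' e false rfl N.inv_core N.flagOK_core
      hrep' hρ' (by omega) (by rw [N.verts_core]; omega)) ?_))
  rintro t4 o4 - D4 k4 ⟨ho4, ht4⟩ _
  refine hwp_nil ⟨o4, by simp, ho4, ?_⟩
  simp only [cost_ofNat]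
  omega

/-- The first three statements are executed on the raw memory, since `Holds` is true only once the
top of the log has been stored. -/
theorem main_runs (hin : IsInput N M.inp) (hd : N.core.card + 3 ≤ M.S)
    (hT : 10 * (M.R + 1) + 2 * N.room N.core N.core ≤ M.S) :
    ∃ t o, edsG.Runs M.S M.inp t (List.range' 1 N.n ++ o) ∧
      Out N.n N.V (N.sols N.V N.core) o ∧
      t ≤ 700 * (N.n + N.m + 1) + loopCost N.toSG N.V N.core := by
  have hMS := M.hS
  have s1 := Exec.set (prog := edsG) (d := M.S) (r := Reg.n) (ρ := fun _ => 0) (μ := fun _ => 0)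
    (S := M.S) (input := M.inp) (e := .inp 0)
    (show Expr.Fits _ _ _ _ (.inp (.num 0)) from
      ⟨Nat.zero_le _, by change M.inp.getD 0 0 ≤ _; rw [hin.n_eq]; omega⟩)
  rw [show Expr.eval M.inp (fun _ => 0) (fun _ => 0) (.inp 0 : E) = N.n from hin.n_eq] at s1
  set ρ1 : Reg → ℕ := Function.update (fun _ => 0) Reg.n N.n with hρ1
  have s2 := Exec.set (prog := edsG) (d := M.S) (r := Reg.m) (ρ := ρ1) (μ := fun _ => 0)
    (S := M.S) (input := M.inp) (e := .inp 1)
    (show Expr.Fits _ _ _ _ (.inp (.num 1)) from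
      ⟨show 1 ≤ M.S by omega, by change M.inp.getD 1 0 ≤ _; rw [hin.m_eq]; omega⟩)
  rw [show Expr.eval M.inp ρ1 (fun _ => 0) (.inp 1 : E) = N.m from hin.m_eq] at s2
  set ρ2 : Reg → ℕ := Function.update ρ1 Reg.m N.m with hρ2
  have en : ρ2 .n = N.n := by simp [hρ2, hρ1]
  have em : ρ2 .m = N.m := by simp [hρ2]
  clear_value ρ2
  have s3 := Exec.store (prog := edsG) (d := M.S) (ρ := ρ2) (μ := fun _ => 0)
    (S := M.S) (input := M.inp) (a := 0) (e := 10 * (Reg.n + 2 * Reg.m + 1)) (Nat.zero_le _)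
    (show 0 < M.S by omega)
    (show Expr.Fits _ _ _ _ (.bin .mul (.num 10) (.bin .add (.bin .add (.reg Reg.n)
      (.bin .mul (.num 2) (.reg Reg.m))) (.num 1))) by
        simp only [Expr.Fits, Expr.eval, Op.eval, en, em]
        refine ⟨?_, ⟨⟨?_, ⟨?_, ?_, ?_⟩, ?_⟩, ?_, ?_⟩, ?_⟩ <;> omega)
  have ev : Expr.eval M.inp ρ2 (fun _ => 0) (10 * (Reg.n + 2 * Reg.m + 1) : E) = 10 * (M.R + 1) := by
    change 10 * (ρ2 .n + 2 * ρ2 .m + 1) = _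
    rw [en, em, hR]
  rw [ev, show Expr.eval M.inp ρ2 (fun _ => 0) (0 : E) = 0 from rfl] at s3
  obtain ⟨t, o, ρ', μ', D', k, h1, -, -, -, o', rfl, ho, ht⟩ := main_build hR hin en em hd hT
    (Function.update (fun _ => 0) 0 (10 * (M.R + 1))) ⟨by simp, le_rfl, by omega, fun f _ r _ h => by
      rw [Function.update_of_ne (by omega)]; exact ⟨rfl, Nat.zero_le _⟩⟩
  have hex := Exec.seq s1 (Exec.seq s2 (Exec.seq s3 h1))
  simp only [List.nil_append] at hex
  refine ⟨_, o', ⟨ρ', μ', hex⟩, ho, ?_⟩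
  have c1 : (Expr.inp 0 : E).cost = 2 := rfl
  have c2 : (Expr.inp 1 : E).cost = 2 := rfl
  have c3 : (10 * (Reg.n + 2 * Reg.m + 1) : E).cost = 9 := rfl
  have c4 : (0 : E).cost = 1 := rfl
  rw [c1, c2, c3, c4]
  omega

end main

end EDSG

namespace EDSG

/-! ## The theorem -/

theorem decode_range' (n : ℕ) (l : List ℕ) : ∀ (j i : ℕ),
    decode (hat n (Finset.Ico 1 (i + 1))) (List.range' (i + 1) j ++ l) =
      decode (hat n (Finset.Ico 1 (i + j + 1))) l
  | 0, i => by simp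
  | j + 1, i => by
      have e : symmDiff (Finset.Ico 1 (i + 1)) {i + 1} = Finset.Ico 1 (i + 1 + 1) := by
        ext x; simp only [Finset.mem_symmDiff, Finset.mem_Ico, Finset.mem_singleton]; omega
      rw [List.range'_succ, List.cons_append, decode_flip (by omega), e, decode_range' n l j (i + 1)]
      congr 3; omega

theorem hat_injOn (n : ℕ) {X Y : Finset ℕ} (hX : X ⊆ Finset.Icc 1 n) (hY : Y ⊆ Finset.Icc 1 n)
    (h : hat n X = hat n Y) : X = Y := by
  have key : ∀ {A B : Finset ℕ}, A ⊆ Finset.Icc 1 n → hat n A = hat n B → A ⊆ B := by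
    intro A B hA he x hx
    have := Finset.mem_Icc.1 (hA hx)
    have hm : (⟨x - 1, by omega⟩ : Fin n) ∈ hat n A := mem_hat.2 (by
      rw [show x - 1 + 1 = x by omega]; exact hx)
    rw [he, mem_hat, show x - 1 + 1 = x by omega] at hm
    exact hm
  exact (key hX h).antisymm (key hY h.symm)

section
variable {n : ℕ} {G : SimpleGraph (Fin n)}

theorem isDominatingSet_hat (hG : 9 ≤ G.egirth) {X : Finset ℕ} :
    G.IsDominatingSet (hat n X) ↔ (wordGraph G hG).Dom X := by
  constructor
  · intro h u hu
    have hu := Finset.mem_Icc.1 (show u ∈ Finset.Icc 1 n from hu)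
    obtain ⟨v, rfl⟩ : ∃ v : Fin n, (v : ℕ) + 1 = u := ⟨⟨u - 1, by omega⟩, by simp; omega⟩
    rcases h v with h | ⟨w, h1, h2⟩
    · exact ⟨_, SG.mem_cl_self _ _, mem_hat.1 h⟩
    · exact ⟨(w : ℕ) + 1, (SG.mem_cl _).2 (Or.inr (mem_wordNb'.2 h2.symm)), mem_hat.1 h1⟩
  · intro h v
    obtain ⟨x, h1, h2⟩ := h ((v : ℕ) + 1) (Finset.mem_Icc.2 ⟨by omega, v.2⟩)
    rcases (SG.mem_cl _).1 h1 with rfl | h1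
    · exact Or.inl (mem_hat.2 h2)
    · obtain ⟨j, i, hj, rfl, hji⟩ := mem_wordNb.1 h1
      rw [Fin.ext (show (j : ℕ) = v by omega)] at hji
      exact Or.inr ⟨i, mem_hat.2 h2, hji.symm⟩

/-- Only an isolated vertex itself can dominate it, so the condition that fixed vertices belong to
the solution is automatic. -/
theorem mem_sols_core (hG : 9 ≤ G.egirth) {X : Finset ℕ} :
    X ∈ (wordGraph G hG).sols (wordGraph G hG).V (wordGraph G hG).core ↔
      X ⊆ Finset.Icc 1 n ∧ G.IsDominatingSet (hat n X) := by
  rw [SG.mem_sols, isDominatingSet_hat hG]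
  refine and_congr_right fun hX => ⟨fun h => h.2, fun h => ⟨fun u hu => ?_, h⟩⟩
  obtain ⟨hu, hn⟩ := Finset.mem_sdiff.1 hu
  obtain ⟨x, hx, hxX⟩ := h u hu
  rcases (SG.mem_cl _).1 hx with rfl | hx
  · exact hxX
  · exact absurd (Finset.mem_filter.2 ⟨hu, ⟨x, hx⟩⟩) hn

theorem exists_hat (D : Finset (Fin n)) : ∃ X ⊆ Finset.Icc 1 n, hat n X = D := by
  refine ⟨D.image fun i : Fin n => (i : ℕ) + 1, fun x hx => ?_, ?_⟩
  · obtain ⟨i, -, rfl⟩ := Finset.mem_image.1 hx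
    exact Finset.mem_Icc.2 ⟨by omega, i.2⟩
  · ext i
    rw [mem_hat, Finset.mem_image]
    constructor
    · rintro ⟨j, hj, e⟩
      rwa [Fin.ext (show (j : ℕ) = i by omega)] at hj
    · exact fun h => ⟨i, h, rfl⟩

variable {es : List (Fin n × Fin n)}

theorem length_edgeList (hes : G.IsEdgeList es) : es.length = G.edgeSet.ncard := by
  have : G.edgeSet = ((es.map fun e => s(e.1, e.2)).toFinset : Set (Sym2 (Fin n))) := by
    ext e; rw [Finset.mem_coe, List.mem_toFinset, hes.2]
  rw [this, Set.ncard_coe_finset, List.toFinset_card_of_nodup hes.1, List.length_map]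

theorem length_edgeList_le (hes : G.IsEdgeList es) : es.length ≤ n ^ 2 := by
  classical
  rw [length_edgeList hes, Set.ncard_eq_toFinset_card']
  have h1 := G.card_edgeFinset_le_card_choose_two
  have h2 := Nat.choose_le_pow n 2
  rw [Fintype.card_fin] at h1
  exact h1.trans h2

theorem inputNet_isInput (hG : 9 ≤ G.egirth) (hes : G.IsEdgeList es) :
    IsInput (inputNet hG hes) (encode n es) where
  n_eq := rfl
  m_eq := rfl
  out_eq _ := rfl
  hd_eq _ := rfl
  tw_eq _ := rfl
  tail_mem a h1 h2 := by
    change n < a at h1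
    change a ≤ n + 2 * es.length at h2
    obtain ⟨i, hi, x, y, h, -⟩ := exists_edge h1 h2
    change arcTail (encode n es) n a ∈ Finset.Icc 1 n
    rw [h, Finset.mem_Icc]
    have := x.2
    omega

end

theorem sum_degrees_le (N : Net) : ∑ u ∈ N.V, (N.nb u).card ≤ 2 * N.m := by
  classical
  have h : ∀ u ∈ N.V, (N.nb u).card = (N.out u).toFinset.card := fun u _ => by
    rw [← length_out, List.toFinset_card_of_nodup (N.out_nodup u)]
  rw [Finset.sum_congr rfl h, ← Finset.card_biUnion]
  · have hs : (N.V.biUnion fun u => (N.out u).toFinset) ⊆ Finset.Ioc N.n (N.n + 2 * N.m) := by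
      intro a ha
      obtain ⟨u, -, ha⟩ := Finset.mem_biUnion.1 ha
      rw [List.mem_toFinset] at ha
      exact Finset.mem_Ioc.2 ⟨N.arc_gt ha, N.arc_le ha⟩
    have := Finset.card_le_card hs
    rw [Nat.card_Ioc] at this
    omega
  · intro u _ v _ hne
    rw [Function.onFun, Finset.disjoint_left]
    intro a h1 h2
    rw [List.mem_toFinset] at h1 h2
    exact hne (N.tail_unique h1 h2)

theorem card_V (N : Net) : N.V.card = N.n := by
  have : N.V = Finset.Icc 1 N.n := by ext u; rw [N.mem_V, Finset.mem_Icc]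
  rw [this, Nat.card_Icc]; omega

theorem room_core_le (N : Net) : N.room N.core N.core ≤ 9 * N.n + 20 * N.m := by
  have hs : N.core ⊆ N.V := Finset.filter_subset _ _
  have h1 := Finset.card_le_card hs
  have h2 := card_V N
  have h3 := sum_degrees_le N
  have h4 : ∑ u ∈ N.core, (N.nb u).card ≤ ∑ u ∈ N.V, (N.nb u).card :=
    Finset.sum_le_sum_of_subset hs
  have h5 : N.arcs N.core ≤ ∑ u ∈ N.core, (N.nb u).card :=
    Finset.sum_le_sum fun u _ => Finset.card_le_card Finset.inter_subset_left
  -- The candidates contribute at most `8 * (n + 2 * m)`, the graph at most `2 * (2 * m) + n`.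
  unfold SG.room SG.pot
  rw [Finset.sum_add_distrib, Finset.sum_const, smul_eq_mul]
  omega

end EDSG

theorem mainTheorem2 :
    ∃ c : ℕ, ∀ (n : ℕ) (G : SimpleGraph (Fin n)) (es : List (Fin n × Fin n)),
      G.IsEdgeList es → 9 ≤ G.egirth →
        ∃ (t : ℕ) (out : List ℕ),
          EDSG.edsG.Runs (c * (n + G.edgeSet.ncard + 1)) (EDSG.encode n es) t out ∧
          (EDSG.decode (∅ : Finset (Fin n)) out).Nodup ∧
          (∀ D : Finset (Fin n), D ∈ EDSG.decode ∅ out ↔ G.IsDominatingSet D) ∧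
          t ≤ c * ({D : Finset (Fin n) | G.IsDominatingSet D}.ncard + n + G.edgeSet.ncard) ∧
          ((∀ v, ∃ w, G.Adj v w) →
            t ≤ c * {D : Finset (Fin n) | G.IsDominatingSet D}.ncard) := by
  classical
  -- The factor `10 ^ 13` of `loopCost_le` is the largest constant to be covered; the rest is slack
  -- for the set-up and the memory.
  refine ⟨10 ^ 17, fun n G es hes hG => ?_⟩
  have hm := EDSG.length_edgeList hes
  rw [← hm]
  let N := EDSG.inputNet hG hes
  have hNn : N.n = n := rfl
  have hNm : N.m = es.length := rfl
  have hroom := EDSG.room_core_le N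
  have hcore : N.core.card ≤ n := (Finset.card_le_card (Finset.filter_subset _ _)).trans
    (EDSG.card_V N).le
  let M : EDSG.Mach := ⟨10 ^ 17 * (n + es.length + 1), EDSG.encode n es, n + 2 * es.length, by omega⟩
  obtain ⟨t, o, hrun, ⟨L, hL, hLmem, hdec⟩, ht⟩ := EDSG.main_runs (N := N) (M := M) rfl
    (EDSG.inputNet_isInput hG hes) (by change _ ≤ 10 ^ 17 * (n + es.length + 1); omega)
    (by change 10 * (n + 2 * es.length + 1) + _ ≤ 10 ^ 17 * (n + es.length + 1); omega)
  have hmem : ∀ X, X ∈ L ↔ X ⊆ Finset.Icc 1 n ∧ G.IsDominatingSet (EDSG.hat n X) := fun X => by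
    rw [hLmem]; exact EDSG.mem_sols_core hG
  have hout : EDSG.decode (∅ : Finset (Fin n)) (List.range' 1 n ++ o) = L.map (EDSG.hat n) := by
    have h1 := EDSG.decode_range' n o n 0
    have h2 := hdec []
    have hV : N.V = Finset.Ico 1 (0 + n + 1) := by
      rw [Nat.zero_add]; exact (Finset.Ico_add_one_right_eq_Icc 1 n).symm
    rw [hV, List.append_nil] at h2
    have h0 : (∅ : Finset (Fin n)) = EDSG.hat n (Finset.Ico 1 (0 + 1)) := by
      ext i; simp [EDSG.mem_hat]
    rw [h0]
    refine h1.trans (h2.trans ?_)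
    simp [EDSG.decode]
    rfl
  have hnd : (L.map (EDSG.hat n)).Nodup := (List.nodup_map_iff_inj_on hL).2 fun X hX Y hY e =>
    EDSG.hat_injOn n ((hmem X).1 hX).1 ((hmem Y).1 hY).1 e
  have hdom : ∀ D : Finset (Fin n), D ∈ L.map (EDSG.hat n) ↔ G.IsDominatingSet D := by
    intro D
    rw [List.mem_map]
    constructor
    · rintro ⟨X, hX, rfl⟩; exact ((hmem X).1 hX).2
    · intro hD
      obtain ⟨X, hX, rfl⟩ := EDSG.exists_hat D
      exact ⟨X, (hmem X).2 ⟨hX, hD⟩, rfl⟩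
  have hcard : {D : Finset (Fin n) | G.IsDominatingSet D}.ncard = (N.sols N.V N.core).card := by
    have h1 : {D : Finset (Fin n) | G.IsDominatingSet D} = ((L.map (EDSG.hat n)).toFinset : Set _) := by
      ext D; rw [Finset.mem_coe, List.mem_toFinset, hdom]; rfl
    have h2 : N.sols N.V N.core = L.toFinset := by ext X; rw [List.mem_toFinset, hLmem]
    rw [h1, Set.ncard_coe_finset, List.toFinset_card_of_nodup hnd, List.length_map, h2,
      List.toFinset_card_of_nodup hL]
  have hcost := EDSG.SG.loopCost_le _ N.V N.core rfl N.inv_core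
  have hpos := Finset.card_pos.2 ⟨_, EDSG.SG.self_mem_sols N.inv_core⟩
  rw [hcard]
  rw [hNn, hNm] at ht
  refine ⟨t, List.range' 1 n ++ o, hrun, by rw [hout]; exact hnd, fun D => by rw [hout, hdom], ?_, ?_⟩
  · omega
  · intro hiso
    have hcV : N.core = N.V := by
      refine Finset.filter_true_of_mem fun u hu => ?_
      have hu := Finset.mem_Icc.1 (show u ∈ Finset.Icc 1 n from hu)
      obtain ⟨v, rfl⟩ : ∃ v : Fin n, (v : ℕ) + 1 = u := ⟨⟨u - 1, by omega⟩, by simp; omega⟩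
      obtain ⟨w, hw⟩ := hiso v
      exact ⟨_, EDSG.mem_wordNb'.2 hw⟩
    have hc : N.core.card = n := by rw [hcV]; exact EDSG.card_V N
    -- Now the potential in `hcost` is `384 * 10 ^ 6 * n ^ 2`. Together with the constant it absorbs
    -- the set-up time `700 * (n + m + 1)`, as `n` and `m` are at most `n ^ 2`.
    rw [hc] at hcost
    have h1 := EDSG.length_edgeList_le hes
    have h2 : n ≤ n ^ 2 := Nat.le_self_pow (by norm_num) n
    omega
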